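/- Let $(X,d)$ be a compact metric space with a Borel probability measure $m$, and let $\mathrm{e}_t(\gamma)=\gamma_t$ on $C([0,1],X)$. An optimal geodesic plan from $\mu$ to $\nu$ is a Borel probability measure $\pi$ on $C([0,1],X)$, concentrated on constant speed geodesics, such that $(\mathrm{e}_0,\mathrm{e}_1)_\sharp\pi$ is an optimal coupling of $\mu,\nu$ for the cost $d^2$; write $\pi\in\mathrm{GeoOpt}(\mu,\nu)$. Let $\mathrm{Ent}_m(\mu)=\int f\log f\,dm$ if $\mu=fm$ and $+\infty$ otherwise. Assume that $(X,d,m)$ is a strong $CD(K,\infty)$ space for some $K\in\mathbb R$: for all probability measures $\mu_0,\mu_1$ with finite entropy there is $\pi\in\mathrm{GeoOpt}(\mu_0,\mu_1)$ such that for every bounded Borel $F\ge 0$ with $\int F\,d\pi=1$ the measures $\mu^F_t=(\mathrm{e}_t)_\sharp(F\pi)$ satisfy $$\mathrm{Ent}_m(\mu_t^F)\le(1-t)\,\mathrm{Ent}_m(\mu_0^F)+t\,\mathrm{Ent}_m(\mu_1^F)-\tfrac K2t(1-t)W_2^2(\mu_0^F,\mu_1^F)\qquad\text{for all }t\in[0,1].$$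 A test plan is a Borel probability measure $\pi$ on $C([0,1],X)$, concentrated on the absolutely continuous curves with square integrable metric speed $|\dot\gamma_t|$, with $\iint_0^1|\dot\gamma_t|^2\,dt\,d\pi<\infty$ and $(\mathrm{e}_t)_\sharp\pi\le C\,m$ for all $t$ and some constant $C$. A property holds for almost every curve if it holds $\pi$-a.e. for every test plan $\pi$. A Borel function $g:X\to[0,\infty]$ is a weak upper gradient of $f:X\to\mathbb R$ if $|f(\gamma_1)-f(\gamma_0)|\le\int_0^1g(\gamma_t)|\dot\gamma_t|\,dt<\infty$ for almost every curve $\gamma$. If $f$ is Sobolev along almost every curve (that is, for almost every $\gamma$ the function $f\circ\gamma$ agrees with an absolutely continuous function a.e. in $[0,1]$ and at $0,1$), the minimal weak upper gradient $|Df|_w$ is the weak upper gradient that is $m$-a.e. below every other one. Let $|Df|(x)=\limsup_{y\to x}|f(y)-f(x)|/d(x,y)$ and $|D^+f|(x)=\limsup_{y\to x}[f(y)-f(x)]^+/d(x,y)$ (both $0$ at isolated points). A relaxed slope of $f\in L^2(m)$ is a $G\in L^2(m)$ with $G\ge\tilde G$ $m$-a.e., where $\tilde G$ is the weak $L^2(m)$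 limit of $|Df_n|$ for some Lipschitz $f_n\to f$ in $L^2(m)$; the minimal relaxed slope $|Df|_*$ is the one of least $L^2(m)$ norm. A Kantorovich potential for $(\mu,\nu)$ is a $c$-concave function $\psi:X\to\mathbb R$ (that is, $\psi=\theta^c$ for some $\theta:X\to\mathbb R$) that maximizes $\int\psi\,d\mu+\int\psi^c\,d\nu$ among Lipschitz functions, where $\psi^c(y)=\inf_x\big(\tfrac12d^2(x,y)-\psi(x)\big)$. Let $f_0,f_1$ be probability densities with respect to $m$ and $\varphi$ any Kantorovich potential for $(f_0m,f_1m)$. Then $|D\varphi|_w$ and $|D\varphi|_*$ exist, and for every $\pi\in\mathrm{GeoOpt}(f_0m,f_1m)$ $$d(\gamma_0,\gamma_1)=|D\varphi|_w(\gamma_0)=|D^+\varphi|(\gamma_0)\qquad\text{for }\pi\text{-a.e. }\gamma .$$ In particular $$W_2^2(f_0m,f_1m)=\int_X|D\varphi|_*^2\,f_0\,dm=\int_X|D\varphi|_w^2\,f_0\,dm .$$ If moreover $f_0,f_1\in L^\infty(m)$, then $\mathrm{GeoOpt}(f_0m,f_1m)$ contains a test plan, and for every $\pi\in\mathrm{GeoOpt}(f_0m,f_1m)$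 that is a test plan $$\lim_{t\downarrow0}\frac{\varphi(\gamma_0)-\varphi(\gamma_t)}{d(\gamma_0,\gamma_t)}=|D^+\varphi|(\gamma_0)\qquad\text{in }L^2(\pi),$$ the quotient being read as $0$ when $\gamma_t=\gamma_0$. -/

import Mathlib

open MeasureTheory Filter Topology Set
open scoped ENNReal NNReal unitInterval

namespace MetricBrenier

/-- The space `C([0,1], X)` of continuous curves carries the Borel σ-algebra of the topology of
uniform convergence. -/
instance curveMeasurableSpace {X : Type*} [TopologicalSpace X] : MeasurableSpace C(I, X) :=
  borel _

instance curveBorelSpace {X : Type*} [TopologicalSpace X] : BorelSpace C(I, X) := ⟨rfl⟩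

section Curves

variable {Y : Type*} [MetricSpace Y]

/-- Absolutely continuous maps `[0,1] → Y`: there is `g ∈ L¹(0,1)` with
`d(γ_s, γ_t) ≤ ∫_s^t g` for all `s ≤ t`. -/
def IsAbsCts (γ : I → Y) : Prop :=
  ∃ g : ℝ → ℝ, IntervalIntegrable g volume 0 1 ∧
    ∀ s t : I, s ≤ t → dist (γ s) (γ t) ≤ ∫ r in (s : ℝ)..(t : ℝ), g r

/-- The metric speed `|γ̇_t|`. It is written as a limsup, so that it is defined for all `t`; along
an absolutely continuous curve the limit exists for a.e. `t`. -/
noncomputable def metricSpeed (γ : I → Y) (t : I) : ℝ≥0∞ :=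
  limsup (fun s : I => edist (γ s) (γ t) / edist s t) (𝓝[≠] t)

/-- The class `AC²([0,1], Y)`: absolutely continuous curves with square integrable speed. -/
def IsAC2 (γ : C(I, Y)) : Prop :=
  IsAbsCts γ ∧ (∫⁻ t : I, metricSpeed γ t ^ 2) < ∞

/-- The curve integral `∫_γ g = ∫₀¹ g(γ_t) |γ̇_t| dt`. -/
noncomputable def curveIntegral (g : Y → ℝ≥0∞) (γ : C(I, Y)) : ℝ≥0∞ :=
  ∫⁻ t : I, g (γ t) * metricSpeed γ t

/-- Constant speed geodesics parametrized by `[0,1]`. -/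
def IsGeodesic (γ : C(I, Y)) : Prop :=
  ∀ s t : I, dist (γ s) (γ t) = |(s : ℝ) - (t : ℝ)| * dist (γ 0) (γ 1)

/-- The slope `|Df|(x) = limsup_{y → x} |f(y) - f(x)| / d(y, x)` (equal to `0` at isolated
points). -/
noncomputable def metricSlope (f : Y → ℝ) (x : Y) : ℝ≥0∞ :=
  limsup (fun y => ENNReal.ofReal |f y - f x| / edist y x) (𝓝[≠] x)

/-- The ascending slope `|D⁺f|(x) = limsup_{y → x} [f(y) - f(x)]⁺ / d(y, x)` (equal to `0` at
isolated points). `ENNReal.ofReal` takes the positive part. -/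
noncomputable def ascSlope (f : Y → ℝ) (x : Y) : ℝ≥0∞ :=
  limsup (fun y => ENNReal.ofReal (f y - f x) / edist y x) (𝓝[≠] x)

end Curves

section Transport

variable {X : Type*} [MetricSpace X] [MeasurableSpace X]

/-- `γ` is a coupling of `μ` and `ν`. -/
def IsCoupling (μ ν : Measure X) (γ : Measure (X × X)) : Prop :=
  γ.map Prod.fst = μ ∧ γ.map Prod.snd = ν

/-- The quadratic cost `∫ d²(x, y) dγ(x, y)`. -/
noncomputable def cost (γ : Measure (X × X)) : ℝ≥0∞ :=
  ∫⁻ p, edist p.1 p.2 ^ 2 ∂γ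

/-- `γ ∈ Opt(μ, ν)`: a coupling of minimal cost. -/
def IsOptimalCoupling (μ ν : Measure X) (γ : Measure (X × X)) : Prop :=
  IsCoupling μ ν γ ∧ ∀ γ', IsCoupling μ ν γ' → cost γ ≤ cost γ'

/-- The Wasserstein distance `W₂(μ, ν)`. The infimum is finite when `μ`, `ν` are probability
measures on a compact space. -/
noncomputable def W2 (μ ν : Measure X) : ℝ :=
  Real.sqrt (⨅ (γ : Measure (X × X)) (_ : IsCoupling μ ν γ), cost γ).toReal

/-- The `c`-transform `ψᶜ(y) = inf_x (d²(x, y) / 2 - ψ(x))`. -/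
noncomputable def cTransform (ψ : X → ℝ) (y : X) : ℝ :=
  ⨅ x, (dist x y ^ 2 / 2 - ψ x)

/-- `ψ : X → ℝ` is `c`-concave: `ψ = θᶜ` for some `θ : X → ℝ`, the infima being finite. -/
def IsCConcave (ψ : X → ℝ) : Prop :=
  ∃ θ : X → ℝ, ∀ y, BddBelow (range fun x => dist x y ^ 2 / 2 - θ x) ∧ ψ y = cTransform θ y

/-- The dual functional `∫ ψ dμ + ∫ ψᶜ dν`. -/
noncomputable def dualFunctional (μ ν : Measure X) (ψ : X → ℝ) : ℝ :=
  ∫ x, ψ x ∂μ + ∫ y, cTransform ψ y ∂ν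

/-- Kantorovich potentials for `(μ, ν)`: `c`-concave functions that maximize the dual functional
among all Lipschitz functions. -/
def IsKantorovichPotential (μ ν : Measure X) (ψ : X → ℝ) : Prop :=
  IsCConcave ψ ∧
    ∀ ψ' : X → ℝ, (∃ L : ℝ≥0, LipschitzWith L ψ') →
      dualFunctional μ ν ψ' ≤ dualFunctional μ ν ψ

/-- Optimal geodesic plans: probability measures on `C([0,1], X)` concentrated on geodesics, whose
endpoints are coupled optimally. -/
structure IsOptGeodPlan (μ ν : Measure X) (π : Measure C(I, X)) : Prop where
  prob : IsProbabilityMeasure π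
  geodesic : ∀ᵐ γ ∂π, IsGeodesic γ
  optimal : IsOptimalCoupling μ ν (π.map fun γ => (γ 0, γ 1))

/-- The relative entropy of a probability measure `μ` with respect to the probability measure `m`:
`∫ f log f dm` if `μ = f m`, and `∞` if `μ` is not absolutely continuous. -/
noncomputable def Ent (m μ : Measure X) : ℝ≥0∞ := InformationTheory.klDiv μ m

/-- The time marginal `μ_t^F = (e_t)_♯ (F π)` of a weighted plan. -/
noncomputable def weightedMarginal (π : Measure C(I, X)) (F : C(I, X) → ℝ≥0) (t : I) : Measure X :=
  (π.withDensity fun γ => (F γ : ℝ≥0∞)).map fun γ => γ t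

/-- The strong `CD(K, ∞)` condition. (Weights on the set of geodesics are written as weights on
all curves, which is the same since the plan is concentrated on geodesics.) -/
def StrongCD (m : Measure X) (K : ℝ) : Prop :=
  ∀ μ₀ μ₁ : Measure X, IsProbabilityMeasure μ₀ → IsProbabilityMeasure μ₁ →
    Ent m μ₀ < ∞ → Ent m μ₁ < ∞ →
    ∃ π : Measure C(I, X), IsOptGeodPlan μ₀ μ₁ π ∧
      ∀ F : C(I, X) → ℝ≥0, Measurable F → (∃ C : ℝ≥0, ∀ γ, F γ ≤ C) →
        ∫⁻ γ, (F γ : ℝ≥0∞) ∂π = 1 →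
        ∀ t : I,
          (Ent m (weightedMarginal π F t) : EReal) ≤
            ((1 - t : ℝ) : EReal) * (Ent m (weightedMarginal π F 0) : EReal) +
              ((t : ℝ) : EReal) * (Ent m (weightedMarginal π F 1) : EReal) -
              ((K / 2 * t * (1 - t) *
                W2 (weightedMarginal π F 0) (weightedMarginal π F 1) ^ 2 : ℝ) : EReal)

end Transport

section Gradients

variable {X : Type*} [MetricSpace X] [MeasurableSpace X]

/-- Test plans: probability measures on curves concentrated on `AC²`, with finite total energy and
time marginals bounded by a fixed multiple of `m`. -/
structure IsTestPlan (m : Measure X) (π : Measure C(I, X)) : Prop where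
  prob : IsProbabilityMeasure π
  ac : ∀ᵐ γ ∂π, IsAC2 γ
  energy : (∫⁻ γ, (∫⁻ t : I, metricSpeed γ t ^ 2) ∂π) < ∞
  compression : ∃ C : ℝ≥0, ∀ t : I, π.map (fun γ => γ t) ≤ C • m

/-- `P` holds for almost every curve: it fails on a set that is null for every test plan. -/
def AlmostEveryCurve (m : Measure X) (P : C(I, X) → Prop) : Prop :=
  ∀ π : Measure C(I, X), IsTestPlan m π → ∀ᵐ γ ∂π, P γ

/-- `g : X → [0, ∞]` is a weak upper gradient of `f`:
`|f(γ₁) - f(γ₀)| ≤ ∫_γ g < ∞` for almost every curve `γ`. -/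
structure IsWeakUpperGradient (m : Measure X) (f : X → ℝ) (g : X → ℝ≥0∞) : Prop where
  measurable : Measurable g
  bound : AlmostEveryCurve m fun γ =>
    ENNReal.ofReal |f (γ 1) - f (γ 0)| ≤ curveIntegral g γ ∧ curveIntegral g γ < ∞

/-- `f` is Sobolev along almost every curve: for a.e. `γ`, `f ∘ γ` coincides a.e. in `[0,1]` and
at the two endpoints with an absolutely continuous function. -/
def IsSobolevAlongCurves (m : Measure X) (f : X → ℝ) : Prop :=
  AlmostEveryCurve m fun γ =>
    ∃ h : I → ℝ, IsAbsCts h ∧ (∀ᵐ t : I, f (γ t) = h t) ∧ f (γ 0) = h 0 ∧ f (γ 1) = h 1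

/-- `G` is (a representative of) the minimal weak upper gradient `|Df|_w`. -/
structure IsMinimalWeakUpperGradient (m : Measure X) (f : X → ℝ) (G : X → ℝ≥0∞) : Prop where
  sobolev : IsSobolevAlongCurves m f
  isWeakUpperGradient : IsWeakUpperGradient m f G
  minimal : ∀ G' : X → ℝ≥0∞, IsWeakUpperGradient m f G' → G ≤ᵐ[m] G'

/-- `G ∈ L²(m)` is a relaxed slope of `f ∈ L²(m)`: it dominates a weak `L²(m)` limit of the slopes
of Lipschitz functions that converge to `f` in `L²(m)`. -/
def IsRelaxedSlope (m : Measure X) (f : X → ℝ) (G : X → ℝ) : Prop :=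
  MemLp f 2 m ∧ MemLp G 2 m ∧
    ∃ (G' : X → ℝ) (u : ℕ → X → ℝ), MemLp G' 2 m ∧
      (∀ n, ∃ L : ℝ≥0, LipschitzWith L (u n)) ∧
      Tendsto (fun n => eLpNorm (fun x => u n x - f x) 2 m) atTop (𝓝 0) ∧
      (∀ h : X → ℝ, MemLp h 2 m →
        Tendsto (fun n => ∫ x, (metricSlope (u n) x).toReal * h x ∂m) atTop
          (𝓝 (∫ x, G' x * h x ∂m))) ∧
      G' ≤ᵐ[m] G

/-- `G` is (a representative of) the minimal relaxed slope `|Df|_*`: a relaxed slope of minimal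
`L²(m)` norm. -/
def IsMinimalRelaxedSlope (m : Measure X) (f : X → ℝ) (G : X → ℝ) : Prop :=
  IsRelaxedSlope m f G ∧
    ∀ G' : X → ℝ, IsRelaxedSlope m f G' → eLpNorm G 2 m ≤ eLpNorm G' 2 m

end Gradients

end MetricBrenier

open MetricBrenier

namespace MetricBrenier

/-! ### Measurability of limsups over punctured neighbourhoods -/

/-! Everything is read off the contact set of `φ`, the pairs with φ(x) + φᶜ(y) = d²(x,y)/2.
Kantorovich duality (Hahn–Banach and Riesz–Markov) puts every optimal coupling on it. Expanding the
squared distance at a contact pair gives |D⁺φ|(x) ≤ d(x,y) (`ascSlope_le_of_mem_contactSet`). The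
ascending slope of a Lipschitz function is a weak upper gradient, so |Dφ|_w ≤ |D⁺φ| m-a.e. Hence
|Dφ|_w(x) ≤ |D⁺φ|(x) ≤ d(x,y) a.e. for an optimal coupling with absolutely continuous first
marginal, and only an integrated inequality in the opposite direction is missing.

That inequality comes from an optimal geodesic plan π that is a test plan. Along a geodesic with
endpoints in contact, φ(γ_0) - φ(γ_t) ≥ (t - t²/2) d²(γ_0,γ_1), while the upper gradient property on
[0,t] bounds the left side by d(γ_0,γ_1) ∫_0^t |Dφ|_w(γ_r) dr. Divide by t d(γ_0,γ_1), integrate and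
let t ↓ 0: the marginals of a test plan are continuous in time against L¹(m), so ∫ d(γ_0,γ_1) dπ ≤ ∫
|Dφ|_w(γ_0) dπ, and equality holds throughout (`IsOptGeodPlan.ae_eq_of_isTestPlan`). The same
squeeze makes the difference quotients converge in L¹(π), hence in L²(π) because they are bounded.

Strong CD supplies such plans between bounded densities. Condition the plan on {γ_t ∈ A}: the
entropy at time t is at least -log m(A), and convexity bounds it by the endpoint entropies, so the
mass of A is at most a constant times m(A). Other couplings on the contact set have the same cost
and the same integral of |Dφ|_w², which sees only the first marginal; so the equality transfers to
them. Unbounded densities are handled by restricting an optimal coupling to the pairs where both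
densities are at most n; the restriction stays on the contact set.

For |Dφ|_*, a least slope is built by projections in L²(m). It is a weak upper gradient, so it
dominates |Dφ|_w. It is at most the distance to the nearest contact point: the Hopf–Lax functions
Q_t φᶜ, t ↑ 1, have slope at most that distance over t, and they can be glued to an optimal sequence
with Lipschitz cutoffs (`IsLeastSlope.ae_le_contactDist`). On an optimal coupling therefore d =
|Dφ|_w ≤ |Dφ|_* ≤ d. -/

lemma iSup_open_eq_iSup_dense {Y : Type*} [TopologicalSpace Y] {D U : Set Y} (hD : Dense D)
    (hU : IsOpen U) {q : Y → ℝ≥0∞} (hq : ContinuousOn q U) :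
    ⨆ y ∈ U, q y = ⨆ y ∈ D, U.indicator q y := by
  apply le_antisymm
  · refine iSup₂_le fun y hy => ?_
    by_contra hlt
    push Not at hlt
    have hopen : IsOpen (U ∩ q ⁻¹' Ioi (⨆ y ∈ D, U.indicator q y)) :=
      hq.isOpen_inter_preimage hU isOpen_Ioi
    obtain ⟨z, hzD, hzU, hz⟩ := hD.exists_mem_open hopen ⟨y, hy, hlt⟩
    have : q z ≤ ⨆ y ∈ D, U.indicator q y := by
      refine le_trans ?_ (le_iSup₂ (f := fun y (_ : y ∈ D) => U.indicator q y) z hzD)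
      rw [indicator_of_mem hzU]
    exact absurd hz (not_lt.mpr this)
  · refine iSup₂_le fun y _ => ?_
    by_cases hy : y ∈ U
    · rw [indicator_of_mem hy]
      exact le_iSup₂ (f := fun y (_ : y ∈ U) => q y) y hy
    · simp [indicator_of_notMem hy]

/-- The limsup is an infimum over the radii 1/(n+1) of suprema over punctured balls, and continuity
off the centre reduces each supremum to a countable dense set. The moving centre `p z` covers both
slopes (`p = id`) and the metric speed, jointly in the curve and the time. -/
lemma measurable_limsup_nhdsNE {Z Y : Type*} [MeasurableSpace Z] [MetricSpace Y]
    [TopologicalSpace.SeparableSpace Y] [MeasurableSpace Y] [OpensMeasurableSpace Y]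
    {p : Z → Y} (hp : Measurable p) {q : Z → Y → ℝ≥0∞} (hq : ∀ y, Measurable fun z => q z y)
    (hc : ∀ z, ContinuousOn (q z) {p z}ᶜ) :
    Measurable fun z => limsup (q z) (𝓝[≠] p z) := by
  obtain ⟨D, hDc, hD⟩ := TopologicalSpace.exists_countable_dense Y
  have key : ∀ z, limsup (q z) (𝓝[≠] p z) =
      ⨅ n : ℕ, ⨆ y ∈ D, (Metric.ball (p z) (1 / ((n : ℝ) + 1)) ∩ {p z}ᶜ).indicator (q z) y := by
    intro z
    rw [(nhdsWithin_hasBasis Metric.nhds_basis_ball_inv_nat_succ _).limsup_eq_iInf_iSup]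
    simp only [iInf_true]
    refine iInf_congr fun n => ?_
    exact iSup_open_eq_iSup_dense hD (Metric.isOpen_ball.inter isOpen_compl_singleton)
      ((hc z).mono inter_subset_right)
  simp_rw [key]
  refine Measurable.iInf fun n => Measurable.biSup _ hDc fun y _ => ?_
  have hset : MeasurableSet {z | y ∈ Metric.ball (p z) (1 / ((n : ℝ) + 1)) ∩ {p z}ᶜ} := by
    have h1 : {z | y ∈ Metric.ball (p z) (1 / ((n : ℝ) + 1)) ∩ {p z}ᶜ} =
        p ⁻¹' (Metric.ball y (1 / ((n : ℝ) + 1)) ∩ {y}ᶜ) := by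
      ext z
      simp [dist_comm, eq_comm]
    rw [h1]
    exact hp (Metric.isOpen_ball.inter isOpen_compl_singleton).measurableSet
  have : (fun z => (Metric.ball (p z) (1 / ((n : ℝ) + 1)) ∩ {p z}ᶜ).indicator (q z) y) =
      {z | y ∈ Metric.ball (p z) (1 / ((n : ℝ) + 1)) ∩ {p z}ᶜ}.indicator fun z => q z y := by
    ext z
    simp only [indicator, mem_ofPred_eq]
  rw [this]
  exact (hq y).indicator hset

lemma continuousOn_div_edist {Y : Type*} [MetricSpace Y] {x : Y} {f : Y → ℝ≥0∞}
    (hf : Continuous f) : ContinuousOn (fun y => f y / edist y x) {x}ᶜ := by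
  intro y hy
  refine ContinuousAt.continuousWithinAt ?_
  refine ENNReal.Tendsto.div hf.continuousAt (Or.inr ?_)
    ((continuous_id.edist continuous_const).continuousAt) (Or.inl (edist_ne_top _ _))
  simpa using hy

/-! ### Slopes: measurability and elementary bounds. -/

section Slopes

variable {X : Type*} [MetricSpace X]

lemma measurable_ascSlope [TopologicalSpace.SeparableSpace X] [MeasurableSpace X] [BorelSpace X]
    {f : X → ℝ} (hf : Continuous f) : Measurable (ascSlope f) := by
  refine measurable_limsup_nhdsNE (p := id) measurable_id
    (q := fun x y => ENNReal.ofReal (f y - f x) / edist y x) (fun y => ?_) (fun x => ?_)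
  · exact (((continuous_const.sub hf).measurable.ennreal_ofReal).div
      (continuous_const.edist continuous_id).measurable)
  · exact continuousOn_div_edist (ENNReal.continuous_ofReal.comp (hf.sub continuous_const))

lemma measurable_metricSlope [TopologicalSpace.SeparableSpace X] [MeasurableSpace X]
    [BorelSpace X] {f : X → ℝ} (hf : Continuous f) : Measurable (metricSlope f) := by
  refine measurable_limsup_nhdsNE (p := id) measurable_id
    (q := fun x y => ENNReal.ofReal |f y - f x| / edist y x) (fun y => ?_) (fun x => ?_)
  · exact (((continuous_const.sub hf).abs.measurable.ennreal_ofReal).div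
      (continuous_const.edist continuous_id).measurable)
  · exact continuousOn_div_edist (ENNReal.continuous_ofReal.comp (hf.sub continuous_const).abs)

lemma ascSlope_le_metricSlope (f : X → ℝ) (x : X) : ascSlope f x ≤ metricSlope f x :=
  limsup_le_limsup (Eventually.of_forall fun _ =>
    ENNReal.div_le_div_right (ENNReal.ofReal_le_ofReal (le_abs_self _)) _)

lemma metricSlope_le_of_eventually {f : X → ℝ} {x : X} {C : ℝ≥0∞}
    (h : ∀ᶠ y in 𝓝 x, ENNReal.ofReal |f y - f x| ≤ C * edist y x) : metricSlope f x ≤ C := by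
  refine limsup_le_of_le (h := ?_)
  filter_upwards [h.filter_mono nhdsWithin_le_nhds] with y hy
  exact ENNReal.div_le_of_le_mul hy

lemma metricSlope_le_of_lipschitz {f : X → ℝ} {L : ℝ≥0} (hf : LipschitzWith L f) (x : X) :
    metricSlope f x ≤ L := by
  refine metricSlope_le_of_eventually (Eventually.of_forall fun y => ?_)
  have := hf y x
  rwa [edist_dist, Real.dist_eq] at this

lemma ascSlope_le_of_lipschitz {f : X → ℝ} {L : ℝ≥0} (hf : LipschitzWith L f) (x : X) :
    ascSlope f x ≤ L :=
  (ascSlope_le_metricSlope f x).trans (metricSlope_le_of_lipschitz hf x)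

lemma eventually_of_ascSlope_lt {f : X → ℝ} {x : X} {a : ℝ≥0∞} (h : ascSlope f x < a) :
    ∀ᶠ y in 𝓝 x, ENNReal.ofReal (f y - f x) ≤ a * edist y x := by
  have h1 := eventually_lt_of_limsup_lt h
  rw [eventually_nhdsWithin_iff] at h1
  filter_upwards [h1] with y hy
  by_cases hyx : y = x
  · simp [hyx]
  · have := (hy hyx).le
    exact (ENNReal.div_le_iff (by simpa using hyx) (edist_ne_top _ _)).mp this

end Slopes

/-! ### Metric speed -/

section Speed

variable {X : Type*} [MetricSpace X]

lemma eventually_of_metricSpeed_lt {γ : I → X} {t : I} {b : ℝ≥0∞} (h : metricSpeed γ t < b) :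
    ∀ᶠ s in 𝓝 t, edist (γ s) (γ t) ≤ b * edist s t := by
  have h1 := eventually_lt_of_limsup_lt h
  rw [eventually_nhdsWithin_iff] at h1
  filter_upwards [h1] with y hy
  by_cases hyx : y = t
  · simp [hyx]
  · have := (hy hyx).le
    exact (ENNReal.div_le_iff (by simpa using hyx) (edist_ne_top _ _)).mp this

lemma metricSpeed_le {γ : I → X} {t : I} {C : ℝ≥0∞}
    (h : ∀ s, edist (γ s) (γ t) ≤ C * edist s t) : metricSpeed γ t ≤ C :=
  limsup_le_of_le (h := Eventually.of_forall fun s => ENNReal.div_le_of_le_mul (h s))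

lemma IsGeodesic.metricSpeed_le {γ : C(I, X)} (h : IsGeodesic γ) (t : I) :
    metricSpeed γ t ≤ edist (γ 0) (γ 1) := by
  refine MetricBrenier.metricSpeed_le fun s => ?_
  rw [edist_dist, edist_dist, edist_dist, ← ENNReal.ofReal_mul dist_nonneg, h s t, mul_comm,
    Subtype.dist_eq, Real.dist_eq]

lemma IsGeodesic.isAbsCts {γ : C(I, X)} (h : IsGeodesic γ) : IsAbsCts γ := by
  refine ⟨fun _ => dist (γ 0) (γ 1), intervalIntegrable_const, fun s t hst => ?_⟩
  rw [intervalIntegral.integral_const, h s t, abs_sub_comm,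
    abs_of_nonneg (sub_nonneg.2 (show (s : ℝ) ≤ t from hst)), smul_eq_mul]

lemma IsGeodesic.energy_le {γ : C(I, X)} (h : IsGeodesic γ) :
    (∫⁻ t : I, metricSpeed γ t ^ 2) ≤ edist (γ 0) (γ 1) ^ 2 := by
  calc (∫⁻ t : I, metricSpeed γ t ^ 2) ≤ ∫⁻ _ : I, edist (γ 0) (γ 1) ^ 2 :=
        lintegral_mono fun t => by gcongr; exact h.metricSpeed_le t
    _ = _ := by simp

lemma IsGeodesic.isAC2 {γ : C(I, X)} (h : IsGeodesic γ) : IsAC2 γ :=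
  ⟨h.isAbsCts, h.energy_le.trans_lt (by simp [edist_lt_top])⟩

lemma measurable_metricSpeed :
    Measurable fun z : C(I, X) × I => metricSpeed z.1 z.2 := by
  refine measurable_limsup_nhdsNE (p := fun z : C(I, X) × I => z.2) measurable_snd
    (q := fun z s => edist (z.1 s) (z.1 z.2) / edist s z.2) (fun s => ?_) (fun z => ?_)
  · refine Measurable.div ?_ ?_
    · exact Continuous.measurable (by fun_prop)
    · exact Continuous.measurable (by fun_prop)
  · exact continuousOn_div_edist (f := fun s => edist (z.1 s) (z.1 z.2)) (by fun_prop)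

lemma measurable_metricSpeed_right (γ : C(I, X)) : Measurable fun t : I => metricSpeed γ t :=
  measurable_limsup_nhdsNE (p := fun t : I => t) measurable_id
    (q := fun t s => edist (γ s) (γ t) / edist s t)
    (fun s => (Continuous.measurable (by fun_prop)).div (Continuous.measurable (by fun_prop)))
    fun t => continuousOn_div_edist (f := fun s => edist (γ s) (γ t)) (by fun_prop)

lemma measurable_curve_eval [MeasurableSpace X] [BorelSpace X] :
    Measurable fun z : C(I, X) × I => z.1 z.2 :=
  Continuous.measurable (by fun_prop)

lemma measurable_eval_curve [MeasurableSpace X] [BorelSpace X] (t : I) :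
    Measurable fun γ : C(I, X) => γ t :=
  Continuous.measurable (by fun_prop)

lemma ae_metricSpeed_lt_top {γ : C(I, X)} (h : IsAC2 γ) : ∀ᵐ t : I, metricSpeed γ t < ∞ := by
  filter_upwards [ae_lt_top ((measurable_metricSpeed_right γ).pow_const 2) h.2.ne] with t ht
  by_contra hc
  simp [top_le_iff.mp (not_lt.mp hc)] at ht

lemma lintegral_metricSpeed_le (γ : C(I, X)) :
    (∫⁻ t : I, metricSpeed γ t) ≤ 1 + ∫⁻ t : I, metricSpeed γ t ^ 2 := by
  calc (∫⁻ t : I, metricSpeed γ t) ≤ ∫⁻ t : I, (1 + metricSpeed γ t ^ 2) := by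
        refine lintegral_mono fun t => ?_
        rcases le_total (metricSpeed γ t) 1 with h | h
        · exact h.trans le_self_add
        · refine le_trans ?_ le_add_self
          rw [sq]
          exact le_mul_of_one_le_left' h
    _ = _ := by rw [lintegral_add_left measurable_const]; simp

end Speed

/-! ### Absolutely continuous real functions on the unit interval -/

section RealAC

/-- Increments of `h` are dominated by those of the primitive of its density, which is absolutely
continuous in the ε–δ sense. Composition with `projIcc` extends `h` by constants to the real line.
-/
lemma IsAbsCts.absolutelyContinuousOnInterval {h : I → ℝ} (hh : IsAbsCts h) :
    AbsolutelyContinuousOnInterval (h ∘ projIcc (0 : ℝ) 1 zero_le_one) 0 1 := by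
  obtain ⟨g, hg, hbound⟩ := hh
  have hG := hg.absolutelyContinuousOnInterval_intervalIntegral (c := 0) (by simp)
  set G : ℝ → ℝ := fun x => ∫ t in (0 : ℝ)..x, g t with hGdef
  have hle : ∀ x ∈ Icc (0 : ℝ) 1, ∀ y ∈ Icc (0 : ℝ) 1,
      dist ((h ∘ projIcc (0 : ℝ) 1 zero_le_one) x) ((h ∘ projIcc (0 : ℝ) 1 zero_le_one) y) ≤
        dist (G x) (G y) := by
    have hint : ∀ x ∈ Icc (0 : ℝ) 1, IntervalIntegrable g volume 0 x := fun x hx =>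
      hg.mono_set (by rw [uIcc_of_le hx.1, uIcc_of_le zero_le_one]; exact Icc_subset_Icc_right hx.2)
    have aux : ∀ x ∈ Icc (0 : ℝ) 1, ∀ y ∈ Icc (0 : ℝ) 1, x ≤ y →
      dist ((h ∘ projIcc (0 : ℝ) 1 zero_le_one) x) ((h ∘ projIcc (0 : ℝ) 1 zero_le_one) y) ≤
        dist (G x) (G y) := by
      intro x hx y hy hxy
      have := hbound ⟨x, hx⟩ ⟨y, hy⟩ hxy
      simp only [Function.comp, projIcc_of_mem zero_le_one hx, projIcc_of_mem zero_le_one hy]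
      refine this.trans ?_
      rw [dist_comm, Real.dist_eq, hGdef]
      simp only
      rw [intervalIntegral.integral_interval_sub_left (hint y hy) (hint x hx)]
      exact le_abs_self _
    intro x hx y hy
    rcases le_total x y with hxy | hxy
    · exact aux x hx y hy hxy
    · rw [dist_comm, dist_comm (G x)]
      exact aux y hy x hx hxy
  rw [absolutelyContinuousOnInterval_iff] at hG ⊢
  intro ε hε
  obtain ⟨δ, hδ, hδ'⟩ := hG ε hε
  refine ⟨δ, hδ, fun E hE hsum => lt_of_le_of_lt ?_ (hδ' E hE hsum)⟩
  refine Finset.sum_le_sum fun i hi => ?_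
  have := hE.1 i hi
  rw [uIcc_of_le zero_le_one] at this
  exact hle _ this.1 _ this.2

lemma ae_unitInterval_iff {p : ℝ → Prop} :
    (∀ᵐ t : I, p t) ↔ ∀ᵐ x : ℝ, x ∈ Icc (0 : ℝ) 1 → p x := by
  rw [← ae_restrict_iff' measurableSet_Icc]
  exact (ae_restrict_iff_subtype measurableSet_Icc).symm

lemma setLIntegral_Icc_coe {s t : I} (f : ℝ → ℝ≥0∞) :
    ∫⁻ r in Icc s t, f r = ∫⁻ x in Icc (s : ℝ) t, f x := by
  have h1 : Icc s t = ((↑) : I → ℝ) ⁻¹' Icc (s : ℝ) t := by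
    ext r
    simp
  have h2 : Icc (s : ℝ) t ⊆ Icc 0 1 := Icc_subset_Icc s.2.1 t.2.2
  have h3 : ∫⁻ r : I, (Icc (s : ℝ) t).indicator f r =
      ∫⁻ x in Icc (0 : ℝ) 1, (Icc (s : ℝ) t).indicator f x := by
    rw [unitInterval.volume_def, lintegral_subtype_comap measurableSet_Icc]
  rw [lintegral_indicator measurableSet_Icc, Measure.restrict_restrict measurableSet_Icc,
    inter_eq_left.mpr h2] at h3
  rw [← h3, ← lintegral_indicator measurableSet_Icc, h1]
  rfl

/-- The fundamental theorem of calculus for absolutely continuous functions. The derivative needs a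
bound only at almost every time, and the endpoints, where the constant extension may have a kink,
are null. -/
lemma IsAbsCts.ofReal_abs_sub_le {h : I → ℝ} (hh : IsAbsCts h) {b : I → ℝ≥0∞}
    (hb : ∀ᵐ t : I, ∀ D : ℝ, t ∈ Ioo (0 : I) 1 →
      HasDerivAt (h ∘ projIcc (0 : ℝ) 1 zero_le_one) D t → ENNReal.ofReal |D| ≤ b t)
    {s t : I} (hst : s ≤ t) :
    ENNReal.ofReal |h t - h s| ≤ ∫⁻ r in Icc s t, b r := by
  have hst' : (s : ℝ) ≤ t := hst
  have hac := hh.absolutelyContinuousOnInterval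
  set H := h ∘ projIcc (0 : ℝ) 1 zero_le_one with hH
  have hftc := (hac.mono (c := s) (d := t) (by
    rw [uIcc_of_le hst', uIcc_of_le zero_le_one]
    exact Icc_subset_Icc s.2.1 t.2.2)).integral_deriv_eq_sub
  have h1 : H t = h t := by simp [hH]
  have h0 : H s = h s := by simp [hH]
  rw [← h1, ← h0, ← hftc, ← Real.enorm_eq_ofReal_abs]
  have hdiff : ∀ᵐ t : I, DifferentiableAt ℝ H t := by
    rw [ae_unitInterval_iff]
    have := hac.ae_differentiableAt
    rwa [uIcc_of_le zero_le_one] at this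
  have hne : ∀ᵐ t : I, t ≠ 0 ∧ t ≠ 1 := by
    have h0 : ∀ᵐ t : I, t ≠ 0 := by simp [ae_iff]
    have h1 : ∀ᵐ t : I, t ≠ 1 := by simp [ae_iff]
    filter_upwards [h0, h1] with t a b using ⟨a, b⟩
  calc ‖∫ x in (s : ℝ)..t, deriv H x‖ₑ
      ≤ ∫⁻ x in Ioc (s : ℝ) t, ‖deriv H x‖ₑ := by
        rw [intervalIntegral.integral_of_le hst']
        exact enorm_integral_le_lintegral_enorm _
    _ ≤ ∫⁻ x in Icc (s : ℝ) t, ‖deriv H x‖ₑ := lintegral_mono_set Ioc_subset_Icc_self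
    _ = ∫⁻ t in Icc s t, ‖deriv H t‖ₑ := (setLIntegral_Icc_coe fun x => ‖deriv H x‖ₑ).symm
    _ ≤ ∫⁻ t in Icc s t, b t := by
        refine lintegral_mono_ae (ae_restrict_of_ae ?_)
        filter_upwards [hb, hdiff, hne] with t ht hd hn
        rw [Real.enorm_eq_ofReal_abs]
        exact ht _ ⟨lt_of_le_of_ne unitInterval.nonneg' (Ne.symm hn.1),
          lt_of_le_of_ne unitInterval.le_one' hn.2⟩ hd.hasDerivAt

lemma IsAbsCts.comp_lipschitz {Y Z : Type*} [MetricSpace Y] [MetricSpace Z] {γ : I → Y}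
    (hγ : IsAbsCts γ) {u : Y → Z} {L : ℝ≥0} (hu : LipschitzWith L u) : IsAbsCts (u ∘ γ) := by
  obtain ⟨g, hg, hb⟩ := hγ
  refine ⟨fun r => L * g r, hg.const_mul _, fun s t hst => ?_⟩
  rw [intervalIntegral.integral_const_mul]
  exact (hu.dist_le_mul _ _).trans (by gcongr; exact hb s t hst)

end RealAC

/-! ### Slopes and speeds along absolutely continuous curves. -/

section ChainRule

variable {X : Type*} [MetricSpace X]

/-- The filter `F` allows increments to be tested from one side of `t` only. Finiteness of both
factors excludes the product of 0 and ∞. -/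
lemma ofReal_le_ascSlope_mul_metricSpeed {γ : I → X} {t : I} {u : X → ℝ} (hγ : ContinuousAt γ t)
    (hu : ascSlope u (γ t) ≠ ∞) (hs : metricSpeed γ t ≠ ∞) {F : Filter I} [F.NeBot]
    (hF : F ≤ 𝓝[≠] t) {c : ℝ}
    (hc : ∀ᶠ s in F, c * dist s t ≤ u (γ s) - u (γ t)) :
    ENNReal.ofReal c ≤ ascSlope u (γ t) * metricSpeed γ t := by
  refine ENNReal.le_mul_of_forall_lt (Or.inr hs) (Or.inl hu) fun a ha b hb => ?_
  have h1 := hγ.eventually (eventually_of_ascSlope_lt ha)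
  have h2 := eventually_of_metricSpeed_lt hb
  have h3 : ∀ᶠ s in F, s ≠ t := hF eventually_mem_nhdsWithin
  have hF' : F ≤ 𝓝 t := hF.trans nhdsWithin_le_nhds
  obtain ⟨s, hs1, hs2, hs3, hs4⟩ := ((h1.filter_mono hF').and ((h2.filter_mono hF').and
    (h3.and hc))).exists
  have hst : edist s t ≠ 0 := by simpa using hs3
  have : ENNReal.ofReal c * edist s t ≤ (a * b) * edist s t := by
    calc ENNReal.ofReal c * edist s t = ENNReal.ofReal (c * dist s t) := by
          rw [edist_dist, ENNReal.ofReal_mul' dist_nonneg]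
      _ ≤ ENNReal.ofReal (u (γ s) - u (γ t)) := ENNReal.ofReal_le_ofReal hs4
      _ ≤ a * edist (γ s) (γ t) := hs1
      _ ≤ a * (b * edist s t) := by gcongr
      _ = _ := by ring
  exact (ENNReal.mul_le_mul_iff_left hst (edist_ne_top _ _)).mp this

/-- A positive derivative makes `u ∘ γ` grow to the right of `t`, a negative one makes it grow to
the left. With the side chosen accordingly, the ascending slope alone controls `|D|`. -/
lemma ofReal_abs_deriv_le {γ : I → X} {t : I} {u : X → ℝ} (hγ : ContinuousAt γ t)
    (ht : t ∈ Ioo (0 : I) 1) (hu : ascSlope u (γ t) ≠ ∞) (hs : metricSpeed γ t ≠ ∞) {D : ℝ}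
    (hD : HasDerivAt ((u ∘ γ) ∘ projIcc (0 : ℝ) 1 zero_le_one) D t) :
    ENNReal.ofReal |D| ≤ ascSlope u (γ t) * metricSpeed γ t := by
  set H := (u ∘ γ) ∘ projIcc (0 : ℝ) 1 zero_le_one with hH
  have hHs : ∀ s : I, H s = u (γ s) := fun s => by simp [hH]
  refine le_of_forall_lt fun e he => ?_
  obtain ⟨c', hc1, hc2⟩ := exists_between he
  refine hc1.trans_le ?_
  have hc'fin : c' ≠ ∞ := (hc2.trans ENNReal.ofReal_lt_top).ne
  obtain ⟨c, rfl⟩ : ∃ c : ℝ≥0, c' = c := ⟨c'.toNNReal, (ENNReal.coe_toNNReal hc'fin).symm⟩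
  have hcD : (c : ℝ) < |D| := by
    rw [← ENNReal.ofReal_coe_nnreal] at hc2
    exact (ENNReal.ofReal_lt_ofReal_iff_of_nonneg c.2).mp hc2
  have hslope := hasDerivAt_iff_tendsto_slope.mp hD
  have hmap : Tendsto ((↑) : I → ℝ) (𝓝[≠] t) (𝓝[≠] (t : ℝ)) := by
    refine tendsto_nhdsWithin_iff.mpr ⟨(continuous_subtype_val.tendsto t).mono_left
      nhdsWithin_le_nhds, ?_⟩
    filter_upwards [eventually_mem_nhdsWithin] with s hs h
    exact hs (Subtype.ext h)
  have hslope' := hslope.comp hmap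
  rw [← ENNReal.ofReal_coe_nnreal]
  rcases le_or_gt 0 D with hD0 | hD0
  · have : (𝓝[>] t).NeBot := nhdsGT_neBot_of_exists_gt ⟨1, ht.2⟩
    have hF : 𝓝[>] t ≤ 𝓝[≠] t := nhdsWithin_mono _ fun s hs => ne_of_gt hs
    refine ofReal_le_ascSlope_mul_metricSpeed hγ hu hs hF ?_
    rw [abs_of_nonneg hD0] at hcD
    filter_upwards [(hslope'.mono_left hF).eventually (lt_mem_nhds hcD),
      eventually_mem_nhdsWithin] with s h1 h2
    have hst : (0 : ℝ) < s - t := sub_pos.mpr (show (t : ℝ) < s from h2)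
    simp only [Function.comp, slope_def_field] at h1
    rw [← hHs s, ← hHs t, Subtype.dist_eq, Real.dist_eq, abs_of_pos hst]
    exact ((lt_div_iff₀ hst).mp h1).le
  · have : (𝓝[<] t).NeBot := nhdsLT_neBot_of_exists_lt ⟨0, ht.1⟩
    have hF : 𝓝[<] t ≤ 𝓝[≠] t := nhdsWithin_mono _ fun s hs => ne_of_lt hs
    refine ofReal_le_ascSlope_mul_metricSpeed hγ hu hs hF ?_
    rw [abs_of_neg hD0] at hcD
    filter_upwards [(hslope'.mono_left hF).eventually (gt_mem_nhds (lt_neg.mp hcD)),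
      eventually_mem_nhdsWithin] with s h1 h2
    have hst : (s : ℝ) - t < 0 := sub_neg.mpr (show (s : ℝ) < t from h2)
    simp only [Function.comp, slope_def_field] at h1
    rw [← hHs s, ← hHs t, Subtype.dist_eq, Real.dist_eq, abs_of_neg hst]
    have := (div_lt_iff_of_neg hst).mp h1
    linarith

/-- The ascending slope of a Lipschitz function is an upper gradient along `AC²` curves. -/
lemma ofReal_abs_sub_le_setLIntegral_ascSlope {u : X → ℝ} {L : ℝ≥0}
    (hu : LipschitzWith L u) {γ : C(I, X)} (hγ : IsAC2 γ) {s t : I} (hst : s ≤ t) :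
    ENNReal.ofReal |u (γ t) - u (γ s)| ≤
      ∫⁻ r in Icc s t, ascSlope u (γ r) * metricSpeed γ r := by
  refine (hγ.1.comp_lipschitz hu).ofReal_abs_sub_le ?_ hst
  filter_upwards [ae_metricSpeed_lt_top hγ] with t hs D ht hD
  exact ofReal_abs_deriv_le γ.continuous.continuousAt ht
    ((ascSlope_le_of_lipschitz hu _).trans_lt ENNReal.coe_lt_top).ne hs.ne hD

lemma Icc_zero_one_eq_univ : Icc (0 : I) 1 = univ := by
  ext r
  simp [unitInterval.le_one']

lemma ofReal_abs_sub_le_curveIntegral_ascSlope {u : X → ℝ} {L : ℝ≥0}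
    (hu : LipschitzWith L u) {γ : C(I, X)} (hγ : IsAC2 γ) :
    ENNReal.ofReal |u (γ 1) - u (γ 0)| ≤ curveIntegral (ascSlope u) γ := by
  have := ofReal_abs_sub_le_setLIntegral_ascSlope hu hγ (s := 0) (t := 1) zero_le_one
  rwa [Icc_zero_one_eq_univ, Measure.restrict_univ] at this

lemma edist_le_setLIntegral_metricSpeed {γ : C(I, X)} (hγ : IsAC2 γ) {s t : I} (hst : s ≤ t) :
    edist (γ s) (γ t) ≤ ∫⁻ r in Icc s t, metricSpeed γ r := by
  have hu : LipschitzWith 1 fun x => dist (γ s) x := LipschitzWith.dist_right _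
  have := ofReal_abs_sub_le_setLIntegral_ascSlope hu hγ hst
  rw [dist_self, sub_zero, abs_of_nonneg dist_nonneg, ← edist_dist] at this
  refine this.trans (lintegral_mono fun r => ?_)
  calc _ ≤ (1 : ℝ≥0∞) * metricSpeed γ r := by gcongr; exact ascSlope_le_of_lipschitz hu _
    _ = _ := one_mul _

end ChainRule

/-! ### The class `AC²` is Borel -/

section AC2

/-- Pairs `(a, b)` from the dense set with `s < a < c < b < t` accumulate at `(s, t)`, and their
intervals lie inside `[s, t]`. Monotonicity of `μ` is enough; no finiteness or continuity of `μ`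
enters. -/
lemma le_measure_Icc_of_dense {D : Set I} (hD : Dense D) {F : I × I → ℝ≥0∞} (hF : Continuous F)
    {μ : Measure I} (h : ∀ s ∈ D, ∀ t ∈ D, s < t → F (s, t) ≤ μ (Icc s t)) {s t : I}
    (hst : s < t) : F (s, t) ≤ μ (Icc s t) := by
  obtain ⟨c, hsc, hct⟩ := exists_between hst
  set O : Set (I × I) := Ioo s c ×ˢ Ioo c t
  have hO : IsOpen O := isOpen_Ioo.prod isOpen_Ioo
  have hmem : (s, t) ∈ closure O := by
    rw [closure_prod_eq, closure_Ioo hsc.ne, closure_Ioo hct.ne]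
    exact ⟨⟨le_rfl, hsc.le⟩, ⟨hct.le, le_rfl⟩⟩
  have hsub : closure O ⊆ closure (O ∩ D ×ˢ D) :=
    closure_minimal ((hD.prod hD).open_subset_closure_inter hO) isClosed_closure
  have hcl : closure (O ∩ D ×ˢ D) ⊆ {p | F p ≤ μ (Icc s t)} := by
    refine closure_minimal ?_ (isClosed_le hF continuous_const)
    rintro ⟨a, b⟩ ⟨⟨ha, hb⟩, haD, hbD⟩
    exact (h a haD b hbD (ha.2.trans hb.1)).trans (measure_mono (Icc_subset_Icc ha.1.le hb.2.le))
  exact hcl (hsub hmem)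

variable {X : Type*} [MetricSpace X]

lemma isAbsCts_of_le_setLIntegral {γ : I → X} {b : I → ℝ≥0∞} (hbm : Measurable b)
    (hb : ∫⁻ t, b t ≠ ∞)
    (h : ∀ s t : I, s < t → edist (γ s) (γ t) ≤ ∫⁻ r in Icc s t, b r) : IsAbsCts γ := by
  set β : ℝ → ℝ≥0∞ := fun x => b (projIcc 0 1 zero_le_one x) with hβ
  have hβm : Measurable β := hbm.comp continuous_projIcc.measurable
  have hβI : ∀ s t : I, ∫⁻ r in Icc s t, b r = ∫⁻ x in Icc (s : ℝ) t, β x := fun s t => by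
    rw [← setLIntegral_Icc_coe]
    simp [hβ]
  have hfin : ∀ s t : I, ∫⁻ x in Icc (s : ℝ) t, β x ≠ ∞ := fun s t => by
    rw [← hβI]
    exact ne_top_of_le_ne_top hb (setLIntegral_le_lintegral _ _)
  have hint : ∀ s t : I, IntegrableOn (fun x => (β x).toReal) (Icc (s : ℝ) t) := fun s t =>
    integrable_toReal_of_lintegral_ne_top hβm.aemeasurable (hfin s t)
  refine ⟨fun x => (β x).toReal, ?_, fun s t hst => ?_⟩
  · rw [intervalIntegrable_iff_integrableOn_Icc_of_le zero_le_one]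
    simpa using hint 0 1
  · rcases hst.eq_or_lt with rfl | hlt
    · simp
    · have h1 := h s t hlt
      rw [hβI] at h1
      rw [intervalIntegral.integral_of_le hst, ← integral_Icc_eq_integral_Ioc,
        integral_toReal hβm.aemeasurable (ae_lt_top hβm (hfin s t)), dist_edist]
      exact ENNReal.toReal_mono (hfin s t) h1

/-- The unknown density of `IsAbsCts` is replaced by the metric speed. What remains is measurable in
the curve and, by density of times, amounts to countably many conditions. -/
lemma isAC2_iff {γ : C(I, X)} : IsAC2 γ ↔ (∫⁻ t : I, metricSpeed γ t ^ 2) < ∞ ∧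
    ∀ s t : I, s < t → edist (γ s) (γ t) ≤ ∫⁻ r in Icc s t, metricSpeed γ r := by
  refine ⟨fun h => ⟨h.2, fun s t hst => edist_le_setLIntegral_metricSpeed h hst.le⟩,
    fun h => ⟨?_, h.1⟩⟩
  refine isAbsCts_of_le_setLIntegral (measurable_metricSpeed_right γ) ?_ h.2
  exact ne_top_of_le_ne_top (ENNReal.add_ne_top.mpr ⟨ENNReal.one_ne_top, h.1.ne⟩)
    (lintegral_metricSpeed_le γ)

lemma measurable_energy :
    Measurable fun γ : C(I, X) => ∫⁻ t : I, metricSpeed γ t ^ 2 :=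
  Measurable.lintegral_prod_right (measurable_metricSpeed.pow_const 2)

/-- Measurability is needed to carry `IsAC2` through the push-forward of a test plan under
restriction of curves. -/
lemma measurableSet_isAC2 : MeasurableSet {γ : C(I, X) | IsAC2 γ} := by
  obtain ⟨D, hDc, hD⟩ := TopologicalSpace.exists_countable_dense I
  have : {γ : C(I, X) | IsAC2 γ} =
      {γ : C(I, X) | (∫⁻ t : I, metricSpeed γ t ^ 2) < ∞} ∩
      ⋂ s ∈ D, ⋂ t ∈ D,
        {γ : C(I, X) | s < t → edist (γ s) (γ t) ≤ ∫⁻ r in Icc s t, metricSpeed γ r} := by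
    ext γ
    simp only [mem_inter_iff, mem_iInter]
    refine isAC2_iff.trans (and_congr_right fun _ => ⟨fun h s _ t _ => h s t, fun h s t hst => ?_⟩)
    have := le_measure_Icc_of_dense hD (F := fun p => edist (γ p.1) (γ p.2)) (by fun_prop)
      (μ := volume.withDensity fun r => metricSpeed γ r) (fun s hs t ht hst => ?_) hst
    · rwa [withDensity_apply _ measurableSet_Icc] at this
    · rw [withDensity_apply _ measurableSet_Icc]
      exact h s hs t ht hst
  rw [this]
  refine (measurableSet_lt measurable_energy measurable_const).inter
    (MeasurableSet.biInter hDc fun s _ => MeasurableSet.biInter hDc fun t _ => ?_)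
  by_cases hst : s < t
  · simp only [hst, true_imp_iff]
    exact measurableSet_le (Continuous.measurable (by fun_prop))
      (Measurable.lintegral_prod_right (ν := volume.restrict (Icc s t)) measurable_metricSpeed)
  · simp [hst]

end AC2


/-! ### Restriction of curves to subintervals -/

section Restriction

/-- The affine map of `[0,1]` onto `[s,t]`. -/
def affineSubinterval (s t : I) : C(I, I) where
  toFun r := ⟨(1 - r) * s + r * t, (convex_Icc (0 : ℝ) 1) s.2 t.2 (sub_nonneg.2 r.2.2) r.2.1
    (by ring)⟩
  continuous_toFun := by fun_prop

@[simp] lemma coe_affineSubinterval (s t r : I) :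
    (affineSubinterval s t r : ℝ) = (1 - r) * s + r * t := rfl

@[simp] lemma affineSubinterval_zero (s t : I) : affineSubinterval s t 0 = s :=
  Subtype.ext (by simp)

@[simp] lemma affineSubinterval_one (s t : I) : affineSubinterval s t 1 = t :=
  Subtype.ext (by simp)

lemma edist_affineSubinterval {s t : I} (hst : s ≤ t) (r r' : I) :
    edist (affineSubinterval s t r) (affineSubinterval s t r') =
      ENNReal.ofReal (t - s) * edist r r' := by
  have h : (0 : ℝ) ≤ t - s := sub_nonneg.2 hst
  rw [edist_dist, edist_dist, ← ENNReal.ofReal_mul h, Subtype.dist_eq, Subtype.dist_eq,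
    Real.dist_eq, Real.dist_eq, ← abs_of_nonneg h, ← abs_mul]
  simp only [coe_affineSubinterval]
  congr 2
  ring

lemma setLIntegral_affineSubinterval {s t : I} (hst : s < t) (h : I → ℝ≥0∞) :
    ∫⁻ r : I, ENNReal.ofReal (t - s) * h (affineSubinterval s t r) =
      ∫⁻ r in Icc s t, h r := by
  have hst' : (0 : ℝ) < t - s := sub_pos.2 hst
  set f : ℝ → ℝ := fun x => (1 - x) * s + x * t with hf
  have himg : f '' Icc 0 1 = Icc (s : ℝ) t := by
    ext y
    constructor
    · rintro ⟨x, hx, rfl⟩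
      constructor
      · simp only [hf]; nlinarith [hx.1, hx.2]
      · simp only [hf]; nlinarith [hx.1, hx.2]
    · intro hy
      refine ⟨(y - s) / (t - s), ⟨div_nonneg (sub_nonneg.2 hy.1) hst'.le,
        (div_le_one hst').2 (by linarith [hy.2])⟩, ?_⟩
      simp only [hf]
      field_simp
      ring
  have hd : ∀ x ∈ Icc (0 : ℝ) 1, HasDerivWithinAt f (t - s) (Icc 0 1) x := fun x _ => by
    have h1 : HasDerivAt f ((-1) * (s : ℝ) + 1 * t) x :=
      (((hasDerivAt_id x).const_sub 1).mul_const _).add ((hasDerivAt_id x).mul_const _)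
    have h2 : (-1) * (s : ℝ) + 1 * t = t - s := by ring
    exact (h2 ▸ h1).hasDerivWithinAt
  have hinj : InjOn f (Icc 0 1) := fun x _ y _ hxy => by
    have : (x - y) * ((t : ℝ) - s) = 0 := by simp only [hf] at hxy; linarith
    rcases mul_eq_zero.1 this with h | h
    · linarith
    · linarith
  have hcov := lintegral_image_eq_lintegral_abs_deriv_mul measurableSet_Icc hd hinj
    (fun x => h (projIcc 0 1 zero_le_one x))
  rw [himg, ← setLIntegral_Icc_coe, abs_of_pos hst'] at hcov
  have h1 : ∀ r : I, h (projIcc 0 1 zero_le_one (r : ℝ)) = h r := fun r => by simp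
  simp only [h1] at hcov
  rw [hcov, unitInterval.volume_def, ← lintegral_subtype_comap measurableSet_Icc]
  refine lintegral_congr fun r => ?_
  have : projIcc 0 1 zero_le_one (f r) = affineSubinterval s t r := by
    have := (affineSubinterval s t r).2
    rw [coe_affineSubinterval] at this
    rw [hf, projIcc_of_mem zero_le_one this]
    rfl
  rw [this]

variable {X : Type*} [MetricSpace X]

lemma metricSpeed_comp_affineSubinterval_le (γ : C(I, X)) {s t : I} (hst : s < t) (r : I) :
    metricSpeed (γ.comp (affineSubinterval s t)) r ≤
      ENNReal.ofReal (t - s) * metricSpeed γ (affineSubinterval s t r) := by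
  have hst' : (0 : ℝ) < t - s := sub_pos.2 hst
  have hc : ENNReal.ofReal (t - s) ≠ 0 := by simpa using hst'
  set a := affineSubinterval s t with ha
  have hne : ∀ r', r' ≠ r → a r' ≠ a r := fun r' h h' => by
    have := edist_affineSubinterval hst.le r' r
    rw [← ha, h', edist_self] at this
    rcases mul_eq_zero.1 this.symm with h1 | h1
    · exact hc h1
    · exact h (edist_eq_zero.1 h1)
  have htend : Tendsto a (𝓝[≠] r) (𝓝[≠] (a r)) := by
    refine tendsto_nhdsWithin_iff.mpr ⟨(a.continuous.tendsto r).mono_left nhdsWithin_le_nhds, ?_⟩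
    filter_upwards [eventually_mem_nhdsWithin] with r' hr' using hne r' hr'
  have h1 : ∀ᶠ r' in 𝓝[≠] r, edist ((γ.comp a) r') ((γ.comp a) r) / edist r' r =
      ENNReal.ofReal (t - s) *
        (edist (γ (a r')) (γ (a r)) / edist (a r') (a r)) := by
    filter_upwards [eventually_mem_nhdsWithin] with r' hr'
    rw [edist_affineSubinterval hst.le, ContinuousMap.comp_apply, ContinuousMap.comp_apply,
      ← mul_div_assoc, ENNReal.mul_div_mul_left _ _ hc ENNReal.ofReal_ne_top]
  calc metricSpeed (γ.comp a) r = ENNReal.ofReal (t - s) *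
        limsup (fun r' => edist (γ (a r')) (γ (a r)) / edist (a r') (a r)) (𝓝[≠] r) := by
        rw [metricSpeed, limsup_congr h1, ENNReal.limsup_const_mul_of_ne_top ENNReal.ofReal_ne_top]
    _ ≤ _ := by
        gcongr
        exact limsup_le_limsup_of_le (f := map a (𝓝[≠] r)) htend
          (u := fun q => edist (γ q) (γ (a r)) / edist q (a r))

lemma isAC2_comp_affineSubinterval {γ : C(I, X)} (hγ : IsAC2 γ) {s t : I} (hst : s < t) :
    IsAC2 (γ.comp (affineSubinterval s t)) ∧
      (∫⁻ r : I, metricSpeed (γ.comp (affineSubinterval s t)) r ^ 2) ≤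
        ∫⁻ r : I, metricSpeed γ r ^ 2 := by
  have hst' : (0 : ℝ) < t - s := sub_pos.2 hst
  have hen : (∫⁻ r : I, metricSpeed (γ.comp (affineSubinterval s t)) r ^ 2) ≤
        ∫⁻ r : I, metricSpeed γ r ^ 2 := by
    calc (∫⁻ r : I, metricSpeed (γ.comp (affineSubinterval s t)) r ^ 2)
        ≤ ∫⁻ r : I, ENNReal.ofReal (t - s) * metricSpeed γ (affineSubinterval s t r) ^ 2 := by
          refine lintegral_mono fun r => ?_
          calc _ ≤ (ENNReal.ofReal (t - s) * metricSpeed γ (affineSubinterval s t r)) ^ 2 := by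
                gcongr; exact metricSpeed_comp_affineSubinterval_le γ hst r
            _ = ENNReal.ofReal (t - s) ^ 2 * metricSpeed γ (affineSubinterval s t r) ^ 2 := by
                rw [mul_pow]
            -- One factor `t - s` is dropped, being at most 1; the other is kept as the Jacobian of
            -- the change of variables.
            _ ≤ _ := by
                gcongr
                rw [sq]
                refine mul_le_of_le_one_right' (ENNReal.ofReal_le_one.2 ?_)
                linarith [t.2.2, s.2.1]
      _ = ∫⁻ r in Icc s t, metricSpeed γ r ^ 2 :=
          setLIntegral_affineSubinterval hst fun r => metricSpeed γ r ^ 2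
      _ ≤ _ := setLIntegral_le_lintegral _ _
  refine ⟨isAC2_iff.2 ⟨hen.trans_lt hγ.2, ?_⟩, hen⟩
  obtain ⟨g, hg, hb⟩ := hγ.1
  have hac' : IsAbsCts (γ.comp (affineSubinterval s t)) := by
    refine ⟨fun x => (t - s) * g ((t - s) * x + s), ?_, fun r r' hrr => ?_⟩
    · refine IntervalIntegrable.const_mul ?_ _
      have h1 : IntervalIntegrable g volume s t := hg.mono_set (by
        rw [uIcc_of_le (show (s : ℝ) ≤ t from hst.le), uIcc_of_le zero_le_one]
        exact Icc_subset_Icc s.2.1 t.2.2)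
      have h2 := (h1.comp_add_right (s : ℝ)).comp_mul_left (c := (t : ℝ) - s)
      rw [sub_self, zero_div, div_self hst'.ne'] at h2
      exact h2
    · have hle : affineSubinterval s t r ≤ affineSubinterval s t r' := by
        show (1 - (r : ℝ)) * s + r * t ≤ (1 - (r' : ℝ)) * s + r' * t
        nlinarith [show (r : ℝ) ≤ r' from hrr]
      refine (hb _ _ hle).trans (le_of_eq ?_)
      rw [intervalIntegral.integral_const_mul,
        intervalIntegral.integral_comp_mul_add g hst'.ne' (s : ℝ), smul_eq_mul,
        mul_inv_cancel_left₀ hst'.ne']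
      simp only [coe_affineSubinterval]
      congr 1 <;> ring
  exact (isAC2_iff.1 ⟨hac', hen.trans_lt hγ.2⟩).2

end Restriction

/-! ### Test plans -/

section TestPlans

variable {X : Type*} [MetricSpace X] [MeasurableSpace X] [BorelSpace X]
  {m : Measure X} {π : Measure C(I, X)}

lemma lintegral_eval_le {C : ℝ≥0} (hC : ∀ t : I, π.map (fun γ => γ t) ≤ C • m) (t : I)
    {h : X → ℝ≥0∞} (hh : Measurable h) : ∫⁻ γ, h (γ t) ∂π ≤ C * ∫⁻ x, h x ∂m := by
  rw [← lintegral_map hh (measurable_eval_curve t)]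
  calc _ ≤ ∫⁻ x, h x ∂(C • m) := lintegral_mono' (hC t) le_rfl
    _ = _ := lintegral_smul_measure _ _

lemma ae_eval {C : ℝ≥0} (hC : ∀ t : I, π.map (fun γ => γ t) ≤ C • m) (t : I) {p : X → Prop}
    (hp : ∀ᵐ x ∂m, p x) : ∀ᵐ γ ∂π, p (γ t) := by
  have hac : π.map (fun γ : C(I, X) => γ t) ≪ m :=
    (Measure.absolutelyContinuous_of_le (hC t)).trans (Measure.smul_absolutelyContinuous (μ := m))
  exact ae_of_ae_map (measurable_eval_curve t).aemeasurable (hac.ae_le hp)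

/-- The marginals of the restricted plan are marginals of `π` at intermediate times, so the
compression constant is unchanged. This localizes to `[s, t]` whatever holds for all test plans at
the times 0 and 1. -/
lemma IsTestPlan.restrict (hπ : IsTestPlan m π) {s t : I} (hst : s < t) :
    IsTestPlan m (π.map fun γ => γ.comp (affineSubinterval s t)) := by
  have hcont : Continuous fun γ : C(I, X) => γ.comp (affineSubinterval s t) :=
    ContinuousMap.continuous_precomp _
  have hmeas := hcont.measurable
  have := hπ.prob
  refine ⟨Measure.isProbabilityMeasure_map hmeas.aemeasurable, ?_, ?_, ?_⟩
  · rw [ae_map_iff hmeas.aemeasurable measurableSet_isAC2]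
    filter_upwards [hπ.ac] with γ hγ using (isAC2_comp_affineSubinterval hγ hst).1
  · rw [lintegral_map measurable_energy hmeas]
    refine lt_of_le_of_lt (lintegral_mono_ae ?_) hπ.energy
    filter_upwards [hπ.ac] with γ hγ using (isAC2_comp_affineSubinterval hγ hst).2
  · obtain ⟨C, hC⟩ := hπ.compression
    refine ⟨C, fun r => ?_⟩
    rw [Measure.map_map (measurable_eval_curve r) hmeas]
    exact hC (affineSubinterval s t r)

lemma lintegral_lintegral_eval_le [SFinite π] {C : ℝ≥0}
    (hC : ∀ t : I, π.map (fun γ => γ t) ≤ C • m)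
    {h : X → ℝ≥0∞} (hh : Measurable h) : ∫⁻ γ, (∫⁻ t : I, h (γ t)) ∂π ≤ C * ∫⁻ x, h x ∂m := by
  rw [lintegral_lintegral_swap (f := fun (γ : C(I, X)) (t : I) => h (γ t))
    (hh.comp measurable_curve_eval).aemeasurable]
  calc _ ≤ ∫⁻ _ : I, C * ∫⁻ x, h x ∂m := lintegral_mono fun t => lintegral_eval_le hC t hh
    _ = _ := by simp

end TestPlans

/-! ### Weak upper gradients -/

section WeakUpperGradients

variable {X : Type*} [MetricSpace X] [MeasurableSpace X] [BorelSpace X]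
  {m : Measure X} {π : Measure C(I, X)}

lemma measurable_mul_metricSpeed {g : X → ℝ≥0∞} (hg : Measurable g) (γ : C(I, X)) :
    Measurable fun t : I => g (γ t) * metricSpeed γ t :=
  (hg.comp γ.continuous.measurable).mul (measurable_metricSpeed_right γ)

omit [BorelSpace X] in
lemma isSobolevAlongCurves_of_lipschitz {f : X → ℝ} {L : ℝ≥0} (hf : LipschitzWith L f) :
    IsSobolevAlongCurves m f := fun π hπ => by
  filter_upwards [hπ.ac] with γ hγ
  exact ⟨f ∘ γ, hγ.1.comp_lipschitz hf, Eventually.of_forall fun _ => rfl, rfl, rfl⟩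

/-- Restricted plans give the inequality for countably many pairs of times outside one null set;
continuity of `f` along the curve gives the remaining pairs. -/
lemma IsWeakUpperGradient.ae_forall_le {f : X → ℝ} {g : X → ℝ≥0∞}
    (hg : IsWeakUpperGradient m f g) (hf : Continuous f) (hπ : IsTestPlan m π) :
    ∀ᵐ γ ∂π, curveIntegral g γ < ∞ ∧ ∀ s t : I, s < t →
      ENNReal.ofReal |f (γ t) - f (γ s)| ≤ ∫⁻ r in Icc s t, g (γ r) * metricSpeed γ r := by
  obtain ⟨D, hDc, hD⟩ := TopologicalSpace.exists_countable_dense I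
  have h1 : ∀ s ∈ D, ∀ t ∈ D, ∀ᵐ (γ : C(I, X)) ∂π, s < t →
      ENNReal.ofReal |f (γ t) - f (γ s)| ≤ ∫⁻ r in Icc s t, g (γ r) * metricSpeed γ r := by
    intro s _ t _
    by_cases hst : s < t
    · have h2 := ae_of_ae_map (ContinuousMap.continuous_precomp _).measurable.aemeasurable
        (hg.bound _ (hπ.restrict hst))
      filter_upwards [h2] with γ hγ _
      have h3 := hγ.1
      simp only [ContinuousMap.comp_apply, affineSubinterval_zero, affineSubinterval_one] at h3
      refine h3.trans ?_
      rw [← setLIntegral_affineSubinterval hst]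
      refine lintegral_mono fun r => ?_
      calc _ ≤ g (γ (affineSubinterval s t r)) * (ENNReal.ofReal (t - s) *
            metricSpeed γ (affineSubinterval s t r)) := by
            gcongr
            · rfl
            · exact metricSpeed_comp_affineSubinterval_le γ hst r
        _ = _ := by ring
    · simp [hst]
  have h4 : ∀ᵐ (γ : C(I, X)) ∂π, ∀ s ∈ D, ∀ t ∈ D, s < t →
      ENNReal.ofReal |f (γ t) - f (γ s)| ≤ ∫⁻ r in Icc s t, g (γ r) * metricSpeed γ r := by
    rw [ae_ball_iff hDc]
    intro s hs
    rw [ae_ball_iff hDc]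
    exact h1 s hs
  filter_upwards [h4, hg.bound _ hπ] with γ hγ hfin
  refine ⟨hfin.2, fun s t hst => ?_⟩
  have := le_measure_Icc_of_dense hD
    (F := fun p => ENNReal.ofReal |f (γ p.2) - f (γ p.1)|)
    (ENNReal.continuous_ofReal.comp (by fun_prop))
    (μ := volume.withDensity fun r => g (γ r) * metricSpeed γ r) (fun s hs t ht hst => ?_) hst
  · rwa [withDensity_apply _ measurableSet_Icc] at this
  · rw [withDensity_apply _ measurableSet_Icc]
    exact hγ s hs t ht hst

/-- Increments of `h` are dominated by those of the primitive of `b`, which has derivative `b`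
almost everywhere by Lebesgue's theorem; compare difference quotients. -/
lemma ae_ofReal_abs_deriv_le_of_le_setLIntegral {h : I → ℝ} {b : I → ℝ≥0∞} (hbm : Measurable b)
    (hb : ∫⁻ t, b t ≠ ∞)
    (hle : ∀ s t : I, s < t → ENNReal.ofReal |h t - h s| ≤ ∫⁻ r in Icc s t, b r) :
    ∀ᵐ t : I, ∀ D : ℝ, t ∈ Ioo (0 : I) 1 →
      HasDerivAt (h ∘ projIcc (0 : ℝ) 1 zero_le_one) D t → ENNReal.ofReal |D| ≤ b t := by
  set β : ℝ → ℝ≥0∞ := fun x => b (projIcc 0 1 zero_le_one x) with hβ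
  have hβm : Measurable β := hbm.comp continuous_projIcc.measurable
  have hβI : ∀ s t : I, ∫⁻ r in Icc s t, b r = ∫⁻ x in Icc (s : ℝ) t, β x := fun s t => by
    rw [← setLIntegral_Icc_coe]
    simp [hβ]
  have hfin : ∀ s t : I, ∫⁻ x in Icc (s : ℝ) t, β x ≠ ∞ := fun s t => by
    rw [← hβI]
    exact ne_top_of_le_ne_top hb (setLIntegral_le_lintegral _ _)
  have hint : IntervalIntegrable (fun x => (β x).toReal) volume 0 1 := by
    rw [intervalIntegrable_iff_integrableOn_Icc_of_le zero_le_one]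
    exact integrable_toReal_of_lintegral_ne_top hβm.aemeasurable (by simpa using hfin 0 1)
  have hint' : ∀ s t : I, IntervalIntegrable (fun x => (β x).toReal) volume s t := fun s t =>
    hint.mono_set (by
      rw [uIcc_of_le zero_le_one]
      exact uIcc_subset_Icc s.2 t.2)
  have hleb : ∀ᵐ t : I, HasDerivAt (fun x => ∫ r in (0 : ℝ)..x, (β r).toReal) (β t).toReal t := by
    refine (ae_unitInterval_iff (p := fun t =>
      HasDerivAt (fun x => ∫ r in (0 : ℝ)..x, (β r).toReal) (β t).toReal t)).2 ?_
    filter_upwards [hint.ae_hasDerivAt_integral] with x hx hx'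
    rw [uIcc_of_le zero_le_one] at hx
    exact hx hx' 0 ⟨le_rfl, zero_le_one⟩
  filter_upwards [hleb] with t ht D ht01 hD
  set H := h ∘ projIcc (0 : ℝ) 1 zero_le_one with hH
  set B : ℝ → ℝ := fun x => ∫ r in (0 : ℝ)..x, (β r).toReal with hB
  have key : ∀ t s : I, |H s - H t| ≤ |B s - B t| := by
    have aux : ∀ s t : I, s < t → |H t - H s| ≤ |B t - B s| := by
      intro s t hst
      have h1 := hle s t hst
      rw [hβI] at h1
      have h2 : B t - B s = (∫⁻ x in Icc (s : ℝ) t, β x).toReal := by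
        rw [hB]
        simp only
        rw [intervalIntegral.integral_interval_sub_left (by simpa using hint' 0 t)
            (by simpa using hint' 0 s),
          intervalIntegral.integral_of_le hst.le, ← integral_Icc_eq_integral_Ioc,
          integral_toReal hβm.aemeasurable (ae_lt_top hβm (hfin s t))]
      rw [h2, abs_of_nonneg ENNReal.toReal_nonneg]
      simp only [hH, Function.comp, projIcc_val]
      exact (ENNReal.ofReal_le_iff_le_toReal (hfin s t)).1 h1
    intro t s
    rcases lt_trichotomy t s with h | rfl | h
    · exact aux t s h
    · simp
    · rw [abs_sub_comm, abs_sub_comm (B s)]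
      exact aux s t h
  have hslopeH := (hasDerivAt_iff_tendsto_slope.mp hD).abs
  have hslopeB := (hasDerivAt_iff_tendsto_slope.mp ht).abs
  have hev : ∀ᶠ x in 𝓝[≠] (t : ℝ), |slope H t x| ≤ |slope B t x| := by
    have hnh : Icc (0 : ℝ) 1 ∈ 𝓝 (t : ℝ) := Icc_mem_nhds ht01.1 ht01.2
    filter_upwards [mem_nhdsWithin_of_mem_nhds hnh] with x hx
    rw [slope_def_field, slope_def_field, abs_div, abs_div]
    exact div_le_div_of_nonneg_right (key t ⟨x, hx⟩) (abs_nonneg _)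
  have hDle := le_of_tendsto_of_tendsto hslopeH hslopeB hev
  rw [abs_of_nonneg ENNReal.toReal_nonneg] at hDle
  calc ENNReal.ofReal |D| ≤ ENNReal.ofReal (β t).toReal := ENNReal.ofReal_le_ofReal hDle
    _ ≤ β t := ENNReal.ofReal_toReal_le
    _ = b t := by simp [hβ]

/-- Weak upper gradients of a Lipschitz function are stable under countable infima. -/
lemma IsWeakUpperGradient.iInf {f : X → ℝ} {L : ℝ≥0} (hf : LipschitzWith L f)
    {g : ℕ → X → ℝ≥0∞} (hg : ∀ n, IsWeakUpperGradient m f (g n)) :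
    IsWeakUpperGradient m f fun x => ⨅ n, g n x := by
  refine ⟨Measurable.iInf fun n => (hg n).measurable, fun π hπ => ?_⟩
  have h1 := ae_all_iff.2 fun n => (hg n).ae_forall_le hf.continuous hπ
  filter_upwards [h1, hπ.ac] with γ hγ hac
  constructor
  -- Integral bounds do not pass to an infimum of integrands, but pointwise bounds do: each `g n`
  -- bounds the derivative of `f ∘ γ` at almost every time.
  · have h2 : ∀ᵐ t : I, ∀ n, ∀ D : ℝ, t ∈ Ioo (0 : I) 1 →
      HasDerivAt ((f ∘ γ) ∘ projIcc (0 : ℝ) 1 zero_le_one) D t →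
        ENNReal.ofReal |D| ≤ g n (γ t) * metricSpeed γ t :=
      ae_all_iff.2 fun n => ae_ofReal_abs_deriv_le_of_le_setLIntegral
        (measurable_mul_metricSpeed (hg n).measurable γ) (hγ n).1.ne (hγ n).2
    have h3 := (hac.1.comp_lipschitz hf).ofReal_abs_sub_le
      (b := fun t => (⨅ n, g n (γ t)) * metricSpeed γ t) (s := 0) (t := 1) ?_ zero_le_one
    · rwa [Icc_zero_one_eq_univ, Measure.restrict_univ] at h3
    · filter_upwards [h2, ae_metricSpeed_lt_top hac] with t ht hs D hD1 hD2
      rw [ENNReal.iInf_mul fun h => absurd h hs.ne]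
      exact le_iInf fun n => ht n D hD1 hD2
  · refine lt_of_le_of_lt (lintegral_mono fun t => ?_) (hγ 0).1
    gcongr
    exact iInf_le _ 0

variable [CompactSpace X]

lemma isWeakUpperGradient_ascSlope {f : X → ℝ} {L : ℝ≥0} (hf : LipschitzWith L f) :
    IsWeakUpperGradient m f (ascSlope f) := by
  refine ⟨measurable_ascSlope hf.continuous, fun π hπ => ?_⟩
  filter_upwards [hπ.ac] with γ hγ
  refine ⟨ofReal_abs_sub_le_curveIntegral_ascSlope hf hγ, ?_⟩
  calc curveIntegral (ascSlope f) γ ≤ ∫⁻ t : I, L * metricSpeed γ t :=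
        lintegral_mono fun t => by gcongr; exact ascSlope_le_of_lipschitz hf _
    _ = L * ∫⁻ t : I, metricSpeed γ t := lintegral_const_mul _ (measurable_metricSpeed_right γ)
    _ < ∞ := ENNReal.mul_lt_top ENNReal.coe_lt_top
        ((lintegral_metricSpeed_le γ).trans_lt (ENNReal.add_lt_top.2 ⟨ENNReal.one_lt_top, hγ.2⟩))

/-- Minimize `∫ g dm` over the weak upper gradients. The infimum `G` of a minimizing sequence is
again one, and its minimum with any competitor cannot have smaller integral, so it agrees with `G`
almost everywhere. -/
lemma exists_isMinimalWeakUpperGradient [IsFiniteMeasure m] {f : X → ℝ} {L : ℝ≥0}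
    (hf : LipschitzWith L f) : ∃ G : X → ℝ≥0∞, IsMinimalWeakUpperGradient m f G := by
  set S : Set ℝ≥0∞ := (fun g : X → ℝ≥0∞ => ∫⁻ x, g x ∂m) '' {g | IsWeakUpperGradient m f g}
  have hS : S.Nonempty := ⟨_, ascSlope f, isWeakUpperGradient_ascSlope hf, rfl⟩
  obtain ⟨v, -, hvt, hvS⟩ := exists_seq_tendsto_sInf hS (OrderBot.bddBelow S)
  choose g hg hgv using hvS
  have hG := IsWeakUpperGradient.iInf hf hg
  set G : X → ℝ≥0∞ := fun x => ⨅ n, g n x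
  have hGle : ∫⁻ x, G x ∂m ≤ sInf S := by
    refine ge_of_tendsto hvt (Eventually.of_forall fun n => ?_)
    rw [← hgv n]
    exact lintegral_mono fun x => iInf_le _ n
  have hfin : ∫⁻ x, G x ∂m ≠ ∞ := by
    refine ne_top_of_le_ne_top ?_ (hGle.trans (sInf_le ⟨ascSlope f,
      isWeakUpperGradient_ascSlope hf, rfl⟩))
    refine ne_top_of_le_ne_top ?_ (lintegral_mono fun x => ascSlope_le_of_lipschitz hf x)
    simpa using ENNReal.mul_ne_top ENNReal.coe_ne_top (measure_ne_top m univ)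
  refine ⟨G, isSobolevAlongCurves_of_lipschitz hf, hG, fun G' hG' => ?_⟩
  -- The sequence `G, G', G', …` has infimum `min G G'`.
  have hmin := IsWeakUpperGradient.iInf hf (m := m) (g := fun n => if n = 0 then G else G')
    (fun n => by split_ifs; exacts [hG, hG'])
  set M : X → ℝ≥0∞ := fun x => ⨅ n : ℕ, (if n = 0 then G else G') x
  have hMG : M ≤ G := fun x => (iInf_le _ 0).trans (by simp)
  have hMG' : M ≤ G' := fun x => (iInf_le _ 1).trans (by simp)
  have hint : ∫⁻ x, G x ∂m ≤ ∫⁻ x, M x ∂m := hGle.trans (sInf_le ⟨M, hmin, rfl⟩)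
  have hae : M =ᵐ[m] G := ae_eq_of_ae_le_of_lintegral_le (Eventually.of_forall hMG)
    (ne_top_of_le_ne_top hfin (lintegral_mono hMG)) hG.measurable.aemeasurable hint
  filter_upwards [hae] with x hx
  rw [← hx]
  exact hMG' x

lemma IsMinimalWeakUpperGradient.le_ascSlope {f : X → ℝ} {L : ℝ≥0} (hf : LipschitzWith L f)
    {G : X → ℝ≥0∞} (hG : IsMinimalWeakUpperGradient m f G) : G ≤ᵐ[m] ascSlope f :=
  hG.minimal _ (isWeakUpperGradient_ascSlope hf)

end WeakUpperGradients


lemma integrable_of_continuous {Y : Type*} [TopologicalSpace Y] [CompactSpace Y]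
    [MeasurableSpace Y] [OpensMeasurableSpace Y] {μ : Measure Y}
    [IsFiniteMeasureOnCompacts μ] {f : Y → ℝ} (hf : Continuous f) : Integrable f μ :=
  hf.integrable_of_hasCompactSupport (HasCompactSupport.of_compactSpace f)

/-! ### `c`-transforms -/

section CTransform

variable {X : Type*} [MetricSpace X] [CompactSpace X]

variable (X) in
/-- The diameter of a compact space, as a nonnegative real. -/
noncomputable def diamNN : ℝ≥0 := ⟨Metric.diam (univ : Set X), Metric.diam_nonneg⟩

lemma dist_le_diamNN (x y : X) : dist x y ≤ diamNN X :=
  Metric.dist_le_diam_of_mem (Metric.isBounded_of_compactSpace) (mem_univ x) (mem_univ y)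

lemma edist_le_diamNN (x y : X) : edist x y ≤ diamNN X := by
  rw [edist_dist, ← ENNReal.ofReal_coe_nnreal]
  exact ENNReal.ofReal_le_ofReal (dist_le_diamNN x y)

lemma dist_sq_sub_le (x y y' : X) :
    dist x y ^ 2 / 2 - dist x y' ^ 2 / 2 ≤ diamNN X * dist y y' := by
  have h1 : dist x y - dist x y' ≤ dist y y' := by
    have := dist_triangle x y' y
    rw [dist_comm y' y] at this
    linarith
  have h2 : dist x y + dist x y' ≤ 2 * diamNN X := by
    linarith [dist_le_diamNN x y, dist_le_diamNN x y']
  have h3 : 0 ≤ dist x y + dist x y' := by positivity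
  nlinarith [dist_nonneg (x := y) (y := y'), mul_le_mul_of_nonneg_right h1 h3,
    mul_le_mul_of_nonneg_left h2 (dist_nonneg (x := y) (y := y'))]

lemma bddBelow_dist_sq_sub {ψ : X → ℝ} (hψ : Continuous ψ) (y : X) :
    BddBelow (range fun x => dist x y ^ 2 / 2 - ψ x) :=
  (isCompact_range (by fun_prop)).bddBelow

lemma cTransform_le {ψ : X → ℝ} (hψ : Continuous ψ) (x y : X) :
    cTransform ψ y ≤ dist x y ^ 2 / 2 - ψ x :=
  ciInf_le (bddBelow_dist_sq_sub hψ y) x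

lemma lipschitzWith_cTransform [Nonempty X] {ψ : X → ℝ}
    (h : ∀ y, BddBelow (range fun x => dist x y ^ 2 / 2 - ψ x)) :
    LipschitzWith (diamNN X) (cTransform ψ) := by
  refine LipschitzWith.of_le_add_mul _ fun y y' => ?_
  rw [← sub_le_iff_le_add]
  refine le_ciInf fun x => ?_
  have h1 : cTransform ψ y ≤ dist x y ^ 2 / 2 - ψ x := ciInf_le (h y) x
  linarith [dist_sq_sub_le x y y']

lemma lipschitzWith_cTransform_of_continuous [Nonempty X] {ψ : X → ℝ} (hψ : Continuous ψ) :
    LipschitzWith (diamNN X) (cTransform ψ) :=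
  lipschitzWith_cTransform (bddBelow_dist_sq_sub hψ)

lemma IsCConcave.lipschitzWith [Nonempty X] {φ : X → ℝ} (hφ : IsCConcave φ) :
    LipschitzWith (diamNN X) φ := by
  obtain ⟨θ, hθ⟩ := hφ
  have : φ = cTransform θ := funext fun y => (hθ y).2
  rw [this]
  exact lipschitzWith_cTransform fun y => (hθ y).1

lemma le_cTransform_cTransform [Nonempty X] {ψ : X → ℝ} (hψ : Continuous ψ) (x : X) :
    ψ x ≤ cTransform (cTransform ψ) x := by
  refine le_ciInf fun y => ?_
  have := cTransform_le hψ x y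
  rw [dist_comm y x]
  linarith

/-- From `φ = θᶜ` follows `θ ≤ φᶜ`, and the transform reverses order. The opposite inequality holds
for every continuous function. -/
lemma IsCConcave.cTransform_cTransform [Nonempty X] {φ : X → ℝ} (hφ : IsCConcave φ) :
    cTransform (cTransform φ) = φ := by
  have hc := hφ.lipschitzWith.continuous
  refine funext fun y => le_antisymm ?_ (le_cTransform_cTransform hc y)
  obtain ⟨θ, hθ⟩ := hφ
  have h1 : ∀ x, θ x ≤ cTransform φ x := fun x => le_ciInf fun y => by
    have h2 := ciInf_le (hθ y).1 x
    have h3 : φ y ≤ dist x y ^ 2 / 2 - θ x := by rw [(hθ y).2]; exact h2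
    rw [dist_comm y x]
    linarith
  rw [(hθ y).2]
  exact ciInf_mono (bddBelow_dist_sq_sub (lipschitzWith_cTransform_of_continuous hc).continuous y)
    fun x => by linarith [h1 x]

/-- The contact set `{(x, y) : φ(x) + φᶜ(y) = d²(x, y) / 2}`. -/
def contactSet (φ : X → ℝ) : Set (X × X) :=
  {p | φ p.1 + cTransform φ p.2 = dist p.1 p.2 ^ 2 / 2}

lemma isClosed_contactSet [Nonempty X] {φ : X → ℝ} (hφ : Continuous φ) :
    IsClosed (contactSet φ) := by
  have := (lipschitzWith_cTransform_of_continuous hφ).continuous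
  exact isClosed_eq (by fun_prop) (by fun_prop)

lemma IsCConcave.exists_mem_contactSet [Nonempty X] {φ : X → ℝ} (hφ : IsCConcave φ) (x : X) :
    ∃ y, (x, y) ∈ contactSet φ := by
  have hc := (lipschitzWith_cTransform_of_continuous hφ.lipschitzWith.continuous).continuous
  obtain ⟨y, -, hy⟩ := isCompact_univ.exists_isMinOn univ_nonempty
    (f := fun y => dist y x ^ 2 / 2 - cTransform φ y) (by fun_prop)
  refine ⟨y, ?_⟩
  have h1 : cTransform (cTransform φ) x = dist y x ^ 2 / 2 - cTransform φ y :=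
    le_antisymm (cTransform_le hc y x) (le_ciInf fun z => hy (mem_univ z))
  rw [hφ.cTransform_cTransform] at h1
  simp only [contactSet, mem_ofPred_eq, h1, dist_comm x y]
  ring

lemma sub_le_of_mem_contactSet {φ : X → ℝ} (hφ : Continuous φ) {x y : X}
    (h : (x, y) ∈ contactSet φ) (z : X) :
    φ z - φ x ≤ dist z y ^ 2 / 2 - dist x y ^ 2 / 2 := by
  have h1 := cTransform_le hφ z y
  have h2 : φ x + cTransform φ y = dist x y ^ 2 / 2 := h
  linarith

/-- The increment of `φ` from `x` to `z` is at most (d²(z,y) - d²(x,y))/2, which the triangle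
inequality bounds by d(z,x) (d(x,y) + d(z,x)/2). Contact bounds increments from above only, hence
the ascending slope. -/
lemma ascSlope_le_of_mem_contactSet {φ : X → ℝ} (hφ : Continuous φ) {x y : X}
    (h : (x, y) ∈ contactSet φ) : ascSlope φ x ≤ edist x y := by
  refine le_of_forall_gt fun a ha => ?_
  have htend : Tendsto (fun z => ENNReal.ofReal (dist x y + dist z x / 2)) (𝓝[≠] x)
      (𝓝 (edist x y)) := by
    have : Tendsto (fun z => ENNReal.ofReal (dist x y + dist z x / 2)) (𝓝 x)
        (𝓝 (ENNReal.ofReal (dist x y + dist x x / 2))) :=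
      (ENNReal.continuous_ofReal.comp (by fun_prop)).tendsto x
    rw [dist_self, zero_div, add_zero, ← edist_dist] at this
    exact this.mono_left nhdsWithin_le_nhds
  obtain ⟨b, hb1, hb2⟩ := exists_between ha
  refine lt_of_le_of_lt (limsup_le_of_le (h := ?_)) hb2
  filter_upwards [htend.eventually (gt_mem_nhds hb1)] with z hz
  refine ENNReal.div_le_of_le_mul (le_trans ?_ (mul_le_mul_left hz.le _))
  rw [edist_dist z x, ← ENNReal.ofReal_mul (by positivity)]
  refine ENNReal.ofReal_le_ofReal ((sub_le_of_mem_contactSet hφ h z).trans ?_)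
  have h1 := dist_triangle z x y
  nlinarith [dist_nonneg (x := z) (y := y), dist_nonneg (x := x) (y := y),
    dist_nonneg (x := z) (y := x)]

end CTransform

/-! ### Kantorovich duality -/

section Duality

variable {X : Type*} [MetricSpace X] [CompactSpace X] [MeasurableSpace X] [BorelSpace X]

/-- The values `∫ u dμ + ∫ v dν` of the pairs of continuous functions with `h ≤ u ⊕ v`. -/
def superValues (μ ν : Measure X) (h : C(X × X, ℝ)) : Set ℝ :=
  {r | ∃ u v : C(X, ℝ), (∀ x y, h (x, y) ≤ u x + v y) ∧ r = ∫ x, u x ∂μ + ∫ y, v y ∂ν}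

variable (μ ν : Measure X)

omit [BorelSpace X] in

lemma superValues_nonempty (h : C(X × X, ℝ)) : (superValues μ ν h).Nonempty :=
  ⟨_, ContinuousMap.const X ‖h‖, 0, fun x y => by
    simpa using (le_abs_self _).trans (h.norm_coe_le_norm (x, y)), rfl⟩

variable [IsProbabilityMeasure μ] [IsProbabilityMeasure ν]

lemma le_of_mem_superValues {h : C(X × X, ℝ)} {a : ℝ} (ha : ∀ p, a ≤ h p) {r : ℝ}
    (hr : r ∈ superValues μ ν h) : a ≤ r := by
  obtain ⟨u, v, huv, rfl⟩ := hr
  have hu := integrable_of_continuous (μ := μ) u.continuous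
  have hv := integrable_of_continuous (μ := ν) v.continuous
  have h1 : ∀ y, a ≤ ∫ x, u x ∂μ + v y := fun y => by
    have : ∫ _, (a - v y) ∂μ ≤ ∫ x, u x ∂μ := integral_mono (integrable_const _) hu fun x => by
      have h1 := ha (x, y)
      have h2 := huv x y
      simp only
      linarith
    simp only [integral_const, probReal_univ, one_smul] at this
    linarith
  have : ∫ _, (a - ∫ x, u x ∂μ) ∂ν ≤ ∫ y, v y ∂ν := integral_mono (integrable_const _) hv
    fun y => by simp only; linarith [h1 y]
  simp only [integral_const, probReal_univ, one_smul] at this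
  linarith

lemma superValues_bddBelow (h : C(X × X, ℝ)) : BddBelow (superValues μ ν h) :=
  ⟨-‖h‖, fun _ hr => le_of_mem_superValues μ ν
    (fun p => (abs_le.1 (h.norm_coe_le_norm p)).1) hr⟩

/-- The sublinear functional of Kantorovich duality. -/
noncomputable def superGauge (h : C(X × X, ℝ)) : ℝ := sInf (superValues μ ν h)

variable {μ ν} in
lemma superGauge_le {h : C(X × X, ℝ)} {u v : C(X, ℝ)} (huv : ∀ x y, h (x, y) ≤ u x + v y) :
    superGauge μ ν h ≤ ∫ x, u x ∂μ + ∫ y, v y ∂ν :=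
  csInf_le (superValues_bddBelow μ ν h) ⟨u, v, huv, rfl⟩

lemma superGauge_zero : superGauge μ ν 0 = 0 := by
  refine le_antisymm ?_ (le_csInf (superValues_nonempty μ ν _) fun r hr =>
    le_of_mem_superValues μ ν (fun p => le_rfl) hr)
  simpa using superGauge_le (μ := μ) (ν := ν) (h := 0) (u := 0) (v := 0) (by simp)

lemma superGauge_add (h h' : C(X × X, ℝ)) :
    superGauge μ ν (h + h') ≤ superGauge μ ν h + superGauge μ ν h' := by
  rw [superGauge, superGauge, superGauge, ← sub_le_iff_le_add]
  refine le_csInf (superValues_nonempty μ ν _) ?_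
  rintro _ ⟨u, v, huv, rfl⟩
  rw [sub_le_comm]
  refine le_csInf (superValues_nonempty μ ν _) ?_
  rintro _ ⟨u', v', huv', rfl⟩
  have := superGauge_le (μ := μ) (ν := ν) (h := h + h') (u := u + u') (v := v + v')
    fun x y => by
      have h1 := huv x y
      have h2 := huv' x y
      simp only [ContinuousMap.add_apply]
      linarith
  simp only [ContinuousMap.add_apply] at this
  rw [integral_add (integrable_of_continuous u.continuous) (integrable_of_continuous u'.continuous),
    integral_add (integrable_of_continuous v.continuous)
      (integrable_of_continuous v'.continuous)] at this
  rw [superGauge] at this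
  linarith

lemma superGauge_smul_le {c : ℝ} (hc : 0 < c) (h : C(X × X, ℝ)) :
    superGauge μ ν (c • h) ≤ c * superGauge μ ν h := by
  rw [← div_le_iff₀' hc]
  refine le_csInf (superValues_nonempty μ ν _) ?_
  rintro _ ⟨u, v, huv, rfl⟩
  rw [div_le_iff₀' hc]
  have := superGauge_le (μ := μ) (ν := ν) (h := c • h) (u := c • u) (v := c • v)
    fun x y => by
      have h1 := huv x y
      simp only [ContinuousMap.smul_apply, smul_eq_mul]
      nlinarith
  simp only [ContinuousMap.smul_apply, smul_eq_mul, integral_const_mul] at this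
  linarith

lemma superGauge_smul {c : ℝ} (hc : 0 < c) (h : C(X × X, ℝ)) :
    superGauge μ ν (c • h) = c * superGauge μ ν h := by
  refine le_antisymm (superGauge_smul_le μ ν hc h) ?_
  have := superGauge_smul_le μ ν (inv_pos.2 hc) (c • h)
  rw [inv_smul_smul₀ hc.ne'] at this
  rwa [← div_eq_inv_mul, le_div_iff₀' hc] at this

/-- Hahn–Banach, extending from the line spanned by `h₀`. For negative multiples the domination on
that line follows from subadditivity, since the gauge vanishes at 0. -/
lemma exists_linear_le_superGauge (h₀ : C(X × X, ℝ)) :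
    ∃ Λ : C(X × X, ℝ) →ₗ[ℝ] ℝ, Λ h₀ = superGauge μ ν h₀ ∧ ∀ h, Λ h ≤ superGauge μ ν h := by
  have H : ∀ c : ℝ, c • h₀ = 0 → (RingHom.id ℝ) c • superGauge μ ν h₀ = 0 := by
    intro c hc
    rcases smul_eq_zero.1 hc with hc | hc
    · simp [hc]
    · simp [hc, superGauge_zero]
  obtain ⟨Λ, hΛ1, hΛ2⟩ := exists_extension_of_le_sublinear
    (LinearPMap.mkSpanSingleton' h₀ (superGauge μ ν h₀) H) (superGauge μ ν)
    (fun c hc h => superGauge_smul μ ν hc h) (superGauge_add μ ν) (by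
      rintro ⟨x, hx⟩
      obtain ⟨c, rfl⟩ := Submodule.mem_span_singleton.1 hx
      rw [LinearPMap.mkSpanSingleton'_apply]
      simp only [RingHom.id_apply, smul_eq_mul]
      rcases lt_trichotomy c 0 with hc | rfl | hc
      · have h1 := superGauge_add μ ν (c • h₀) ((-c) • h₀)
        rw [← add_smul, add_neg_cancel, zero_smul, superGauge_zero,
          superGauge_smul μ ν (neg_pos.2 hc)] at h1
        linarith
      · simp [superGauge_zero]
      · rw [superGauge_smul μ ν hc])
  refine ⟨Λ, ?_, hΛ2⟩
  have h1 : (1 : ℝ) • h₀ ∈ (LinearPMap.mkSpanSingleton' h₀ (superGauge μ ν h₀) H).domain :=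
    Submodule.mem_span_singleton.2 ⟨1, rfl⟩
  have h2 := hΛ1 ⟨_, h1⟩
  rw [LinearPMap.mkSpanSingleton'_apply] at h2
  simpa using h2

-- Riesz–Markov–Kakutani: on a compact space every continuous function is compactly supported.
open CompactlySupported in
lemma exists_measure_of_positive {Y : Type*} [TopologicalSpace Y] [CompactSpace Y] [T2Space Y]
    [MeasurableSpace Y] [BorelSpace Y] (Λ : C(Y, ℝ) →ₗ[ℝ] ℝ) (hΛ : ∀ h, 0 ≤ h → 0 ≤ Λ h) :
    ∃ ρ : Measure Y, IsFiniteMeasure ρ ∧ ∀ h : C(Y, ℝ), ∫ y, h y ∂ρ = Λ h := by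
  let T : C_c(Y, ℝ) →ₗ[ℝ] ℝ :=
    { toFun := fun f => Λ f.toContinuousMap
      map_add' := fun f g => by rw [← map_add]; rfl
      map_smul' := fun c f => by rw [RingHom.id_apply, ← map_smul]; rfl }
  let T' : C_c(Y, ℝ) →ₚ[ℝ] ℝ := PositiveLinearMap.mk₀ T fun f hf => hΛ _ hf
  refine ⟨RealRMK.rieszMeasure T', inferInstance, fun h => ?_⟩
  exact RealRMK.integral_rieszMeasure T' ⟨h, HasCompactSupport.of_compactSpace h⟩

/-- Existence of a coupling without duality gap. -/
theorem exists_isCoupling_integral_le (h₀ : C(X × X, ℝ)) :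
    ∃ ρ : Measure (X × X), IsFiniteMeasure ρ ∧ IsCoupling μ ν ρ ∧
      ∀ M, (∀ u v : C(X, ℝ), (∀ x y, u x + v y ≤ h₀ (x, y)) →
        ∫ x, u x ∂μ + ∫ y, v y ∂ν ≤ M) → ∫ p, h₀ p ∂ρ ≤ M := by
  -- The gauge at `-h₀` is minus the supremum of the dual problem, so `Λ h₀` equals that supremum.
  -- Domination at `-h ≤ 0` makes `Λ` positive.
  obtain ⟨Λ, hΛ0, hΛ⟩ := exists_linear_le_superGauge μ ν (-h₀)
  obtain ⟨ρ, hρ, hρΛ⟩ := exists_measure_of_positive Λ fun h hh => by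
    have h1 := hΛ (-h)
    have h2 := superGauge_le (μ := μ) (ν := ν) (h := -h) (u := 0) (v := 0) fun x y => by
      simpa using hh (x, y)
    simp only [map_neg, ContinuousMap.zero_apply, integral_zero, add_zero] at h1 h2
    linarith
  -- Domination gives one inequality between the integrals; applied to `-u` it gives the other, and
  -- so identifies the marginal.
  have hfst : ∀ u : C(X, ℝ), ∫ p, u p.1 ∂ρ = ∫ x, u x ∂μ := by
    have aux : ∀ u : C(X, ℝ), ∫ p, u p.1 ∂ρ ≤ ∫ x, u x ∂μ := fun u => by
      have h1 := hρΛ (u.comp ContinuousMap.fst)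
      have h2 := superGauge_le (μ := μ) (ν := ν) (h := u.comp ContinuousMap.fst) (u := u) (v := 0)
        fun x y => by simp
      simp only [ContinuousMap.zero_apply, integral_zero, add_zero] at h2
      exact h1.trans_le ((hΛ _).trans h2)
    intro u
    refine le_antisymm (aux u) ?_
    have := aux (-u)
    simp only [ContinuousMap.neg_apply, integral_neg] at this
    linarith
  have hsnd : ∀ u : C(X, ℝ), ∫ p, u p.2 ∂ρ = ∫ x, u x ∂ν := by
    have aux : ∀ u : C(X, ℝ), ∫ p, u p.2 ∂ρ ≤ ∫ x, u x ∂ν := fun u => by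
      have h1 := hρΛ (u.comp ContinuousMap.snd)
      have h2 := superGauge_le (μ := μ) (ν := ν) (h := u.comp ContinuousMap.snd) (u := 0) (v := u)
        fun x y => by simp
      simp only [ContinuousMap.zero_apply, integral_zero, zero_add] at h2
      exact h1.trans_le ((hΛ _).trans h2)
    intro u
    refine le_antisymm (aux u) ?_
    have := aux (-u)
    simp only [ContinuousMap.neg_apply, integral_neg] at this
    linarith
  refine ⟨ρ, hρ, ⟨?_, ?_⟩, fun M hM => ?_⟩
  · refine ext_of_forall_integral_eq_of_IsFiniteMeasure fun f => ?_
    rw [integral_map measurable_fst.aemeasurable f.continuous.aestronglyMeasurable]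
    exact hfst f.toContinuousMap
  · refine ext_of_forall_integral_eq_of_IsFiniteMeasure fun f => ?_
    rw [integral_map measurable_snd.aemeasurable f.continuous.aestronglyMeasurable]
    exact hsnd f.toContinuousMap
  · have h1 : -M ≤ superGauge μ ν (-h₀) := by
      refine le_csInf (superValues_nonempty μ ν _) ?_
      rintro _ ⟨u, v, huv, rfl⟩
      have := hM (-u) (-v) fun x y => by
        have := huv x y
        simp only [ContinuousMap.neg_apply] at this ⊢
        linarith
      simp only [ContinuousMap.neg_apply, integral_neg] at this
      linarith
    rw [hρΛ]
    rw [map_neg] at hΛ0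
    linarith

end Duality

/-! ### Optimal couplings and the contact set -/

section Couplings

variable {X : Type*} [MetricSpace X] [CompactSpace X] [MeasurableSpace X] [BorelSpace X]
  {μ ν : Measure X} {ρ : Measure (X × X)}

omit [MetricSpace X] [CompactSpace X] [BorelSpace X] in
lemma IsCoupling.isProbabilityMeasure [IsProbabilityMeasure μ] (h : IsCoupling μ ν ρ) :
    IsProbabilityMeasure ρ := by
  refine ⟨?_⟩
  have : (ρ.map Prod.fst) univ = 1 := by rw [h.1]; exact measure_univ
  rwa [Measure.map_apply measurable_fst MeasurableSet.univ, preimage_univ] at this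

lemma cost_eq_ofReal [IsFiniteMeasure ρ] :
    cost ρ = ENNReal.ofReal (∫ p, dist p.1 p.2 ^ 2 ∂ρ) := by
  rw [ofReal_integral_eq_lintegral_ofReal (integrable_of_continuous (by fun_prop))
    (Eventually.of_forall fun p => by positivity)]
  refine lintegral_congr fun p => ?_
  rw [edist_dist, ENNReal.ofReal_pow dist_nonneg]

lemma cost_ne_top [IsFiniteMeasure ρ] : cost ρ ≠ ∞ := by
  rw [cost_eq_ofReal]
  exact ENNReal.ofReal_ne_top

lemma integral_le_of_cost_le {ρ' : Measure (X × X)} [IsFiniteMeasure ρ] [IsFiniteMeasure ρ']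
    (h : cost ρ ≤ cost ρ') : ∫ p, dist p.1 p.2 ^ 2 ∂ρ ≤ ∫ p, dist p.1 p.2 ^ 2 ∂ρ' := by
  rw [cost_eq_ofReal, cost_eq_ofReal] at h
  exact (ENNReal.ofReal_le_ofReal_iff (integral_nonneg fun p => by positivity)).1 h

lemma IsCoupling.integral_add (h : IsCoupling μ ν ρ) [IsFiniteMeasure ρ] {u v : X → ℝ}
    (hu : Continuous u) (hv : Continuous v) :
    ∫ p, (u p.1 + v p.2) ∂ρ = ∫ x, u x ∂μ + ∫ y, v y ∂ν := by
  rw [MeasureTheory.integral_add (integrable_of_continuous (by fun_prop))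
    (integrable_of_continuous (by fun_prop)), ← h.1, ← h.2,
    integral_map measurable_fst.aemeasurable hu.aestronglyMeasurable,
    integral_map measurable_snd.aemeasurable hv.aestronglyMeasurable]

lemma IsCoupling.add_integral_le [Nonempty X] (h : IsCoupling μ ν ρ) [IsFiniteMeasure ρ]
    {φ : X → ℝ} (hφ : Continuous φ) :
    dualFunctional μ ν φ ≤ (∫ p, dist p.1 p.2 ^ 2 ∂ρ) / 2 := by
  have hc := (lipschitzWith_cTransform_of_continuous hφ).continuous
  rw [dualFunctional, ← h.integral_add hφ hc, ← integral_div]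
  exact integral_mono (integrable_of_continuous (by fun_prop))
    (integrable_of_continuous (by fun_prop)) fun p => by
      have := cTransform_le hφ p.1 p.2
      simp only
      linarith

/-- Since φ(x) + φᶜ(y) ≤ d²(x,y)/2 everywhere, the two integrals agree exactly when equality holds
almost everywhere. -/
lemma IsCoupling.ae_mem_contactSet_iff [Nonempty X] (h : IsCoupling μ ν ρ) [IsFiniteMeasure ρ]
    {φ : X → ℝ} (hφ : Continuous φ) : (∀ᵐ p ∂ρ, p ∈ contactSet φ) ↔
      dualFunctional μ ν φ = (∫ p, dist p.1 p.2 ^ 2 ∂ρ) / 2 := by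
  have hc := (lipschitzWith_cTransform_of_continuous hφ).continuous
  rw [dualFunctional, ← h.integral_add hφ hc, ← integral_div]
  have hi1 : Integrable (fun p : X × X => φ p.1 + cTransform φ p.2) ρ :=
    integrable_of_continuous (by fun_prop)
  have hi2 : Integrable (fun p : X × X => dist p.1 p.2 ^ 2 / 2) ρ :=
    integrable_of_continuous (by fun_prop)
  rw [integral_eq_iff_of_ae_le hi1 hi2 (Eventually.of_forall fun p => by
      have := cTransform_le hφ p.1 p.2
      simp only
      linarith)]
  rfl

variable [IsProbabilityMeasure μ]

/-- There are an optimal coupling and a Lipschitz function without duality gap. -/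
lemma exists_isCoupling_dualFunctional_ge [Nonempty X] (μ ν : Measure X) [IsProbabilityMeasure μ]
    [IsProbabilityMeasure ν] : ∃ ρ : Measure (X × X), IsFiniteMeasure ρ ∧ IsCoupling μ ν ρ ∧
      ∀ M, (∀ ψ : X → ℝ, LipschitzWith (diamNN X) ψ → dualFunctional μ ν ψ ≤ M) →
        (∫ p, dist p.1 p.2 ^ 2 ∂ρ) / 2 ≤ M := by
  obtain ⟨ρ, hρ, hc, hM⟩ := exists_isCoupling_integral_le μ ν
    ⟨fun p : X × X => dist p.1 p.2 ^ 2 / 2, by fun_prop⟩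
  refine ⟨ρ, hρ, hc, fun M h => ?_⟩
  rw [← integral_div]
  -- An admissible pair `(u, v)` is improved to `uᶜᶜ` and its transform, so the supremum may be
  -- taken over functions that are Lipschitz with the diameter as constant.
  refine hM M fun u v huv => ?_
  have h1 := lipschitzWith_cTransform_of_continuous u.continuous
  have h2 := lipschitzWith_cTransform_of_continuous h1.continuous
  have h3 := lipschitzWith_cTransform_of_continuous h2.continuous
  refine le_trans ?_ (h _ h2)
  refine add_le_add (integral_mono (integrable_of_continuous u.continuous)
    (integrable_of_continuous h2.continuous) fun x => le_cTransform_cTransform u.continuous x)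
    (integral_mono (integrable_of_continuous v.continuous)
    (integrable_of_continuous h3.continuous) fun y => ?_)
  refine le_trans ?_ (le_cTransform_cTransform h1.continuous y)
  exact le_ciInf fun x => by
    have := huv x y
    simp only [ContinuousMap.coe_mk] at this
    linarith

lemma exists_isOptimalCoupling [Nonempty X] (μ ν : Measure X) [IsProbabilityMeasure μ]
    [IsProbabilityMeasure ν] : ∃ ρ : Measure (X × X), IsOptimalCoupling μ ν ρ := by
  obtain ⟨ρ, hρ, hc, hM⟩ := exists_isCoupling_dualFunctional_ge μ ν
  refine ⟨ρ, hc, fun ρ' hρ' => ?_⟩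
  have := hρ'.isProbabilityMeasure
  rw [cost_eq_ofReal, cost_eq_ofReal]
  refine ENNReal.ofReal_le_ofReal ?_
  have := hM _ fun ψ hψ => hρ'.add_integral_le hψ.continuous
  linarith

/-- No Lipschitz function beats `φ`, so half the cost of the coupling without duality gap is at most
the dual value of `φ`. An optimal coupling costs no more, which forces equality in weak duality. -/
lemma IsKantorovichPotential.ae_mem_contactSet [Nonempty X] [IsProbabilityMeasure ν] {φ : X → ℝ}
    (hφ : IsKantorovichPotential μ ν φ) (hρ : IsOptimalCoupling μ ν ρ) :
    ∀ᵐ p ∂ρ, p ∈ contactSet φ := by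
  have := hρ.1.isProbabilityMeasure
  have hc := hφ.1.lipschitzWith.continuous
  rw [hρ.1.ae_mem_contactSet_iff hc]
  refine le_antisymm (hρ.1.add_integral_le hc) ?_
  obtain ⟨ρ', hρ', hc', hM⟩ := exists_isCoupling_dualFunctional_ge μ ν
  have h1 := hM _ fun ψ hψ => hφ.2 ψ ⟨_, hψ⟩
  linarith [integral_le_of_cost_le (hρ.2 ρ' hc')]

/-- A coupling concentrated on the contact set is optimal, and so is every other optimal
coupling. -/
lemma IsCoupling.isOptimalCoupling_of_contactSet [Nonempty X] {φ : X → ℝ} (hφ : Continuous φ)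
    (hρ : IsCoupling μ ν ρ) (h : ∀ᵐ p ∂ρ, p ∈ contactSet φ) : IsOptimalCoupling μ ν ρ := by
  have := hρ.isProbabilityMeasure
  refine ⟨hρ, fun ρ' hρ' => ?_⟩
  have := hρ'.isProbabilityMeasure
  rw [hρ.ae_mem_contactSet_iff hφ] at h
  rw [cost_eq_ofReal, cost_eq_ofReal]
  refine ENNReal.ofReal_le_ofReal ?_
  linarith [hρ'.add_integral_le hφ]

lemma IsOptimalCoupling.ae_mem_contactSet_of_coupling [Nonempty X] {φ : X → ℝ}
    (hφ : Continuous φ) (hρ : IsCoupling μ ν ρ) (h : ∀ᵐ p ∂ρ, p ∈ contactSet φ)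
    {ρ' : Measure (X × X)} (hρ' : IsOptimalCoupling μ ν ρ') : ∀ᵐ p ∂ρ', p ∈ contactSet φ := by
  have := hρ.isProbabilityMeasure
  have := hρ'.1.isProbabilityMeasure
  rw [hρ.ae_mem_contactSet_iff hφ] at h
  rw [hρ'.1.ae_mem_contactSet_iff hφ]
  refine le_antisymm (hρ'.1.add_integral_le hφ) ?_
  linarith [integral_le_of_cost_le (hρ'.2 ρ hρ)]

lemma IsOptimalCoupling.ofReal_W2_sq (hρ : IsOptimalCoupling μ ν ρ) :
    ENNReal.ofReal (W2 μ ν ^ 2) = cost ρ := by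
  have := hρ.1.isProbabilityMeasure
  have h1 : (⨅ (γ : Measure (X × X)) (_ : IsCoupling μ ν γ), cost γ) = cost ρ :=
    le_antisymm (iInf₂_le ρ hρ.1) (le_iInf₂ hρ.2)
  rw [W2, h1, Real.sq_sqrt ENNReal.toReal_nonneg, ENNReal.ofReal_toReal cost_ne_top]

lemma W2_sq_le [Nonempty X] [IsProbabilityMeasure ν] : W2 μ ν ^ 2 ≤ diamNN X ^ 2 := by
  obtain ⟨ρ, hρ⟩ := exists_isOptimalCoupling μ ν
  have := hρ.1.isProbabilityMeasure
  have h1 := hρ.ofReal_W2_sq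
  rw [cost_eq_ofReal, ENNReal.ofReal_eq_ofReal_iff (by positivity)
    (integral_nonneg fun p => by positivity)] at h1
  rw [h1]
  calc ∫ p, dist p.1 p.2 ^ 2 ∂ρ ≤ ∫ _, ((diamNN X : ℝ) ^ 2) ∂ρ :=
        integral_mono (integrable_of_continuous (by fun_prop)) (integrable_const _) fun p => by
          have := dist_le_diamNN p.1 p.2
          simp only
          gcongr
    _ = _ := by simp

end Couplings


/-! ### Entropy bounds -/

section Entropy

variable {X : Type*} [MeasurableSpace X] {m μ : Measure X} [IsProbabilityMeasure m]
  [IsProbabilityMeasure μ]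

/-- Jensen's inequality in tangent form. With density ρ and `c = m(A)`, log(cρ) ≥ 1 - 1/(cρ);
integrating against `μ` and using that the integral of 1/ρ over `A` is at most `c`, the constants
cancel. -/
lemma neg_log_measureReal_le_Ent (h : Ent m μ ≠ ∞) {A : Set X} (hA : MeasurableSet A)
    (hμA : μ Aᶜ = 0) : 0 < m.real A ∧ -Real.log (m.real A) ≤ (Ent m μ).toReal := by
  obtain ⟨hac, hint⟩ := InformationTheory.klDiv_ne_top_iff.1 h
  have hmA : m A ≠ 0 := fun h0 => by
    have h1 := measure_add_measure_compl (μ := μ) hA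
    rw [hac h0, hμA, measure_univ, add_zero] at h1
    exact zero_ne_one h1
  have hc : 0 < m.real A := ENNReal.toReal_pos hmA (measure_ne_top _ _)
  refine ⟨hc, ?_⟩
  rw [Ent, InformationTheory.toReal_klDiv_of_measure_eq hac (by simp)]
  set c := m.real A with hcdef
  set h : X → ℝ≥0∞ := A.indicator fun x => (μ.rnDeriv m x)⁻¹ with hh
  have hhm : Measurable h := (Measure.measurable_rnDeriv μ m).inv.indicator hA
  have hle : ∫⁻ x, h x ∂μ ≤ m A := by
    rw [← lintegral_rnDeriv_mul hac hhm.aemeasurable, ← lintegral_indicator_one hA]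
    refine lintegral_mono fun x => ?_
    by_cases hx : x ∈ A
    · simp only [hh, indicator_of_mem hx, Pi.one_apply]
      exact ENNReal.mul_inv_le_one _
    · simp [hh, hx]
  have hfin : ∫⁻ x, h x ∂μ ≠ ∞ := ne_top_of_le_ne_top (measure_ne_top _ _) hle
  have hhint : Integrable (fun x => (h x).toReal) μ :=
    integrable_toReal_of_lintegral_ne_top hhm.aemeasurable hfin
  have hI : ∫ x, (h x).toReal ∂μ ≤ c := by
    rw [integral_toReal hhm.aemeasurable (ae_lt_top hhm hfin)]
    exact ENNReal.toReal_mono (measure_ne_top _ _) hle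
  have hmono : ∫ x, (1 - Real.log c - c⁻¹ * (h x).toReal) ∂μ ≤ ∫ x, llr μ m x ∂μ := by
    refine integral_mono_ae ((integrable_const _).sub (hhint.const_mul _)) hint ?_
    have hAae : ∀ᵐ x ∂μ, x ∈ A := hμA
    filter_upwards [Measure.rnDeriv_pos hac, hac.ae_le (Measure.rnDeriv_lt_top μ m), hAae]
      with x hpos hlt hxA
    have hρ : 0 < (μ.rnDeriv m x).toReal := ENNReal.toReal_pos hpos.ne' hlt.ne
    simp only [hh, indicator_of_mem hxA, ENNReal.toReal_inv, llr]
    have := Real.one_sub_inv_le_log_of_pos (mul_pos hc hρ)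
    rw [Real.log_mul hc.ne' hρ.ne', mul_inv] at this
    linarith
  rw [integral_sub (integrable_const _) (hhint.const_mul _), integral_const_mul] at hmono
  simp only [integral_const, probReal_univ, one_smul] at hmono
  have : c⁻¹ * ∫ x, (h x).toReal ∂μ ≤ 1 := by
    rw [inv_mul_le_iff₀ hc]
    linarith
  linarith

lemma Ent_le_log {C : ℝ≥0} (hC : μ ≤ C • m) :
    Ent m μ ≠ ∞ ∧ (Ent m μ).toReal ≤ Real.log C := by
  have hac : μ ≪ m := (Measure.absolutelyContinuous_of_le hC).trans
    (Measure.smul_absolutelyContinuous (μ := m))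
  have hbd : μ.rnDeriv m ≤ᵐ[m] fun _ => (C : ℝ≥0∞) := by
    refine ae_le_of_forall_setLIntegral_le_of_sigmaFinite (Measure.measurable_rnDeriv μ m)
      fun s hs _ => ?_
    rw [← withDensity_apply _ hs, Measure.withDensity_rnDeriv_eq _ _ hac, setLIntegral_const]
    exact hC s
  have hint : Integrable (llr μ m) μ := by
    rw [← integrable_rnDeriv_mul_log_iff hac]
    -- The function x log x is bounded on `[0, C]`, so the entropy is finite.
    obtain ⟨B, hB⟩ := (isCompact_Icc (a := (0 : ℝ)) (b := C)).exists_bound_of_continuousOn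
      Real.continuous_mul_log.continuousOn
    refine Integrable.of_bound ((Real.continuous_mul_log.measurable.comp
      (Measure.measurable_rnDeriv μ m).ennreal_toReal).aestronglyMeasurable) B ?_
    filter_upwards [hbd] with x hx
    exact hB _ ⟨ENNReal.toReal_nonneg, by simpa using ENNReal.toReal_mono ENNReal.coe_ne_top hx⟩
  refine ⟨InformationTheory.klDiv_ne_top hac hint, ?_⟩
  rw [Ent, InformationTheory.toReal_klDiv_of_measure_eq hac (by simp)]
  calc ∫ x, llr μ m x ∂μ ≤ ∫ _, Real.log C ∂μ := by
        refine integral_mono_ae hint (integrable_const _) ?_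
        filter_upwards [Measure.rnDeriv_pos hac, hac.ae_le (Measure.rnDeriv_lt_top μ m),
          hac.ae_le hbd] with x hpos hlt hx
        exact Real.log_le_log (ENNReal.toReal_pos hpos.ne' hlt.ne)
          (by simpa using ENNReal.toReal_mono ENNReal.coe_ne_top hx)
    _ = _ := by simp

end Entropy

/-! ### Propagation of density bounds in strong `CD(K, ∞)` spaces -/

section StrongCD

variable {X : Type*} [MetricSpace X] [CompactSpace X] [MeasurableSpace X] [BorelSpace X]
  {m μ₀ μ₁ : Measure X} {π : Measure C(I, X)}

omit [CompactSpace X] [BorelSpace X] in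
lemma IsTestPlan.of_isOptGeodPlan (hπ : IsOptGeodPlan μ₀ μ₁ π) {C : ℝ≥0}
    (hC : ∀ t : I, π.map (fun γ => γ t) ≤ C • m)
    (hfin : (∫⁻ γ, edist (γ 0) (γ 1) ^ 2 ∂π) < ∞) : IsTestPlan m π := by
  refine ⟨hπ.prob, ?_, ?_, C, hC⟩
  · filter_upwards [hπ.geodesic] with γ hγ using IsGeodesic.isAC2 hγ
  · refine (lintegral_mono_ae ?_).trans_lt hfin
    filter_upwards [hπ.geodesic] with γ hγ using IsGeodesic.energy_le hγ

omit [CompactSpace X] in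
lemma measurable_endpoints : Measurable fun γ : C(I, X) => (γ 0, γ 1) :=
  (measurable_eval_curve 0).prodMk (measurable_eval_curve 1)

omit [CompactSpace X] in
lemma IsOptGeodPlan.map_zero (hπ : IsOptGeodPlan μ₀ μ₁ π) : π.map (fun γ => γ 0) = μ₀ := by
  rw [← hπ.optimal.1.1, Measure.map_map measurable_fst measurable_endpoints]
  rfl

omit [CompactSpace X] in
lemma IsOptGeodPlan.map_one (hπ : IsOptGeodPlan μ₀ μ₁ π) : π.map (fun γ => γ 1) = μ₁ := by
  rw [← hπ.optimal.1.2, Measure.map_map measurable_snd measurable_endpoints]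
  rfl

omit [CompactSpace X] in
lemma weightedMarginal_le {F : C(I, X) → ℝ≥0} {b : ℝ≥0} (hF : ∀ γ, F γ ≤ b) (t : I) :
    weightedMarginal π F t ≤ b • π.map (fun γ => γ t) := by
  have h1 : π.withDensity (fun γ => (F γ : ℝ≥0∞)) ≤ b • π := by
    calc _ ≤ π.withDensity (fun _ => (b : ℝ≥0∞)) :=
          withDensity_mono (Eventually.of_forall fun γ => ENNReal.coe_le_coe.2 (hF γ))
      _ = _ := withDensity_const _
  calc weightedMarginal π F t ≤ (b • π).map fun γ => γ t :=
        Measure.map_mono h1 (measurable_eval_curve t)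
    _ = _ := Measure.map_smul _ _ _

omit [CompactSpace X] in
lemma isProbabilityMeasure_weightedMarginal {F : C(I, X) → ℝ≥0}
    (hF : ∫⁻ γ, (F γ : ℝ≥0∞) ∂π = 1) (t : I) : IsProbabilityMeasure (weightedMarginal π F t) := by
  have : IsProbabilityMeasure (π.withDensity fun γ => (F γ : ℝ≥0∞)) :=
    ⟨by rw [withDensity_apply _ MeasurableSet.univ, Measure.restrict_univ, hF]⟩
  exact Measure.isProbabilityMeasure_map (measurable_eval_curve t).aemeasurable

/-- The factor 1/8 is half of the maximum 1/4 of `t (1 - t)`; `|K|` covers both signs of the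
curvature. -/
lemma neg_le_curvature_term (K : ℝ) (t : I) {w D : ℝ} (hw : 0 ≤ w) (hwD : w ≤ D) :
    -(|K| / 8 * D) ≤ K / 2 * t * (1 - t) * w := by
  have ht0 := t.2.1
  have ht1 := t.2.2
  have h1 : (t : ℝ) * (1 - t) ≤ 1 / 4 := by nlinarith [sq_nonneg ((t : ℝ) - 1 / 2)]
  have h2 : 0 ≤ (t : ℝ) * (1 - t) := mul_nonneg ht0 (sub_nonneg.2 ht1)
  have h3 : (t : ℝ) * (1 - t) * w ≤ 1 / 4 * D := by gcongr
  have h4 : 0 ≤ (t : ℝ) * (1 - t) * w := mul_nonneg h2 hw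
  have h5 := neg_abs_le K
  nlinarith [abs_nonneg K, mul_le_mul_of_nonneg_left h3 (abs_nonneg K),
    mul_le_mul_of_nonneg_right h5 h4]

/-- In a strong `CD(K, ∞)` space measures with bounded densities are joined by an optimal
geodesic plan whose interpolants have uniformly bounded densities. -/
theorem StrongCD.exists_isOptGeodPlan_isTestPlan [IsProbabilityMeasure m] {K : ℝ}
    (hCD : StrongCD m K) [h₀ : IsProbabilityMeasure μ₀] [h₁ : IsProbabilityMeasure μ₁] {C : ℝ≥0}
    (hμ₀ : μ₀ ≤ C • m) (hμ₁ : μ₁ ≤ C • m) :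
    ∃ π : Measure C(I, X), IsOptGeodPlan μ₀ μ₁ π ∧ IsTestPlan m π := by
  have : Nonempty X := nonempty_of_isProbabilityMeasure m
  obtain ⟨π, hπ, hF⟩ := hCD μ₀ μ₁ h₀ h₁ (Ent_le_log hμ₀).1.lt_top (Ent_le_log hμ₁).1.lt_top
  have hprob := hπ.prob
  refine ⟨π, hπ, ?_⟩
  -- `D` bounds the squared Wasserstein distance. The curvature term then costs at most `|K| / 8 *
  -- D` in entropy, which becomes the exponential factor of `C'`.
  set D : ℝ := (diamNN X : ℝ) ^ 2
  set C' : ℝ≥0 := C * ⟨Real.exp (|K| / 8 * D), (Real.exp_pos _).le⟩ with hC'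
  refine IsTestPlan.of_isOptGeodPlan hπ (C := C') (fun t => ?_) ?_
  · rw [Measure.le_iff]
    intro A hA
    by_contra hlt
    rw [not_le] at hlt
    have hCpos : 0 < C := by
      rcases eq_or_ne C 0 with h | h
      · have := hμ₀ univ
        rw [h, zero_smul, measure_univ] at this
        simp at this
      · exact pos_iff_ne_zero.2 h
    have hmt := measurable_eval_curve (X := X) t
    set a : ℝ≥0 := (π.map (fun γ => γ t) A).toNNReal with ha
    have hprobt : IsProbabilityMeasure (π.map fun γ => γ t) :=
      Measure.isProbabilityMeasure_map hmt.aemeasurable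
    have haa : (a : ℝ≥0∞) = π ((fun γ => γ t) ⁻¹' A) := by
      rw [ha, ENNReal.coe_toNNReal (measure_ne_top _ _), Measure.map_apply hmt hA]
    have ha0 : a ≠ 0 := fun h => by
      rw [Measure.map_apply hmt hA, ← haa, h] at hlt
      simp at hlt
    classical
    -- `F` conditions the plan on passing through `A` at time `t`. The endpoint densities grow by
    -- the factor `a⁻¹` at most.
    set F : C(I, X) → ℝ≥0 := ((fun γ => γ t) ⁻¹' A).indicator fun _ => a⁻¹ with hFdef
    have hFm : Measurable F := measurable_const.indicator (hmt hA)
    have hFb : ∀ γ, F γ ≤ a⁻¹ := fun γ => indicator_le_self' (fun _ _ => zero_le) γ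
    have hF1 : ∫⁻ γ, (F γ : ℝ≥0∞) ∂π = 1 := by
      have : ∀ γ, (F γ : ℝ≥0∞) =
          ((fun γ : C(I, X) => γ t) ⁻¹' A).indicator (fun _ => ((a⁻¹ : ℝ≥0) : ℝ≥0∞)) γ :=
        fun γ => by
        by_cases hγ : γ ∈ (fun γ : C(I, X) => γ t) ⁻¹' A <;> simp [hFdef, hγ]
      simp_rw [this]
      rw [lintegral_indicator_const (hmt hA), ← haa, ← ENNReal.coe_mul, inv_mul_cancel₀ ha0,
        ENNReal.coe_one]
    have hineq := hF F hFm ⟨_, hFb⟩ hF1 t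
    have hp : ∀ s, IsProbabilityMeasure (weightedMarginal π F s) :=
      isProbabilityMeasure_weightedMarginal hF1
    have hp0 := hp 0
    have hp1 := hp 1
    have hpt := hp t
    have hb0 : weightedMarginal π F 0 ≤ (a⁻¹ * C) • m := by
      refine (weightedMarginal_le hFb 0).trans ?_
      rw [hπ.map_zero, mul_smul]
      intro s
      simp only [Measure.smul_apply]
      exact smul_le_smul_of_nonneg_left (hμ₀ s) zero_le
    have hb1 : weightedMarginal π F 1 ≤ (a⁻¹ * C) • m := by
      refine (weightedMarginal_le hFb 1).trans ?_
      rw [hπ.map_one, mul_smul]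
      intro s
      simp only [Measure.smul_apply]
      exact smul_le_smul_of_nonneg_left (hμ₁ s) zero_le
    obtain ⟨he0, hl0⟩ := Ent_le_log hb0
    obtain ⟨he1, hl1⟩ := Ent_le_log hb1
    set e0 := Ent m (weightedMarginal π F 0)
    set e1 := Ent m (weightedMarginal π F 1)
    set et := Ent m (weightedMarginal π F t) with het_def
    rw [← EReal.coe_ennreal_toReal he0, ← EReal.coe_ennreal_toReal he1, ← EReal.coe_mul,
      ← EReal.coe_mul, ← EReal.coe_add, ← EReal.coe_sub] at hineq
    -- The right side of the convexity inequality is real, so the entropy at time `t` is finite.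
    have het : et ≠ ∞ := fun h => by
      rw [h, EReal.coe_ennreal_top] at hineq
      exact absurd hineq (not_le.2 (EReal.coe_lt_top _))
    rw [← EReal.coe_ennreal_toReal het, EReal.coe_le_coe_iff] at hineq
    have hAc : weightedMarginal π F t Aᶜ = 0 := by
      rw [weightedMarginal, Measure.map_apply hmt hA.compl,
        withDensity_apply _ (hmt hA.compl), ← lintegral_zero
          (μ := π.restrict ((fun γ => γ t) ⁻¹' Aᶜ))]
      refine setLIntegral_congr_fun (hmt hA.compl) fun γ hγ => ?_
      have : γ ∉ (fun γ : C(I, X) => γ t) ⁻¹' A := hγ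
      simp [hFdef, this]
    obtain ⟨hmA, hlow⟩ := neg_log_measureReal_le_Ent het hA hAc
    have hW := neg_le_curvature_term K t (sq_nonneg _)
      (W2_sq_le (μ := weightedMarginal π F 0) (ν := weightedMarginal π F 1))
    have ht0 : (0 : ℝ) ≤ t := t.2.1
    have ht1 : (t : ℝ) ≤ 1 := t.2.2
    have haC : (0 : ℝ) < (a⁻¹ * C : ℝ≥0) := by positivity
    -- The entropy at time `t` is at least -log m(A), and both endpoint entropies are at most
    -- log(C/a). Exponentiating bounds `a` by `C' * m.real A`, against `hlt`.
    have hlog : -Real.log (m.real A) ≤ Real.log (a⁻¹ * C : ℝ≥0) + |K| / 8 * D := by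
      have h1 : (1 - (t : ℝ)) * e0.toReal ≤ (1 - t) * Real.log (a⁻¹ * C : ℝ≥0) := by
        have := sub_nonneg.2 ht1
        gcongr
      have h2 : (t : ℝ) * e1.toReal ≤ t * Real.log (a⁻¹ * C : ℝ≥0) := by gcongr
      linarith
    rw [← Real.log_inv, ← Real.log_exp (|K| / 8 * D), ← Real.log_mul haC.ne' (Real.exp_pos _).ne',
      Real.log_le_log_iff (inv_pos.2 hmA) (by positivity), NNReal.coe_mul, NNReal.coe_inv] at hlog
    have ha0' : (0 : ℝ) < a := by positivity
    have hfinal : (a : ℝ) ≤ C * Real.exp (|K| / 8 * D) * m.real A := by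
      rw [inv_le_iff_one_le_mul₀ hmA] at hlog
      have : (a : ℝ) * 1 ≤ a * (((a : ℝ)⁻¹ * C * Real.exp (|K| / 8 * D)) * m.real A) := by gcongr
      rw [mul_one] at this
      refine this.trans (le_of_eq ?_)
      field_simp
    refine absurd hlt (not_lt.2 ?_)
    have h3 : π.map (fun γ => γ t) A = ENNReal.ofReal a := by
      rw [ENNReal.ofReal_coe_nnreal, ha, ENNReal.coe_toNNReal (measure_ne_top _ _)]
    rw [h3]
    calc ENNReal.ofReal a ≤ ENNReal.ofReal (C' * m.real A) := ENNReal.ofReal_le_ofReal hfinal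
      _ = (C' • m) A := by
        rw [ENNReal.ofReal_mul C'.coe_nonneg, ENNReal.ofReal_coe_nnreal, ofReal_measureReal]
        rfl
  · refine lt_of_le_of_lt (lintegral_mono fun γ => ?_)
      (b := ∫⁻ _, ((diamNN X : ℝ≥0∞) ^ 2) ∂π) (by simp)
    gcongr
    exact edist_le_diamNN _ _

end StrongCD


/-! ### Brenier's theorem: from test plans to arbitrary optimal couplings. -/

section Brenier

variable {X : Type*} [MetricSpace X] [CompactSpace X] [MeasurableSpace X] [BorelSpace X]
  {m μ₀ μ₁ : Measure X} {π : Measure C(I, X)}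

-- Compare `φ` at `γ t` and `γ 0` through the contact point `γ 1`: the remaining distance is the
-- fraction 1 - t of the length, and (1 - (1 - t)²)/2 = t - t²/2.
omit [MeasurableSpace X] [BorelSpace X] in
lemma IsGeodesic.le_sub_of_mem_contactSet {γ : C(I, X)} (hγ : IsGeodesic γ) {φ : X → ℝ}
    (hφ : Continuous φ) (h : (γ 0, γ 1) ∈ contactSet φ) (t : I) :
    (t - t ^ 2 / 2) * dist (γ 0) (γ 1) ^ 2 ≤ φ (γ 0) - φ (γ t) := by
  have h1 := sub_le_of_mem_contactSet hφ h (γ t)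
  have h2 : dist (γ t) (γ 1) = (1 - t) * dist (γ 0) (γ 1) := by
    rw [hγ t 1, Icc.coe_one, abs_sub_comm, abs_of_nonneg (sub_nonneg.2 t.2.2)]
  rw [h2] at h1
  nlinarith

omit [CompactSpace X] in
lemma IsWeakUpperGradient.ae_le_edist_mul {f : X → ℝ} {g : X → ℝ≥0∞}
    (hg : IsWeakUpperGradient m f g) (hf : Continuous f) (hπ : IsTestPlan m π)
    (hgeo : ∀ᵐ γ ∂π, IsGeodesic γ) :
    ∀ᵐ γ ∂π, ∀ t : I, 0 < t → ENNReal.ofReal |f (γ t) - f (γ 0)| ≤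
      edist (γ 0) (γ 1) * ∫⁻ r in Icc 0 t, g (γ r) := by
  filter_upwards [hg.ae_forall_le hf hπ, hgeo] with γ h1 h2 t ht
  refine (h1.2 0 t ht).trans ?_
  have hgγ : Measurable fun r : I => g (γ r) := hg.measurable.comp γ.continuous.measurable
  rw [mul_comm, ← lintegral_mul_const _ hgγ]
  exact lintegral_mono fun r => by gcongr; exact IsGeodesic.metricSpeed_le h2 r

/-- The marginals of a test plan depend continuously on time, tested against `L¹(m)`. -/
lemma IsTestPlan.continuous_integral_eval [IsFiniteMeasure m] (hπ : IsTestPlan m π) {f : X → ℝ}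
    (hfm : Measurable f) (hf : Integrable f m) : Continuous fun t : I => ∫ γ, f (γ t) ∂π := by
  have := hπ.prob
  obtain ⟨C, hC⟩ := hπ.compression
  have hint : ∀ {f : X → ℝ}, Measurable f → Integrable f m → ∀ t : I,
      Integrable (fun γ : C(I, X) => f (γ t)) π := by
    intro f hfm hf t
    refine ⟨(hfm.comp (measurable_eval_curve t)).aestronglyMeasurable, ?_⟩
    exact (lintegral_eval_le hC t hfm.enorm).trans_lt (ENNReal.mul_lt_top ENNReal.coe_lt_top hf.2)
  -- By compression, replacing `f` by a continuous `g` changes the integral by at most `C` times the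
  -- L¹(m) distance, at all times simultaneously. The denominator `2 * (C + 1)` stays positive when
  -- `C = 0`.
  refine continuous_of_uniform_approx_of_continuous fun u hu => ?_
  obtain ⟨ε, hε, hεu⟩ := Metric.mem_uniformity_dist.1 hu
  obtain ⟨g, -, hgε, hgc, hgi⟩ := hf.exists_hasCompactSupport_lintegral_sub_le
    (ε := ENNReal.ofReal (ε / (2 * (C + 1)))) (by simp; positivity)
  refine ⟨fun t => ∫ γ, g (γ t) ∂π, ?_, fun t => hεu ?_⟩
  · obtain ⟨B, hB⟩ := (isCompact_univ (X := X)).exists_bound_of_continuousOn hgc.continuousOn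
    refine continuous_of_dominated (bound := fun _ => B) (fun t =>
      (hgc.measurable.comp (measurable_eval_curve t)).aestronglyMeasurable)
      (fun t => Eventually.of_forall fun γ => hB _ (mem_univ _)) (integrable_const _)
      (Eventually.of_forall fun γ => by fun_prop)
  · rw [Real.dist_eq, ← integral_sub (hint hfm hf t) (hint hgc.measurable hgi t),
      ← ENNReal.ofReal_lt_ofReal_iff hε, ← Real.enorm_eq_ofReal_abs]
    calc ‖∫ γ, (f (γ t) - g (γ t)) ∂π‖ₑ ≤ ∫⁻ γ, ‖f (γ t) - g (γ t)‖ₑ ∂π :=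
          enorm_integral_le_lintegral_enorm _
      _ ≤ C * ∫⁻ x, ‖f x - g x‖ₑ ∂m :=
          lintegral_eval_le hC t (h := fun x => ‖f x - g x‖ₑ) (hfm.sub hgc.measurable).enorm
      _ ≤ C * ENNReal.ofReal (ε / (2 * (C + 1))) := by gcongr
      _ = ENNReal.ofReal (C * (ε / (2 * (C + 1)))) := by
          rw [ENNReal.ofReal_mul C.coe_nonneg, ENNReal.ofReal_coe_nnreal]
      _ < ENNReal.ofReal ε := by
          rw [ENNReal.ofReal_lt_ofReal_iff hε]
          have hC0 := C.coe_nonneg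
          rw [mul_div_assoc', div_lt_iff₀ (by positivity)]
          nlinarith

/-- Fubini turns the left side into a time integral of `∫ G(γ_r) dπ`, which is continuous in r and
so close to its value at 0 on a short interval. -/
lemma IsTestPlan.eventually_lintegral_Icc_le [IsFiniteMeasure m] (hπ : IsTestPlan m π)
    {G : X → ℝ≥0∞} (hG : Measurable G) {L : ℝ≥0} (hGL : ∀ᵐ x ∂m, G x ≤ L) {ε : ℝ≥0∞}
    (hε : 0 < ε) : ∀ᶠ t in 𝓝[>] (0 : I), ∫⁻ γ, (∫⁻ r in Icc 0 t, G (γ r)) ∂π ≤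
      ENNReal.ofReal t * (∫⁻ γ, G (γ 0) ∂π + ε) := by
  have := hπ.prob
  obtain ⟨C, hC⟩ := hπ.compression
  have hint : Integrable (fun x => (G x).toReal) m := by
    refine Integrable.of_bound hG.ennreal_toReal.aestronglyMeasurable (L : ℝ) ?_
    filter_upwards [hGL] with x hx
    rw [Real.norm_of_nonneg ENNReal.toReal_nonneg]
    exact ENNReal.toReal_mono ENNReal.coe_ne_top hx
  have hfin : ∀ t : I, ∀ᵐ γ ∂π, G (γ t) < ∞ := fun t =>
    ae_eval hC t (hGL.mono fun x hx => hx.trans_lt ENNReal.coe_lt_top)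
  have hle : ∀ t : I, ∫⁻ γ, G (γ t) ∂π ≠ ∞ := fun t => by
    refine ne_top_of_le_ne_top ?_ (lintegral_mono_ae (ae_eval hC t hGL))
    simp
  have hN : ∀ t : I, ∫⁻ γ, G (γ t) ∂π = ENNReal.ofReal (∫ γ, (G (γ t)).toReal ∂π) := fun t => by
    have hGt : Measurable fun γ : C(I, X) => G (γ t) := hG.comp (measurable_eval_curve t)
    rw [integral_toReal hGt.aemeasurable (hfin t),
      ENNReal.ofReal_toReal (hle t)]
  have hcont : Continuous fun t : I => ∫⁻ γ, G (γ t) ∂π := by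
    simp_rw [hN]
    exact ENNReal.continuous_ofReal.comp (hπ.continuous_integral_eval hG.ennreal_toReal hint)
  have hev : ∀ᶠ t in 𝓝 (0 : I), ∫⁻ γ, G (γ t) ∂π ≤ ∫⁻ γ, G (γ 0) ∂π + ε :=
    (hcont.tendsto 0).eventually (Iic_mem_nhds (ENNReal.lt_add_right (hle 0) hε.ne'))
  obtain ⟨δ, hδ, hδ'⟩ := Metric.eventually_nhds_iff.1 hev
  filter_upwards [nhdsWithin_le_nhds (Metric.ball_mem_nhds (0 : I) hδ)] with t ht
  rw [lintegral_lintegral_swap (f := fun (γ : C(I, X)) (r : I) => G (γ r))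
    (hG.comp measurable_curve_eval).aemeasurable]
  calc _ ≤ ∫⁻ r in Icc 0 t, (∫⁻ γ, G (γ 0) ∂π + ε) := by
        refine setLIntegral_mono measurable_const fun r hr => hδ' ?_
        refine lt_of_le_of_lt ?_ (Metric.mem_ball.1 ht)
        rw [Subtype.dist_eq, Subtype.dist_eq, Real.dist_eq, Real.dist_eq, Icc.coe_zero, sub_zero,
          sub_zero, abs_of_nonneg r.2.1, abs_of_nonneg t.2.1]
        exact hr.2
    _ = _ := by
        rw [setLIntegral_const, unitInterval.volume_Icc, Icc.coe_zero, sub_zero, mul_comm]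

/-- Brenier's theorem for optimal geodesic plans that are test plans. -/
theorem IsOptGeodPlan.ae_eq_of_isTestPlan [IsFiniteMeasure m] [Nonempty X] {φ : X → ℝ}
    (hφ : IsCConcave φ) {G : X → ℝ≥0∞} (hG : IsMinimalWeakUpperGradient m φ G)
    (hπ : IsOptGeodPlan μ₀ μ₁ π) (hπt : IsTestPlan m π)
    (hc : ∀ᵐ γ ∂π, (γ 0, γ 1) ∈ contactSet φ) :
    ∀ᵐ γ ∂π, G (γ 0) = edist (γ 0) (γ 1) ∧ ascSlope φ (γ 0) = edist (γ 0) (γ 1) := by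
  have hL := hφ.lipschitzWith
  have hprob := hπ.prob
  obtain ⟨C, hC⟩ := hπt.compression
  have hGm := hG.isWeakUpperGradient.measurable
  have hGasc := hG.le_ascSlope hL
  have hGL : ∀ᵐ x ∂m, G x ≤ diamNN X :=
    hGasc.mono fun x hx => hx.trans (ascSlope_le_of_lipschitz hL x)
  have h0 : ∀ᵐ γ ∂π, G (γ 0) ≤ ascSlope φ (γ 0) := ae_eval hC 0 hGasc
  have hasc : ∀ᵐ γ ∂π, ascSlope φ (γ 0) ≤ edist (γ 0) (γ 1) :=
    hc.mono fun γ h => ascSlope_le_of_mem_contactSet hL.continuous h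
  -- The lower bound from contact and the upper bound from the weak gradient are divided by the
  -- length; for a constant geodesic the claim is trivial.
  have hkey : ∀ᵐ γ ∂π, ∀ t : I, 0 < t →
      ENNReal.ofReal (t - t ^ 2 / 2) * edist (γ 0) (γ 1) ≤ ∫⁻ r in Icc 0 t, G (γ r) := by
    filter_upwards [hG.isWeakUpperGradient.ae_le_edist_mul hL.continuous hπt hπ.geodesic,
      hc, hπ.geodesic] with γ h1 h2 h3 t ht
    rcases eq_or_ne (edist (γ 0) (γ 1)) 0 with h | h
    · rw [h, mul_zero]
      exact zero_le
    · have h4 := IsGeodesic.le_sub_of_mem_contactSet h3 hL.continuous h2 t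
      have ht' : (0 : ℝ) ≤ t - t ^ 2 / 2 := by nlinarith [t.2.1, t.2.2]
      have h5 : edist (γ 0) (γ 1) * (ENNReal.ofReal (t - t ^ 2 / 2) * edist (γ 0) (γ 1)) ≤
          edist (γ 0) (γ 1) * ∫⁻ r in Icc 0 t, G (γ r) := by
        refine le_trans (le_of_eq ?_) ((ENNReal.ofReal_le_ofReal (h4.trans
          ((le_abs_self _).trans (abs_sub_comm _ _).le))).trans (h1 t ht))
        rw [edist_dist, ENNReal.ofReal_mul ht', ENNReal.ofReal_pow dist_nonneg]
        ring
      exact (ENNReal.mul_le_mul_iff_right h (edist_ne_top _ _)).1 h5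
  have hlefin : ∫⁻ γ, edist (γ 0) (γ 1) ∂π ≠ ∞ := by
    refine ne_top_of_le_ne_top ?_ (lintegral_mono fun γ => edist_le_diamNN (γ 0) (γ 1))
    simp
  have hedm : Measurable fun γ : C(I, X) => edist (γ 0) (γ 1) :=
    Continuous.measurable (by fun_prop)
  -- Integrate, divide by `t`, let `t ↓ 0`. An inequality of integrals suffices because the opposite
  -- one is known pointwise.
  have hI : ∫⁻ γ, edist (γ 0) (γ 1) ∂π ≤ ∫⁻ γ, G (γ 0) ∂π := by
    refine ENNReal.le_of_forall_pos_le_add fun ε hε _ => ?_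
    have hev := hπt.eventually_lintegral_Icc_le hGm hGL (ENNReal.coe_pos.2 hε)
    have hmul : ∀ᶠ t : I in 𝓝[>] (0 : I),
        ENNReal.ofReal (1 - (t : ℝ) / 2) * ∫⁻ γ, edist (γ 0) (γ 1) ∂π ≤
        ∫⁻ γ, G (γ 0) ∂π + ε := by
      filter_upwards [hev, eventually_mem_nhdsWithin] with t h1 ht
      have ht0 : (0 : ℝ) < t := ht
      have h2 : ENNReal.ofReal t * (ENNReal.ofReal (1 - t / 2) * ∫⁻ γ, edist (γ 0) (γ 1) ∂π) ≤
          ENNReal.ofReal t * (∫⁻ γ, G (γ 0) ∂π + ε) := by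
        refine le_trans ?_ h1
        rw [← mul_assoc, ← ENNReal.ofReal_mul ht0.le, ← lintegral_const_mul _ hedm]
        refine lintegral_mono_ae ?_
        filter_upwards [hkey] with γ hγ
        have := hγ t ht
        rwa [show (t : ℝ) * (1 - t / 2) = t - t ^ 2 / 2 by ring]
      exact (ENNReal.mul_le_mul_iff_right (by simpa using ht0) ENNReal.ofReal_ne_top).1 h2
    have htend : Tendsto (fun t : I => ENNReal.ofReal (1 - t / 2) *
        ∫⁻ γ, edist (γ 0) (γ 1) ∂π) (𝓝[>] 0) (𝓝 (∫⁻ γ, edist (γ 0) (γ 1) ∂π)) := by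
      have h1 : Tendsto (fun t : I => ENNReal.ofReal (1 - (t : ℝ) / 2)) (𝓝 0)
          (𝓝 (ENNReal.ofReal (1 - ((0 : I) : ℝ) / 2))) :=
        (ENNReal.continuous_ofReal.comp (by fun_prop)).tendsto 0
      have h2 := ENNReal.Tendsto.mul_const (b := ∫⁻ γ, edist (γ 0) (γ 1) ∂π) h1 (Or.inr hlefin)
      simp only [Icc.coe_zero, zero_div, sub_zero, ENNReal.ofReal_one, one_mul] at h2
      exact h2.mono_left nhdsWithin_le_nhds
    have : (𝓝[>] (0 : I)).NeBot := nhdsGT_neBot_of_exists_gt ⟨1, zero_lt_one⟩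
    exact le_of_tendsto htend hmul
  have hG0 : ∫⁻ γ, G (γ 0) ∂π ≠ ∞ := by
    refine ne_top_of_le_ne_top hlefin (lintegral_mono_ae ?_)
    filter_upwards [h0, hasc] with γ a b using a.trans b
  have heq := ae_eq_of_ae_le_of_lintegral_le (by
    filter_upwards [h0, hasc] with γ a b using a.trans b) hG0 hedm.aemeasurable hI
  filter_upwards [heq, h0, hasc] with γ a b c
  exact ⟨a, le_antisymm c (a ▸ b)⟩

omit [MetricSpace X] [CompactSpace X] [BorelSpace X] in
lemma IsCoupling.lintegral_fst {ρ : Measure (X × X)} (hρ : IsCoupling μ₀ μ₁ ρ) {g : X → ℝ≥0∞}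
    (hg : Measurable g) : ∫⁻ p, g p.1 ∂ρ = ∫⁻ x, g x ∂μ₀ := by
  rw [← hρ.1, lintegral_map hg measurable_fst]

/-- Brenier's theorem for bounded densities. -/
theorem StrongCD.ae_eq_of_le [IsProbabilityMeasure m] {K : ℝ} (hCD : StrongCD m K) {φ : X → ℝ}
    (hφ : IsCConcave φ) {G : X → ℝ≥0∞} (hG : IsMinimalWeakUpperGradient m φ G)
    [IsProbabilityMeasure μ₀] [IsProbabilityMeasure μ₁] {C : ℝ≥0} (hμ₀ : μ₀ ≤ C • m)
    (hμ₁ : μ₁ ≤ C • m) {ρ : Measure (X × X)} (hρ : IsCoupling μ₀ μ₁ ρ)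
    (hc : ∀ᵐ p ∂ρ, p ∈ contactSet φ) :
    ∀ᵐ p ∂ρ, G p.1 = edist p.1 p.2 ∧ ascSlope φ p.1 = edist p.1 p.2 := by
  have : Nonempty X := nonempty_of_isProbabilityMeasure m
  have hρp := hρ.isProbabilityMeasure
  have hL := hφ.lipschitzWith
  have hGm := hG.isWeakUpperGradient.measurable
  obtain ⟨π, hπ, hπt⟩ := hCD.exists_isOptGeodPlan_isTestPlan hμ₀ hμ₁
  have hc' := IsOptimalCoupling.ae_mem_contactSet_of_coupling hL.continuous hρ hc hπ.optimal
  have hD := hπ.ae_eq_of_isTestPlan hφ hG hπt (ae_of_ae_map measurable_endpoints.aemeasurable hc')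
  -- Both couplings are optimal, so they have equal cost; for `π` it is the integral of `G²`, which
  -- depends on the first marginal alone and so has the same value for `ρ`.
  have hcost : cost ρ = ∫⁻ p, G p.1 ^ 2 ∂ρ := by
    have h1 : cost ρ = cost (π.map fun γ => (γ 0, γ 1)) :=
      le_antisymm ((hρ.isOptimalCoupling_of_contactSet hL.continuous hc).2 _ hπ.optimal.1)
        (hπ.optimal.2 _ hρ)
    have hG2 : Measurable fun p : X × X => G p.1 ^ 2 := (hGm.comp measurable_fst).pow_const 2
    rw [h1, hρ.lintegral_fst (hGm.pow_const 2), ← hπ.optimal.1.lintegral_fst (hGm.pow_const 2),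
      lintegral_map hG2 measurable_endpoints, cost,
      lintegral_map (measurable_edist.pow_const 2) measurable_endpoints]
    refine lintegral_congr_ae ?_
    filter_upwards [hD] with γ hγ
    simp only [hγ.1]
  have hac : μ₀ ≪ m := (Measure.absolutelyContinuous_of_le hμ₀).trans
    (Measure.smul_absolutelyContinuous (μ := m))
  have h0 : ∀ᵐ p ∂ρ, G p.1 ≤ ascSlope φ p.1 := by
    have : ∀ᵐ x ∂(ρ.map Prod.fst), G x ≤ ascSlope φ x := by
      rw [hρ.1]
      exact hac.ae_le (hG.le_ascSlope hL)
    exact ae_of_ae_map measurable_fst.aemeasurable this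
  have hasc : ∀ᵐ p ∂ρ, ascSlope φ p.1 ≤ edist p.1 p.2 :=
    hc.mono fun p h => ascSlope_le_of_mem_contactSet hL.continuous h
  have heq := ae_eq_of_ae_le_of_lintegral_le (f := fun p => G p.1 ^ 2)
    (g := fun p => edist p.1 p.2 ^ 2) (μ := ρ) (by
    filter_upwards [h0, hasc] with p a b
    gcongr
    exact a.trans b) (hcost ▸ cost_ne_top) (measurable_edist.pow_const 2).aemeasurable hcost.le
  filter_upwards [heq, h0, hasc] with p a b c
  have a' : G p.1 = edist p.1 p.2 := (ENNReal.pow_right_strictMono two_ne_zero).injective a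
  exact ⟨a', le_antisymm c (a' ▸ b)⟩

omit [MetricSpace X] [CompactSpace X] [BorelSpace X] in
lemma map_fst_restrict_le {ρ : Measure (X × X)} {B : Set (X × X)} {f : X → ℝ≥0∞}
    (hf : Measurable f) (hρ : ρ.map Prod.fst = m.withDensity f) {n : ℝ≥0}
    (hBf : ∀ p ∈ B, f p.1 ≤ n) : (ρ.restrict B).map Prod.fst ≤ n • m := by
  rw [Measure.le_iff]
  intro s hs
  have hset : MeasurableSet (s ∩ {x | f x ≤ n}) := hs.inter (measurableSet_le hf measurable_const)
  calc (ρ.restrict B).map Prod.fst s = ρ (Prod.fst ⁻¹' s ∩ B) := by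
        rw [Measure.map_apply measurable_fst hs, Measure.restrict_apply (measurable_fst hs)]
    _ ≤ ρ (Prod.fst ⁻¹' (s ∩ {x | f x ≤ n})) := measure_mono fun p hp => ⟨hp.1, hBf p hp.2⟩
    _ = ∫⁻ x in s ∩ {x | f x ≤ n}, f x ∂m := by
        rw [← Measure.map_apply measurable_fst hset, hρ, withDensity_apply _ hset]
    _ ≤ ∫⁻ x in s ∩ {x | f x ≤ n}, n ∂m := setLIntegral_mono measurable_const fun x hx => hx.2
    _ = n * m (s ∩ {x | f x ≤ n}) := setLIntegral_const _ _
    _ ≤ n * m s := by gcongr; exact inter_subset_left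
    _ = _ := rfl

omit [MetricSpace X] [CompactSpace X] [BorelSpace X] in
lemma map_snd_restrict_le {ρ : Measure (X × X)} {B : Set (X × X)} (hB : MeasurableSet B)
    {f : X → ℝ≥0∞} (hf : Measurable f) (hρ : ρ.map Prod.snd = m.withDensity f) {n : ℝ≥0}
    (hBf : ∀ p ∈ B, f p.2 ≤ n) : (ρ.restrict B).map Prod.snd ≤ n • m := by
  have h1 := map_fst_restrict_le (ρ := ρ.map Prod.swap) (B := Prod.swap ⁻¹' B)
    hf (n := n) (m := m) (by
      rw [Measure.map_map measurable_fst measurable_swap]; exact hρ) fun p hp => hBf _ hp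
  rwa [Measure.restrict_map measurable_swap (measurable_swap hB),
    Measure.map_map measurable_fst measurable_swap] at h1

/-- Brenier's theorem for general densities. -/
theorem StrongCD.ae_eq_of_isOptimalCoupling [IsProbabilityMeasure m] {K : ℝ}
    (hCD : StrongCD m K) {f₀ f₁ : X → ℝ≥0∞} (hf₀ : AEMeasurable f₀ m) (hf₁ : AEMeasurable f₁ m)
    [IsProbabilityMeasure (m.withDensity f₀)] [IsProbabilityMeasure (m.withDensity f₁)]
    {φ : X → ℝ} (hφ : IsKantorovichPotential (m.withDensity f₀) (m.withDensity f₁) φ)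
    {G : X → ℝ≥0∞} (hG : IsMinimalWeakUpperGradient m φ G) {ρ : Measure (X × X)}
    (hρ : IsOptimalCoupling (m.withDensity f₀) (m.withDensity f₁) ρ) :
    ∀ᵐ p ∂ρ, G p.1 = edist p.1 p.2 ∧ ascSlope φ p.1 = edist p.1 p.2 := by
  have : Nonempty X := nonempty_of_isProbabilityMeasure m
  have hρp := hρ.1.isProbabilityMeasure
  have hc := hφ.ae_mem_contactSet hρ
  set g₀ := hf₀.mk f₀
  set g₁ := hf₁.mk f₁
  have hg₀ : Measurable g₀ := hf₀.measurable_mk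
  have hg₁ : Measurable g₁ := hf₁.measurable_mk
  have h₀ : m.withDensity f₀ = m.withDensity g₀ := withDensity_congr_ae hf₀.ae_eq_mk
  have h₁ : m.withDensity f₁ = m.withDensity g₁ := withDensity_congr_ae hf₁.ae_eq_mk
  have hfst : ρ.map Prod.fst = m.withDensity g₀ := hρ.1.1.trans h₀
  have hsnd : ρ.map Prod.snd = m.withDensity g₁ := hρ.1.2.trans h₁
  have hlt : ∀ {g : X → ℝ≥0∞}, Measurable g → IsProbabilityMeasure (m.withDensity g) →
      ∀ᵐ x ∂(m.withDensity g), g x < ∞ := fun {g} hg hp => by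
    refine (withDensity_absolutelyContinuous m g).ae_le (ae_lt_top hg ?_)
    have := measure_ne_top (m.withDensity g) univ
    rwa [withDensity_apply _ MeasurableSet.univ, Measure.restrict_univ] at this
  have hfin₀ : ∀ᵐ p ∂ρ, g₀ p.1 < ∞ := ae_of_ae_map measurable_fst.aemeasurable
    (hfst ▸ hlt hg₀ (h₀ ▸ inferInstance))
  have hfin₁ : ∀ᵐ p ∂ρ, g₁ p.2 < ∞ := ae_of_ae_map measurable_snd.aemeasurable
    (hsnd ▸ hlt hg₁ (h₁ ▸ inferInstance))
  -- On `B n` both densities are at most `n`, and these sets exhaust ρ-almost every pair. A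
  -- normalized piece of `ρ` has bounded marginals and still lies on the contact set, which is all
  -- that the bounded case requires.
  let B : ℕ → Set (X × X) := fun n => {p | g₀ p.1 ≤ (n : ℝ≥0) ∧ g₁ p.2 ≤ (n : ℝ≥0)}
  have hB : ∀ n, MeasurableSet (B n) := fun n =>
    (measurableSet_le (hg₀.comp measurable_fst) measurable_const).inter
      (measurableSet_le (hg₁.comp measurable_snd) measurable_const)
  have hBn : ∀ n, ∀ᵐ p ∂ρ, p ∈ B n →
      G p.1 = edist p.1 p.2 ∧ ascSlope φ p.1 = edist p.1 p.2 := by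
    intro n
    rw [← ae_restrict_iff' (hB n)]
    rcases eq_or_ne (ρ (B n)) 0 with h0 | h0
    · rw [Measure.restrict_eq_zero.2 h0]
      simp
    set b : ℝ≥0 := (ρ (B n)).toNNReal with hb
    have hb' : (b : ℝ≥0∞) = ρ (B n) := ENNReal.coe_toNNReal (measure_ne_top _ _)
    have hb0 : b ≠ 0 := fun h => h0 (by rw [← hb', h]; rfl)
    set ρ' : Measure (X × X) := b⁻¹ • ρ.restrict (B n) with hρ'
    have hprob : IsProbabilityMeasure ρ' := by
      refine ⟨?_⟩
      rw [hρ', Measure.smul_apply, Measure.restrict_apply MeasurableSet.univ, univ_inter, ← hb',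
        ENNReal.smul_def, smul_eq_mul, ← ENNReal.coe_mul, inv_mul_cancel₀ hb0, ENNReal.coe_one]
    have hp0 : IsProbabilityMeasure (ρ'.map Prod.fst) :=
      Measure.isProbabilityMeasure_map measurable_fst.aemeasurable
    have hp1 : IsProbabilityMeasure (ρ'.map Prod.snd) :=
      Measure.isProbabilityMeasure_map measurable_snd.aemeasurable
    have hle : ∀ {μ : Measure X}, μ ≤ (n : ℝ≥0) • m → b⁻¹ • μ ≤ (b⁻¹ * n) • m := fun {μ} h => by
      rw [mul_smul]
      intro s
      simp only [Measure.smul_apply]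
      exact smul_le_smul_of_nonneg_left (h s) zero_le
    have h1 : ρ'.map Prod.fst ≤ (b⁻¹ * n) • m := by
      rw [hρ', Measure.map_smul]
      exact hle (map_fst_restrict_le hg₀ hfst fun p hp => hp.1)
    have h2 : ρ'.map Prod.snd ≤ (b⁻¹ * n) • m := by
      rw [hρ', Measure.map_smul]
      exact hle (map_snd_restrict_le (hB n) hg₁ hsnd fun p hp => hp.2)
    have hc' : ∀ᵐ p ∂ρ', p ∈ contactSet φ :=
      Measure.ae_smul_measure (ae_restrict_of_ae hc) _
    have := hCD.ae_eq_of_le hφ.1 hG h1 h2 ⟨rfl, rfl⟩ hc'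
    have hac : ρ.restrict (B n) ≪ ρ' :=
      Measure.absolutelyContinuous_smul (ENNReal.coe_ne_zero.2 (inv_ne_zero hb0))
    exact hac.ae_le this
  filter_upwards [ae_all_iff.2 hBn, hfin₀, hfin₁] with p hp h0 h1
  obtain ⟨n, hn⟩ := exists_nat_ge (max (g₀ p.1).toNNReal (g₁ p.2).toNNReal)
  refine hp n ⟨?_, ?_⟩
  · rw [← ENNReal.coe_toNNReal h0.ne]
    exact ENNReal.coe_le_coe.2 ((le_max_left _ _).trans hn)
  · rw [← ENNReal.coe_toNNReal h1.ne]
    exact ENNReal.coe_le_coe.2 ((le_max_right _ _).trans hn)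

end Brenier


/-! ### Nested closed convex sets in a Hilbert space -/

section Hilbert

variable {H : Type*} [NormedAddCommGroup H] [InnerProductSpace ℝ H]

/-- The hypothesis is the variational inequality of the projection `v` of 0 onto a convex set
containing `w`. -/
lemma norm_sub_sq_le_of_norm_sq_le_inner {v w : H} (h : ‖v‖ ^ 2 ≤ inner ℝ v w) :
    ‖w - v‖ ^ 2 ≤ ‖w‖ ^ 2 - ‖v‖ ^ 2 := by
  rw [norm_sub_sq_real, real_inner_comm]
  linarith

lemma norm_le_of_norm_sq_le_inner {v w : H} (h : ‖v‖ ^ 2 ≤ inner ℝ v w) : ‖v‖ ≤ ‖w‖ := by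
  have := norm_sub_sq_le_of_norm_sq_le_inner h
  exact (sq_le_sq₀ (norm_nonneg _) (norm_nonneg _)).1 (by nlinarith [sq_nonneg ‖w - v‖])

/-- The projections of 0 onto shrinking sets have increasing norms, bounded by the norm of the
common point `z`. The squared distance between two of them is at most the difference of their
squared norms, so they form a Cauchy sequence. -/
lemma exists_tendsto_projection_of_antitone [CompleteSpace H] {K : ℕ → Set H} (hK : Antitone K)
    (hcl : ∀ n, IsClosed (K n)) (hconv : ∀ n, Convex ℝ (K n)) {z : H} (hz : ∀ n, z ∈ K n) :
    ∃ (G : H) (v : ℕ → H), (∀ n, v n ∈ K n) ∧ Tendsto v atTop (𝓝 G) ∧ (∀ n, G ∈ K n) ∧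
      ∀ n, ∀ w ∈ K n, ‖v n‖ ^ 2 ≤ inner ℝ (v n) w := by
  have hproj : ∀ n, ∃ v ∈ K n, ∀ w ∈ K n, ‖v‖ ^ 2 ≤ inner ℝ v w := fun n => by
    obtain ⟨v, hv, hmin⟩ := exists_norm_eq_iInf_of_complete_convex ⟨z, hz n⟩
      (hcl n).isComplete (hconv n) 0
    refine ⟨v, hv, fun w hw => ?_⟩
    have := (norm_eq_iInf_iff_real_inner_le_zero (hconv n) hv).1 hmin w hw
    rw [zero_sub, inner_neg_left, inner_sub_right, real_inner_self_eq_norm_sq] at this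
    linarith
  choose v hv hvw using hproj
  have hmono : Monotone fun n => ‖v n‖ ^ 2 := fun n k hnk => by
    have := norm_le_of_norm_sq_le_inner (hvw n (v k) (hK hnk (hv k)))
    simp only
    gcongr
  have hbdd : BddAbove (range fun n => ‖v n‖ ^ 2) := ⟨‖z‖ ^ 2, by
    rintro _ ⟨n, rfl⟩
    have := norm_le_of_norm_sq_le_inner (hvw n z (hz n))
    simp only
    gcongr⟩
  have hcau := (tendsto_atTop_ciSup hmono hbdd).cauchySeq
  have hcauv : CauchySeq v := by
    rw [Metric.cauchySeq_iff'] at hcau ⊢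
    intro ε hε
    obtain ⟨N, hN⟩ := hcau (ε ^ 2) (by positivity)
    refine ⟨N, fun n hn => ?_⟩
    have h1 := hN n hn
    have h2 := norm_sub_sq_le_of_norm_sq_le_inner (hvw N (v n) (hK hn (hv n)))
    rw [Real.dist_eq] at h1
    rw [dist_eq_norm]
    exact lt_of_pow_lt_pow_left₀ 2 hε.le (h2.trans_lt ((le_abs_self _).trans_lt h1))
  obtain ⟨G, hG⟩ := cauchySeq_tendsto_of_complete hcauv
  refine ⟨G, v, hv, hG, fun n => ?_, hvw⟩
  refine (hcl n).mem_of_tendsto hG ?_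
  filter_upwards [eventually_ge_atTop n] with k hk using hK hk (hv k)

end Hilbert

/-! ### Calculus of slopes -/

section SlopeCalculus

variable {X : Type*} [MetricSpace X]

lemma metricSlope_le_of_tendsto {f B : X → ℝ} {x : X} {b : ℝ} (hB : Tendsto B (𝓝 x) (𝓝 b))
    (h : ∀ᶠ y in 𝓝 x, |f y - f x| ≤ B y * dist y x) : metricSlope f x ≤ ENNReal.ofReal b := by
  refine le_of_forall_gt fun a ha => ?_
  obtain ⟨c, hc1, hc2⟩ := exists_between ha
  refine lt_of_le_of_lt (metricSlope_le_of_eventually ?_) hc2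
  have h1 := ((ENNReal.continuous_ofReal.tendsto b).comp hB).eventually (gt_mem_nhds hc1)
  filter_upwards [h1, h] with y hy1 hy2
  calc ENNReal.ofReal |f y - f x| ≤ ENNReal.ofReal (B y * dist y x) := ENNReal.ofReal_le_ofReal hy2
    _ = ENNReal.ofReal (B y) * edist y x := by rw [ENNReal.ofReal_mul' dist_nonneg, edist_dist]
    _ ≤ c * edist y x := by gcongr; exact hy1.le

lemma eventually_of_metricSlope_lt {f : X → ℝ} {x : X} {a : ℝ}
    (hf : metricSlope f x ≠ ∞) (h : (metricSlope f x).toReal < a) :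
    ∀ᶠ y in 𝓝 x, |f y - f x| ≤ a * dist y x := by
  have h' : metricSlope f x < ENNReal.ofReal a := (ENNReal.lt_ofReal_iff_toReal_lt hf).2 h
  have h1 := eventually_lt_of_limsup_lt h'
  rw [eventually_nhdsWithin_iff] at h1
  filter_upwards [h1] with y hy
  by_cases hyx : y = x
  · simp [hyx]
  · have h2 := (ENNReal.div_le_iff (by simpa using hyx) (edist_ne_top _ _)).mp (hy hyx).le
    have ha : 0 ≤ a := ENNReal.toReal_nonneg.trans h.le
    rw [edist_dist, ← ENNReal.ofReal_mul ha] at h2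
    exact (ENNReal.ofReal_le_ofReal_iff (by positivity)).1 h2

lemma LipschitzWith.metricSlope_ne_top {f : X → ℝ} {L : ℝ≥0} (hf : LipschitzWith L f) (x : X) :
    metricSlope f x ≠ ∞ :=
  ((metricSlope_le_of_lipschitz hf x).trans_lt ENNReal.coe_lt_top).ne

/-- In this splitting the weight is frozen at `x` and `u - v` is taken at `y`. As `y → x` the error
contributes only `κ * |u x - v x|` to the slope, which is small when `u` and `v` approximate the
same function. -/
lemma abs_glue_sub_le {u v χ : X → ℝ} {κ : ℝ≥0} (hχ : LipschitzWith κ χ) {x : X}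
    (h0 : 0 ≤ χ x) (h1 : χ x ≤ 1) (y : X) :
    |(χ y * u y + (1 - χ y) * v y) - (χ x * u x + (1 - χ x) * v x)| ≤
      χ x * |u y - u x| + (1 - χ x) * |v y - v x| + κ * |u y - v y| * dist y x := by
  have hid : (χ y * u y + (1 - χ y) * v y) - (χ x * u x + (1 - χ x) * v x) =
      χ x * (u y - u x) + (1 - χ x) * (v y - v x) + (χ y - χ x) * (u y - v y) := by ring
  have hd : |χ y - χ x| ≤ κ * dist y x := hχ.dist_le_mul y x
  rw [hid]
  refine (abs_add_three _ _ _).trans ?_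
  rw [abs_mul, abs_mul, abs_mul, abs_of_nonneg h0, abs_of_nonneg (sub_nonneg.2 h1)]
  have := mul_le_mul_of_nonneg_right hd (abs_nonneg (u y - v y))
  linarith

/-- The slope of a convex combination with a Lipschitz weight. -/
lemma toReal_metricSlope_glue_le {u v χ : X → ℝ} {κ Lu Lv : ℝ≥0} (hχ : LipschitzWith κ χ)
    (hu : LipschitzWith Lu u) (hv : LipschitzWith Lv v) {x : X}
    (h0 : 0 ≤ χ x) (h1 : χ x ≤ 1) :
    (metricSlope (fun y => χ y * u y + (1 - χ y) * v y) x).toReal ≤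
      χ x * (metricSlope u x).toReal + (1 - χ x) * (metricSlope v x).toReal +
        κ * |u x - v x| := by
  refine le_of_forall_pos_le_add fun ε hε => ?_
  have hub := eventually_of_metricSlope_lt (LipschitzWith.metricSlope_ne_top hu x)
    (lt_add_of_pos_right _ hε)
  have hvb := eventually_of_metricSlope_lt (LipschitzWith.metricSlope_ne_top hv x)
    (lt_add_of_pos_right _ hε)
  have hcu := hu.continuous
  have hcv := hv.continuous
  have h1' := sub_nonneg.2 h1
  have key : metricSlope (fun y => χ y * u y + (1 - χ y) * v y) x ≤ ENNReal.ofReal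
      (χ x * ((metricSlope u x).toReal + ε) + (1 - χ x) * ((metricSlope v x).toReal + ε) +
        κ * |u x - v x|) := by
    refine metricSlope_le_of_tendsto (B := fun y => χ x * ((metricSlope u x).toReal + ε) +
      (1 - χ x) * ((metricSlope v x).toReal + ε) + κ * |u y - v y|)
      (Continuous.tendsto (by fun_prop) x) ?_
    filter_upwards [hub, hvb] with y hy1 hy2
    refine (abs_glue_sub_le hχ h0 h1 y).trans ?_
    have e1 := mul_le_mul_of_nonneg_left hy1 h0
    have e2 := mul_le_mul_of_nonneg_left hy2 h1'
    linarith
  have hnn : 0 ≤ χ x * ((metricSlope u x).toReal + ε) +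
      (1 - χ x) * ((metricSlope v x).toReal + ε) + κ * |u x - v x| := by positivity
  have := ENNReal.toReal_mono ENNReal.ofReal_ne_top key
  rw [ENNReal.toReal_ofReal hnn] at this
  linarith

lemma exists_lipschitzWith_glue [CompactSpace X] {u v χ : X → ℝ} {κ Lu Lv : ℝ≥0}
    (hχ : LipschitzWith κ χ) (hu : LipschitzWith Lu u) (hv : LipschitzWith Lv v)
    (h0 : ∀ x, 0 ≤ χ x) (h1 : ∀ x, χ x ≤ 1) :
    ∃ L : ℝ≥0, LipschitzWith L fun y => χ y * u y + (1 - χ y) * v y := by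
  obtain ⟨B, hB⟩ := isCompact_univ.exists_bound_of_continuousOn
    (hu.continuous.sub hv.continuous).continuousOn
  have hB' : ∀ y, |u y - v y| ≤ B.toNNReal := fun y =>
    (hB y (mem_univ y)).trans (Real.le_coe_toNNReal B)
  refine ⟨Lu + Lv + κ * B.toNNReal, LipschitzWith.of_dist_le_mul fun y x => ?_⟩
  rw [Real.dist_eq]
  refine (abs_glue_sub_le hχ (h0 x) (h1 x) y).trans ?_
  have hd := dist_nonneg (x := y) (y := x)
  have e1 : |u y - u x| ≤ Lu * dist y x := hu.dist_le_mul y x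
  have e2 : |v y - v x| ≤ Lv * dist y x := hv.dist_le_mul y x
  have h1x := sub_nonneg.2 (h1 x)
  have e3 : χ x * |u y - u x| ≤ 1 * (Lu * dist y x) := by gcongr; exact h1 x
  have e4 : (1 - χ x) * |v y - v x| ≤ 1 * (Lv * dist y x) := by
    gcongr; linarith [h0 x]
  have e5 : κ * |u y - v y| * dist y x ≤ κ * B.toNNReal * dist y x := by gcongr; exact hB' y
  push_cast
  linarith

end SlopeCalculus

/-! ### Hopf–Lax approximation of `c`-concave functions -/

section HopfLax

variable {X : Type*} [MetricSpace X] [CompactSpace X]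

/-- The Hopf–Lax evolution `Q_t c (x) = inf_y (d²(y, x) / (2t) - c y)`. -/
noncomputable def hopfLax (c : X → ℝ) (t : ℝ) (x : X) : ℝ :=
  ⨅ y, (dist y x ^ 2 / 2 / t - c y)

variable {c : X → ℝ} {t : ℝ}

lemma hopfLax_le (hc : Continuous c) (y x : X) :
    hopfLax c t x ≤ dist y x ^ 2 / 2 / t - c y :=
  ciInf_le ((isCompact_range (f := fun y => dist y x ^ 2 / 2 / t - c y)
    (by fun_prop)).bddBelow) y

variable [Nonempty X]

lemma exists_hopfLax_eq (hc : Continuous c) (x : X) :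
    ∃ y, hopfLax c t x = dist y x ^ 2 / 2 / t - c y := by
  obtain ⟨y, -, hy⟩ := isCompact_univ.exists_isMinOn univ_nonempty
    (f := fun y => dist y x ^ 2 / 2 / t - c y) (by fun_prop)
  exact ⟨y, le_antisymm (hopfLax_le hc y x) (le_ciInf fun z => hy (mem_univ z))⟩

lemma lipschitzWith_hopfLax (hc : Continuous c) (ht : 0 < t) :
    LipschitzWith (diamNN X / t.toNNReal) (hopfLax c t) := by
  refine LipschitzWith.of_le_add_mul _ fun x z => ?_
  obtain ⟨y, hy⟩ := exists_hopfLax_eq (t := t) hc z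
  have h1 := hopfLax_le (t := t) hc y x
  have h2 := div_le_div_of_nonneg_right (dist_sq_sub_le y x z) ht.le
  rw [NNReal.coe_div, Real.coe_toNNReal _ ht.le, hy]
  rw [sub_div] at h2
  have h3 : diamNN X / t * dist x z = diamNN X * dist x z / t := by ring
  linarith

/-- At time 1 the evolution of `φᶜ` is `φ`. For `t < 1` it is larger, and a contact point of `x`
used as competitor bounds the excess. -/
lemma abs_hopfLax_sub_le {φ : X → ℝ} (hφ : IsCConcave φ) (ht : 0 < t) (ht1 : t < 1) (x : X) :
    |hopfLax (cTransform φ) t x - φ x| ≤ diamNN X ^ 2 / 2 * (1 / t - 1) := by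
  have hc := (lipschitzWith_cTransform_of_continuous hφ.lipschitzWith.continuous).continuous
  have ht' : 0 ≤ 1 / t - 1 := by
    rw [sub_nonneg, le_div_iff₀ ht]
    linarith
  have hlow : φ x ≤ hopfLax (cTransform φ) t x := by
    refine le_ciInf fun y => ?_
    have h1 := cTransform_le hφ.lipschitzWith.continuous x y
    have h2 : dist y x ^ 2 / 2 ≤ dist y x ^ 2 / 2 / t := by
      rw [le_div_iff₀ ht]
      nlinarith [sq_nonneg (dist y x)]
    rw [dist_comm x y] at h1
    linarith
  obtain ⟨y, hy⟩ := hφ.exists_mem_contactSet x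
  have hy' : φ x + cTransform φ y = dist x y ^ 2 / 2 := hy
  have hup := hopfLax_le (t := t) hc y x
  rw [dist_comm y x] at hup
  rw [abs_of_nonneg (sub_nonneg.2 hlow)]
  have hD : dist x y ^ 2 / 2 ≤ (diamNN X : ℝ) ^ 2 / 2 := by
    have := dist_le_diamNN x y
    gcongr
  have h3 : dist x y ^ 2 / 2 / t - dist x y ^ 2 / 2 = dist x y ^ 2 / 2 * (1 / t - 1) := by ring
  have h4 := mul_le_mul_of_nonneg_right hD ht'
  linarith

/-- The slope of the Hopf–Lax evolution at a time `t < 1` is controlled by the distance to any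
point in contact. -/
lemma metricSlope_hopfLax_le {φ : X → ℝ} (hφ : IsCConcave φ) (ht : 0 < t) (ht1 : t < 1) {x y : X}
    (hxy : (x, y) ∈ contactSet φ) :
    metricSlope (hopfLax (cTransform φ) t) x ≤ ENNReal.ofReal (dist x y / t) := by
  have hφc := hφ.lipschitzWith.continuous
  have hc := (lipschitzWith_cTransform_of_continuous hφc).continuous
  have hxy' : φ x + cTransform φ y = dist x y ^ 2 / 2 := hxy
  -- Comparing a minimizer `p` for `z` with the contact point `y` costs the diameter times d(z,x)
  -- twice, once for each squared distance moved from `z` to `x`. The factor 1 - t is the gap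
  -- between the costs d²/2 and d²/(2t), multiplied by t; it forces minimizers near `x` to lie
  -- hardly farther away than `y`.
  set κ : ℝ := 4 * diamNN X / (1 - t) with hκ
  have h1t : 0 < 1 - t := by linarith
  have hmin : ∀ z p, hopfLax (cTransform φ) t z = dist p z ^ 2 / 2 / t - cTransform φ p →
      dist x p ≤ Real.sqrt (dist x y ^ 2 + κ * dist z x) := by
    intro z p hp
    refine Real.le_sqrt_of_sq_le ?_
    have h1 := hopfLax_le (t := t) hc y z
    have h2 := cTransform_le hφc x p
    have h3 := dist_sq_sub_le y z x
    have h4 := dist_sq_sub_le p x z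
    rw [dist_comm x z] at h4
    rw [hp] at h1
    have h5 : dist p z ^ 2 / 2 / t - dist y z ^ 2 / 2 / t ≤
        dist x p ^ 2 / 2 - dist x y ^ 2 / 2 := by linarith
    rw [← sub_div, div_le_iff₀ ht] at h5
    rw [dist_comm p x] at h4
    rw [dist_comm y x] at h3
    have h6 : (dist x p ^ 2 / 2 - dist x y ^ 2 / 2) * (1 - t) ≤ 2 * diamNN X * dist z x := by
      linarith
    have h7 : dist x p ^ 2 - dist x y ^ 2 ≤ 4 * diamNN X * dist z x / (1 - t) := by
      rw [le_div_iff₀ h1t]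
      linarith
    have h8 : κ * dist z x = 4 * diamNN X * dist z x / (1 - t) := by rw [hκ]; ring
    linarith
  refine metricSlope_le_of_tendsto
    (B := fun z => (Real.sqrt (dist x y ^ 2 + κ * dist z x) + dist z x / 2) / t) ?_ ?_
  · have : Tendsto (fun z => (Real.sqrt (dist x y ^ 2 + κ * dist z x) + dist z x / 2) / t) (𝓝 x)
        (𝓝 ((Real.sqrt (dist x y ^ 2 + κ * dist x x) + dist x x / 2) / t)) :=
      Continuous.tendsto (by fun_prop) x
    rwa [dist_self, mul_zero, add_zero, Real.sqrt_sq dist_nonneg, zero_div, add_zero] at this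
  · refine Eventually.of_forall fun z => ?_
    have hκ0 : 0 ≤ κ := by positivity
    have hstep : ∀ p a b, a = x ∧ b = z ∨ a = z ∧ b = x →
        dist x p ≤ Real.sqrt (dist x y ^ 2 + κ * dist z x) →
        dist p a ^ 2 / 2 / t - dist p b ^ 2 / 2 / t ≤
          (Real.sqrt (dist x y ^ 2 + κ * dist z x) + dist z x / 2) / t * dist z x := by
      intro p a b hab hp
      rw [← sub_div, div_mul_eq_mul_div]
      refine div_le_div_of_nonneg_right ?_ ht.le
      have hz := dist_nonneg (x := z) (y := x)
      have tri1 := dist_triangle p z x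
      have tri2 := dist_triangle p x z
      rw [dist_comm p x] at tri1 tri2
      rw [dist_comm x z] at tri2
      have hpz := dist_nonneg (x := p) (y := z)
      have hpx := dist_nonneg (x := x) (y := p)
      rcases hab with ⟨rfl, rfl⟩ | ⟨rfl, rfl⟩
      · rw [dist_comm p a]
        nlinarith
      · rw [dist_comm p b]
        nlinarith
    rw [abs_le]
    obtain ⟨p, hp⟩ := exists_hopfLax_eq (t := t) hc z
    obtain ⟨q, hq⟩ := exists_hopfLax_eq (t := t) hc x
    have hqd : dist x q ≤ Real.sqrt (dist x y ^ 2 + κ * dist z x) := by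
      refine (hmin x q hq).trans (Real.sqrt_le_sqrt ?_)
      rw [dist_self, mul_zero, add_zero]
      have := mul_nonneg hκ0 (dist_nonneg (x := z) (y := x))
      linarith
    have e1 := hopfLax_le (t := t) hc p x
    have e2 := hopfLax_le (t := t) hc q z
    constructor
    · have := hstep p x z (Or.inl ⟨rfl, rfl⟩) (hmin z p hp)
      linarith
    · have := hstep q z x (Or.inr ⟨rfl, rfl⟩) hqd
      linarith

/-- The distance from `x` to the nearest point in contact with it. -/
noncomputable def contactDist (φ : X → ℝ) (x : X) : ℝ :=
  sInf {r | ∃ y, (x, y) ∈ contactSet φ ∧ r = dist x y}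

omit [CompactSpace X] [Nonempty X] in
lemma contactDist_le {φ : X → ℝ} {x y : X} (h : (x, y) ∈ contactSet φ) :
    contactDist φ x ≤ dist x y :=
  csInf_le ⟨0, by rintro _ ⟨y, -, rfl⟩; exact dist_nonneg⟩ ⟨y, h, rfl⟩

lemma exists_contactDist_eq {φ : X → ℝ} (hφ : IsCConcave φ) (x : X) :
    ∃ y, (x, y) ∈ contactSet φ ∧ contactDist φ x = dist x y := by
  have hcomp : IsCompact {y | (x, y) ∈ contactSet φ} :=
    ((isClosed_contactSet hφ.lipschitzWith.continuous).preimage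
      (by fun_prop : Continuous fun y => (x, y))).isCompact
  obtain ⟨y, hy, hmin⟩ := hcomp.exists_isMinOn (hφ.exists_mem_contactSet x)
    (f := fun y => dist x y) (by fun_prop)
  refine ⟨y, hy, le_antisymm (contactDist_le hy) (le_csInf ⟨_, y, hy, rfl⟩ ?_)⟩
  rintro _ ⟨z, hz, rfl⟩
  exact hmin hz

/-- The minimum is attained, so a sublevel set is the projection of a compact set and hence closed.
-/
lemma measurable_contactDist [MeasurableSpace X] [BorelSpace X] {φ : X → ℝ}
    (hφ : IsCConcave φ) : Measurable (contactDist φ) := by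
  refine measurable_of_Iic fun a => IsClosed.measurableSet ?_
  have h : contactDist φ ⁻¹' Iic a =
      Prod.fst '' (contactSet φ ∩ {p : X × X | dist p.1 p.2 ≤ a}) := by
    ext x
    constructor
    · intro hx
      obtain ⟨y, hy, hd⟩ := exists_contactDist_eq hφ x
      exact ⟨(x, y), ⟨hy, (hd.symm.trans_le hx : dist x y ≤ a)⟩, rfl⟩
    · rintro ⟨⟨x', y⟩, ⟨h1, h2⟩, rfl⟩
      exact (contactDist_le h1).trans h2
  rw [h]
  exact (((isClosed_contactSet hφ.lipschitzWith.continuous).inter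
    (isClosed_le (by fun_prop) continuous_const)).isCompact.image continuous_fst).isClosed

omit [CompactSpace X] [Nonempty X] in
lemma contactDist_nonneg {φ : X → ℝ} (x : X) : 0 ≤ contactDist φ x :=
  Real.sInf_nonneg (by rintro _ ⟨y, -, rfl⟩; exact dist_nonneg)

lemma contactDist_le_diamNN {φ : X → ℝ} (hφ : IsCConcave φ) (x : X) :
    contactDist φ x ≤ diamNN X := by
  obtain ⟨y, hy, hd⟩ := exists_contactDist_eq hφ x
  exact hd ▸ dist_le_diamNN x y

end HopfLax


/-! ### The least slope in `L²` -/

section LeastSlope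

variable {X : Type*} [MetricSpace X] [CompactSpace X] [MeasurableSpace X] [BorelSpace X]
  {m : Measure X}

lemma memLp_of_continuous [IsFiniteMeasure m] {f : X → ℝ} (hf : Continuous f) (p : ℝ≥0∞) :
    MemLp f p m := by
  obtain ⟨B, hB⟩ := isCompact_univ.exists_bound_of_continuousOn hf.continuousOn
  exact MemLp.of_bound hf.aestronglyMeasurable B (Eventually.of_forall fun x => hB x (mem_univ x))

omit [CompactSpace X] [MeasurableSpace X] [BorelSpace X] in
lemma toReal_metricSlope_le {f : X → ℝ} {L : ℝ≥0} (hf : LipschitzWith L f) (x : X) :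
    (metricSlope f x).toReal ≤ L :=
  ENNReal.toReal_le_coe_of_le_coe (metricSlope_le_of_lipschitz hf x)

lemma memLp_toReal_metricSlope [IsFiniteMeasure m] {f : X → ℝ} {L : ℝ≥0}
    (hf : LipschitzWith L f) (p : ℝ≥0∞) : MemLp (fun x => (metricSlope f x).toReal) p m := by
  refine MemLp.of_bound (measurable_metricSlope hf.continuous).ennreal_toReal.aestronglyMeasurable
    L (Eventually.of_forall fun x => ?_)
  rw [Real.norm_of_nonneg ENNReal.toReal_nonneg]
  exact toReal_metricSlope_le hf x

/-- Functions in `L²` that dominate the slope of a Lipschitz function `ε`-close to `f`. -/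
def slopeSet (m : Measure X) (f : X → ℝ) (ε : ℝ) : Set (Lp ℝ 2 m) :=
  {g | ∃ u : X → ℝ, (∃ L : ℝ≥0, LipschitzWith L u) ∧
    eLpNorm (fun x => u x - f x) 2 m ≤ ENNReal.ofReal ε ∧
    ∀ᵐ x ∂m, (metricSlope u x).toReal ≤ g x}

omit [CompactSpace X] [BorelSpace X] in
lemma slopeSet_mono {f : X → ℝ} {ε δ : ℝ} (h : ε ≤ δ) : slopeSet m f ε ⊆ slopeSet m f δ :=
  fun _ ⟨u, hu, hd, hg⟩ => ⟨u, hu, hd.trans (ENNReal.ofReal_le_ofReal h), hg⟩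

/-- A convex combination is a gluing with constant weight; `κ = 0` removes the error term. -/
lemma convex_slopeSet [IsFiniteMeasure m] {f : X → ℝ} (hf : Continuous f) {ε : ℝ} :
    Convex ℝ (slopeSet m f ε) := by
  rintro g ⟨u, ⟨Lu, hu⟩, hud, hug⟩ h ⟨v, ⟨Lv, hv⟩, hvd, hvh⟩ a b ha hb hab
  obtain rfl : b = 1 - a := by linarith
  have ha1 : a ≤ 1 := by linarith
  have hχ : LipschitzWith 0 fun _ : X => a := LipschitzWith.const a
  refine ⟨fun y => a * u y + (1 - a) * v y,
    exists_lipschitzWith_glue hχ hu hv (fun _ => ha) (fun _ => ha1), ?_, ?_⟩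
  · have e : (fun x => a * u x + (1 - a) * v x - f x) =
        a • (fun x => u x - f x) + (1 - a) • (fun x => v x - f x) := by
      ext x
      simp only [Pi.add_apply, Pi.smul_apply, smul_eq_mul]
      ring
    have m1 : AEStronglyMeasurable (fun x => u x - f x) m :=
      (hu.continuous.sub hf).aestronglyMeasurable
    have m2 : AEStronglyMeasurable (fun x => v x - f x) m :=
      (hv.continuous.sub hf).aestronglyMeasurable
    rw [e]
    refine (eLpNorm_add_le (m1.const_smul a) (m2.const_smul _) (by norm_num)).trans ?_
    rw [eLpNorm_const_smul, eLpNorm_const_smul, Real.enorm_of_nonneg ha, Real.enorm_of_nonneg hb]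
    calc _ ≤ ENNReal.ofReal a * ENNReal.ofReal ε + ENNReal.ofReal (1 - a) * ENNReal.ofReal ε := by
          gcongr
      _ = ENNReal.ofReal ε := by
          rw [← add_mul, ← ENNReal.ofReal_add ha hb, hab, ENNReal.ofReal_one, one_mul]
  · filter_upwards [hug, hvh, Lp.coeFn_add (a • g) ((1 - a) • h), Lp.coeFn_smul a g,
      Lp.coeFn_smul (1 - a) h] with x h1 h2 h3 h4 h5
    refine (toReal_metricSlope_glue_le hχ hu hv ha ha1).trans ?_
    rw [h3, Pi.add_apply, h4, h5, NNReal.coe_zero, zero_mul, add_zero]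
    simp only [Pi.smul_apply, smul_eq_mul]
    gcongr

lemma toLp_mem_slopeSet [IsFiniteMeasure m] {f u : X → ℝ} {ε : ℝ} {L : ℝ≥0}
    (hu : LipschitzWith L u) (h : eLpNorm (fun x => u x - f x) 2 m ≤ ENNReal.ofReal ε) :
    (memLp_toReal_metricSlope (m := m) hu 2).toLp _ ∈ slopeSet m f ε :=
  ⟨u, ⟨L, hu⟩, h, (MemLp.coeFn_toLp _).mono fun _ hx => hx.ge⟩

omit [MetricSpace X] [CompactSpace X] [BorelSpace X] in
lemma inner_eq_integral (f g : Lp ℝ 2 m) : inner ℝ f g = ∫ x, f x * g x ∂m := by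
  rw [L2.inner_def]
  exact integral_congr_ae (Eventually.of_forall fun x => mul_comm _ _)

/-- `G` is the strong limit of slopes of Lipschitz functions that converge to `f`, and minimizes
the norm among the weak limits of functions dominating such slopes. -/
structure IsLeastSlope (m : Measure X) (f : X → ℝ) (G : Lp ℝ 2 m) : Prop where
  approx : ∃ u : ℕ → X → ℝ, (∀ n, ∃ L : ℝ≥0, LipschitzWith L (u n)) ∧
    Tendsto (fun n => eLpNorm (fun x => u n x - f x) 2 m) atTop (𝓝 0) ∧
    Tendsto (fun n => eLpNorm (fun x => (metricSlope (u n) x).toReal - G x) 2 m) atTop (𝓝 0)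
  least : ∀ (w : ℕ → Lp ℝ 2 m) (w' : Lp ℝ 2 m),
    (∀ ε > 0, ∀ᶠ k in atTop, w k ∈ slopeSet m f ε) →
    (∀ h : Lp ℝ 2 m, Tendsto (fun k => inner ℝ h (w k)) atTop (𝓝 (inner ℝ h w'))) →
    ‖G‖ ^ 2 ≤ inner ℝ G w'

/-- Project 0 onto the closures of the slope sets with tolerances 1/(n+1), which all contain the
slope of `f`. The limit of the projections is the least slope, and their variational inequalities
pass to weak limits. -/
lemma exists_isLeastSlope [IsFiniteMeasure m] {f : X → ℝ} {L : ℝ≥0} (hf : LipschitzWith L f) :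
    ∃ G, IsLeastSlope m f G := by
  let e : ℕ → ℝ := fun n => 1 / ((n : ℝ) + 1)
  have he0 : ∀ n, 0 < e n := fun n => Nat.one_div_pos_of_nat
  have het : Tendsto e atTop (𝓝 0) := tendsto_one_div_add_atTop_nhds_zero_nat
  have heanti : Antitone e := fun a b hab => Nat.one_div_le_one_div hab
  obtain ⟨G, v, hv, hvG, -, hmin⟩ := exists_tendsto_projection_of_antitone
    (K := fun n => closure (slopeSet m f (e n)))
    (fun a b hab => closure_mono (slopeSet_mono (heanti hab))) (fun _ => isClosed_closure)
    (fun n => (convex_slopeSet hf.continuous).closure)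
    (z := (memLp_toReal_metricSlope (m := m) hf 2).toLp _)
    (fun n => subset_closure (toLp_mem_slopeSet hf (by simp)))
  -- An element of the slope set within `e n` of `v n` dominates an actual slope, whose norm is then
  -- at most `‖v n‖ + e n`. The variational inequality places that slope itself near `v n`.
  have hex : ∀ n, ∃ (u : X → ℝ) (Lu : ℝ≥0) (hu : LipschitzWith Lu u),
      eLpNorm (fun x => u x - f x) 2 m ≤ ENNReal.ofReal (e n) ∧
      ‖(memLp_toReal_metricSlope (m := m) hu 2).toLp _ - v n‖ ^ 2 ≤
        (‖v n‖ + e n) ^ 2 - ‖v n‖ ^ 2 := fun n => by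
    obtain ⟨g, ⟨u, ⟨Lu, hu⟩, hd, hg⟩, hgv⟩ := Metric.mem_closure_iff.1 (hv n) (e n) (he0 n)
    refine ⟨u, Lu, hu, hd, ?_⟩
    refine (norm_sub_sq_le_of_norm_sq_le_inner (hmin n _ (subset_closure
      (toLp_mem_slopeSet hu hd)))).trans ?_
    have h1 : ‖(memLp_toReal_metricSlope (m := m) hu 2).toLp _‖ ≤ ‖g‖ := by
      refine Lp.norm_le_norm_of_ae_le ?_
      filter_upwards [hg, MemLp.coeFn_toLp (memLp_toReal_metricSlope (m := m) hu 2)] with x h1 h2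
      rw [h2, Real.norm_of_nonneg ENNReal.toReal_nonneg]
      exact h1.trans (le_abs_self _)
    have h2 : ‖g‖ ≤ ‖v n‖ + e n := by
      rw [dist_comm, dist_eq_norm] at hgv
      linarith [norm_sub_norm_le g (v n)]
    gcongr
    exact h1.trans h2
  choose u Lu hu hud hun using hex
  refine ⟨G, ⟨u, fun n => ⟨Lu n, hu n⟩, ?_, ?_⟩, ?_⟩
  · refine tendsto_of_tendsto_of_tendsto_of_le_of_le tendsto_const_nhds ?_
      (fun _ => zero_le) hud
    simpa [Function.comp_def] using (ENNReal.continuous_ofReal.tendsto 0).comp het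
  · have h0 : Tendsto (fun n => (‖v n‖ + e n) ^ 2 - ‖v n‖ ^ 2) atTop (𝓝 0) := by
      have := ((hvG.norm.add het).pow 2).sub (hvG.norm.pow 2)
      simpa using this
    have h1 : Tendsto (fun n => (memLp_toReal_metricSlope (m := m) (hu n) 2).toLp _ - v n)
        atTop (𝓝 0) := by
      rw [tendsto_zero_iff_norm_tendsto_zero]
      have := (squeeze_zero (fun n => sq_nonneg _) hun h0).sqrt
      simpa [Real.sqrt_sq (norm_nonneg _)] using this
    have h2 := h1.add hvG
    simp only [sub_add_cancel, zero_add] at h2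
    exact (Lp.tendsto_Lp_iff_tendsto_eLpNorm' _ _).1 h2 |>.congr fun n => eLpNorm_congr_ae <|
      (MemLp.coeFn_toLp (memLp_toReal_metricSlope (m := m) (hu n) 2)).mono fun x hx => by
        simp [hx]
  · intro w w' hw hww
    have h1 : ∀ n, ‖v n‖ ^ 2 ≤ inner ℝ (v n) w' := fun n =>
      ge_of_tendsto (hww (v n)) ((hw _ (he0 n)).mono fun k hk => hmin n _ (subset_closure hk))
    exact le_of_tendsto_of_tendsto' (hvG.norm.pow 2) (hvG.inner tendsto_const_nhds) h1

end LeastSlope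


/-! ### The least slope as minimal relaxed slope and as weak upper gradient. -/

section RelaxedSlope

variable {X : Type*} [MetricSpace X] [CompactSpace X] [MeasurableSpace X] [BorelSpace X]
  {m : Measure X} {f : X → ℝ} {G : Lp ℝ 2 m}

omit [MetricSpace X] [CompactSpace X] [BorelSpace X] in
lemma inner_toLp {g h : X → ℝ} (hg : MemLp g 2 m) (hh : MemLp h 2 m) :
    inner ℝ (hg.toLp g) (hh.toLp h) = ∫ x, g x * h x ∂m := by
  rw [inner_eq_integral]
  refine integral_congr_ae ?_
  filter_upwards [hg.coeFn_toLp, hh.coeFn_toLp] with x h1 h2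
  rw [h1, h2]

lemma IsLeastSlope.ae_nonneg (hG : IsLeastSlope m f G) : ∀ᵐ x ∂m, 0 ≤ G x := by
  obtain ⟨u, hu, -, hs⟩ := hG.approx
  have hm : ∀ n, AEStronglyMeasurable (fun x => (metricSlope (u n) x).toReal) m := fun n =>
    (measurable_metricSlope (hu n).choose_spec.continuous).ennreal_toReal.aestronglyMeasurable
  obtain ⟨ns, -, hns⟩ := (tendstoInMeasure_of_tendsto_eLpNorm two_ne_zero hm
    (Lp.aestronglyMeasurable G) hs).exists_seq_tendsto_ae
  filter_upwards [hns] with x hx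
  exact ge_of_tendsto' hx fun n => ENNReal.toReal_nonneg

lemma IsLeastSlope.isRelaxedSlope [IsFiniteMeasure m] (hf : Continuous f)
    (hG : IsLeastSlope m f G) : IsRelaxedSlope m f G := by
  obtain ⟨u, hu, hd, hs⟩ := hG.approx
  refine ⟨memLp_of_continuous hf 2, Lp.memLp G, G, u, Lp.memLp G, hu, hd, fun h hh => ?_,
    EventuallyLE.rfl⟩
  choose L hL using hu
  have h1 : Tendsto (fun n => (memLp_toReal_metricSlope (m := m) (hL n) 2).toLp _) atTop (𝓝 G) := by
    have := (Lp.tendsto_Lp_iff_tendsto_eLpNorm'' _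
      (fun n => memLp_toReal_metricSlope (m := m) (hL n) 2) _ (Lp.memLp G)).2 hs
    rwa [Lp.toLp_coeFn] at this
  have h2 := h1.inner (𝕜 := ℝ) (tendsto_const_nhds (x := hh.toLp h))
  have h3 := inner_toLp (Lp.memLp G) hh
  rw [Lp.toLp_coeFn] at h3
  simpa only [inner_toLp, h3] using h2

/-- The slopes of the sequence behind `R` eventually enter every slope set, so minimality applies to
their weak limit `R'`. Nonnegativity of `G` then allows `R'` to be replaced by the larger `R`. -/
lemma IsLeastSlope.norm_sq_le_inner [IsFiniteMeasure m] (hG : IsLeastSlope m f G) {R : X → ℝ}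
    (hR : IsRelaxedSlope m f R) : ‖G‖ ^ 2 ≤ inner ℝ G (hR.2.1.toLp R) := by
  have hRm := hR.2.1
  obtain ⟨R', u, hR', hu, hd, hw, hle⟩ := hR.2.2
  choose L hL using hu
  have h1 : ‖G‖ ^ 2 ≤ inner ℝ G (hR'.toLp R') := by
    refine hG.least (fun n => (memLp_toReal_metricSlope (m := m) (hL n) 2).toLp _) _
      (fun ε hε => ?_) (fun h => ?_)
    · filter_upwards [hd.eventually (ge_mem_nhds (ENNReal.ofReal_pos.2 hε))] with n hn
      exact toLp_mem_slopeSet (hL n) hn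
    · have h3 := hw h (Lp.memLp h)
      simp_rw [mul_comm _ (h _)] at h3
      simpa only [← inner_toLp (Lp.memLp h) (memLp_toReal_metricSlope (m := m) (hL _) 2),
        ← inner_toLp (Lp.memLp h) hR', Lp.toLp_coeFn] using h3
  refine h1.trans ?_
  rw [inner_eq_integral, inner_eq_integral]
  refine integral_mono_ae ((Lp.memLp G).integrable_mul (Lp.memLp _))
    ((Lp.memLp G).integrable_mul (Lp.memLp _)) ?_
  filter_upwards [hG.ae_nonneg, hR'.coeFn_toLp, hRm.coeFn_toLp, hle] with x h1 h2 h3 h4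
  simp only [h2, h3]
  gcongr

lemma IsLeastSlope.isMinimalRelaxedSlope [IsFiniteMeasure m] (hf : Continuous f)
    (hG : IsLeastSlope m f G) : IsMinimalRelaxedSlope m f G := by
  refine ⟨hG.isRelaxedSlope hf, fun R hR => ?_⟩
  have h := norm_le_of_norm_sq_le_inner (hG.norm_sq_le_inner hR)
  rwa [Lp.norm_toLp, Lp.norm_def,
    ENNReal.toReal_le_toReal (Lp.eLpNorm_ne_top G) hR.2.1.eLpNorm_ne_top] at h

lemma IsLeastSlope.ae_eq [IsFiniteMeasure m] (hf : Continuous f) (hG : IsLeastSlope m f G)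
    {R : X → ℝ} (hR : IsMinimalRelaxedSlope m f R) : R =ᵐ[m] G := by
  have h1 := norm_sub_sq_le_of_norm_sq_le_inner (hG.norm_sq_le_inner hR.1)
  have h2 : ‖hR.1.2.1.toLp R‖ ≤ ‖G‖ := by
    rw [Lp.norm_toLp, Lp.norm_def,
      ENNReal.toReal_le_toReal hR.1.2.1.eLpNorm_ne_top (Lp.eLpNorm_ne_top G)]
    exact hR.2 G (hG.isRelaxedSlope hf)
  have h3 : ‖hR.1.2.1.toLp R‖ ^ 2 ≤ ‖G‖ ^ 2 := by gcongr
  have h4 : hR.1.2.1.toLp R - G = 0 := by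
    rw [← norm_eq_zero]
    exact pow_eq_zero_iff two_ne_zero |>.1 (le_antisymm (by linarith) (sq_nonneg _))
  have h5 := hR.1.2.1.coeFn_toLp
  rw [sub_eq_zero.1 h4] at h5
  exact h5.symm

-- Cauchy–Schwarz for the product of `π` and Lebesgue measure; the compression bound turns the first
-- factor into the L²(m) norm of `g`.
omit [CompactSpace X] in
lemma lintegral_curveIntegral_le {π : Measure C(I, X)} [SFinite π] {C : ℝ≥0}
    (hC : ∀ t : I, π.map (fun γ => γ t) ≤ C • m) {g : X → ℝ} (hg : Measurable g) :
    ∫⁻ γ, curveIntegral (fun x => ‖g x‖ₑ) γ ∂π ≤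
      (C : ℝ≥0∞) ^ (1 / 2 : ℝ) * eLpNorm g 2 m *
        (∫⁻ γ, (∫⁻ t : I, metricSpeed γ t ^ 2) ∂π) ^ (1 / 2 : ℝ) := by
  have hm1 : Measurable fun z : C(I, X) × I => ‖g (z.1 z.2)‖ₑ :=
    (hg.comp measurable_curve_eval).enorm
  have hm2 : Measurable fun z : C(I, X) × I => metricSpeed z.1 z.2 := measurable_metricSpeed
  have h1 := ENNReal.lintegral_mul_le_Lp_mul_Lq (π.prod (volume : Measure I))
    Real.HolderConjugate.two_two hm1.aemeasurable hm2.aemeasurable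
  rw [lintegral_prod _ (hm1.mul hm2).aemeasurable, lintegral_prod _ (hm1.pow_const 2).aemeasurable,
    lintegral_prod _ (hm2.pow_const 2).aemeasurable] at h1
  have h2 := lintegral_lintegral_eval_le hC (hg.enorm.pow_const (2 : ℝ))
  have h3 : eLpNorm g 2 m = (∫⁻ x, ‖g x‖ₑ ^ (2 : ℝ) ∂m) ^ (1 / 2 : ℝ) := by
    rw [eLpNorm_eq_lintegral_rpow_enorm_toReal two_ne_zero ENNReal.ofNat_ne_top]
    simp
  rw [h3, ← ENNReal.mul_rpow_of_nonneg _ _ (by norm_num)]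
  refine h1.trans ?_
  simp only [ENNReal.rpow_two] at h2 ⊢
  gcongr

/-- The least slope is a weak upper gradient. -/
lemma IsLeastSlope.isWeakUpperGradient [IsProbabilityMeasure m] (hf : Continuous f)
    (hG : IsLeastSlope m f G) : IsWeakUpperGradient m f fun x => ENNReal.ofReal (G x) := by
  obtain ⟨u, hu, hd, hs⟩ := hG.approx
  have hGm : Measurable G := (Lp.stronglyMeasurable G).measurable
  refine ⟨hGm.ennreal_ofReal, fun π hπ => ?_⟩
  have := hπ.prob
  obtain ⟨C, hC⟩ := hπ.compression
  choose L hL using hu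
  have hsm : ∀ n, Measurable fun x => (metricSlope (u n) x).toReal - G x := fun n =>
    (measurable_metricSlope (hL n).continuous).ennreal_toReal.sub hGm
  have hdm : ∀ n, Measurable fun x => u n x - f x := fun n =>
    ((hL n).continuous.sub hf).measurable
  have hcm : ∀ {g : X → ℝ≥0∞}, Measurable g → Measurable fun γ : C(I, X) => curveIntegral g γ :=
    fun {g} hg => ((hg.comp measurable_curve_eval).mul
      measurable_metricSpeed).lintegral_prod_right'
  have hE : ((∫⁻ γ, (∫⁻ t : I, metricSpeed γ t ^ 2) ∂π) ^ (1 / 2 : ℝ)) ≠ ∞ :=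
    ENNReal.rpow_ne_top_of_nonneg (by norm_num) hπ.energy.ne
  have hCt : ((C : ℝ≥0∞) ^ (1 / 2 : ℝ)) ≠ ∞ :=
    ENNReal.rpow_ne_top_of_nonneg (by norm_num) ENNReal.coe_ne_top
  have hfin : ∀ᵐ γ ∂π, curveIntegral (fun x => ENNReal.ofReal (G x)) γ < ∞ := by
    have h1 := lintegral_curveIntegral_le hC hGm
    have h2 := ae_lt_top (hcm hGm.enorm) (h1.trans_lt (ENNReal.mul_lt_top (ENNReal.mul_lt_top
      hCt.lt_top (Lp.eLpNorm_lt_top G)) hE.lt_top)).ne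
    filter_upwards [h2] with γ hγ
    refine lt_of_le_of_lt (lintegral_mono fun t => ?_) hγ
    gcongr
    exact Real.ofReal_le_enorm _
  -- `e n` collects the errors of replacing `f` by `u n` at the endpoints and `G` by the slope of `u
  -- n` along the curve. Its integral tends to 0, while the deficit it dominates does not depend on
  -- `n`.
  let e : ℕ → C(I, X) → ℝ≥0∞ := fun n γ => ‖u n (γ 1) - f (γ 1)‖ₑ + ‖u n (γ 0) - f (γ 0)‖ₑ +
    curveIntegral (fun x => ‖(metricSlope (u n) x).toReal - G x‖ₑ) γ
  have hint : ∀ n, ∫⁻ γ, e n γ ∂π ≤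
      C * eLpNorm (fun x => u n x - f x) 2 m + C * eLpNorm (fun x => u n x - f x) 2 m +
      (C : ℝ≥0∞) ^ (1 / 2 : ℝ) * eLpNorm (fun x => (metricSlope (u n) x).toReal - G x) 2 m *
        (∫⁻ γ, (∫⁻ t : I, metricSpeed γ t ^ 2) ∂π) ^ (1 / 2 : ℝ) := fun n => by
    have h1 : ∀ t, ∫⁻ γ, ‖u n (γ t) - f (γ t)‖ₑ ∂π ≤ C * eLpNorm (fun x => u n x - f x) 2 m :=
      fun t => by
        refine (lintegral_eval_le hC t (hdm n).enorm).trans ?_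
        gcongr
        rw [← eLpNorm_one_eq_lintegral_enorm]
        exact eLpNorm_le_eLpNorm_of_exponent_le (by norm_num) (hdm n).aestronglyMeasurable
    have hm : ∀ t, Measurable fun γ : C(I, X) => ‖u n (γ t) - f (γ t)‖ₑ := fun t =>
      ((hdm n).comp (measurable_eval_curve t)).enorm
    simp only [e]
    rw [lintegral_add_right _ (hcm (hsm n).enorm), lintegral_add_right _ (hm 0)]
    exact add_le_add (add_le_add (h1 1) (h1 0)) (lintegral_curveIntegral_le hC (hsm n))
  have hlim : Tendsto (fun n => ∫⁻ γ, e n γ ∂π) atTop (𝓝 0) := by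
    refine tendsto_of_tendsto_of_tendsto_of_le_of_le tendsto_const_nhds ?_
      (fun _ => zero_le) hint
    have h1 := ENNReal.Tendsto.const_mul (a := C) hd (Or.inr ENNReal.coe_ne_top)
    have h2 := ENNReal.Tendsto.mul_const (ENNReal.Tendsto.const_mul hs (Or.inr hCt)) (Or.inr hE)
    simpa using (h1.add h1).add h2
  have hle : ∀ n, ∀ᵐ γ ∂π, ENNReal.ofReal |f (γ 1) - f (γ 0)| -
      curveIntegral (fun x => ENNReal.ofReal (G x)) γ ≤ e n γ := fun n => by
    filter_upwards [hπ.ac] with γ hγ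
    rw [tsub_le_iff_left]
    have h1 := ofReal_abs_sub_le_curveIntegral_ascSlope (hL n) hγ
    have h2 : curveIntegral (ascSlope (u n)) γ ≤
        curveIntegral (fun x => ENNReal.ofReal (G x)) γ +
        curveIntegral (fun x => ‖(metricSlope (u n) x).toReal - G x‖ₑ) γ := by
      unfold curveIntegral
      rw [← lintegral_add_left (measurable_mul_metricSpeed hGm.ennreal_ofReal γ)]
      refine lintegral_mono fun t => ?_
      rw [← add_mul]
      gcongr
      refine (ascSlope_le_metricSlope _ _).trans ?_
      rw [← ENNReal.ofReal_toReal (LipschitzWith.metricSlope_ne_top (hL n) (γ t))]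
      calc ENNReal.ofReal (metricSlope (u n) (γ t)).toReal
          = ENNReal.ofReal (G (γ t) + ((metricSlope (u n) (γ t)).toReal - G (γ t))) := by
            rw [add_sub_cancel]
        _ ≤ ENNReal.ofReal (G (γ t)) +
            ENNReal.ofReal ((metricSlope (u n) (γ t)).toReal - G (γ t)) := ENNReal.ofReal_add_le
        _ ≤ _ := by
            gcongr
            exact Real.ofReal_le_enorm _
    have h3 : ENNReal.ofReal |f (γ 1) - f (γ 0)| ≤ ENNReal.ofReal |u n (γ 1) - u n (γ 0)| +
        (‖u n (γ 1) - f (γ 1)‖ₑ + ‖u n (γ 0) - f (γ 0)‖ₑ) := by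
      simp only [← Real.enorm_eq_ofReal_abs]
      have e1 : f (γ 1) - f (γ 0) = (u n (γ 1) - u n (γ 0)) +
          (-(u n (γ 1) - f (γ 1)) + (u n (γ 0) - f (γ 0))) := by ring
      rw [e1]
      refine (enorm_add_le _ _).trans ?_
      gcongr
      refine (enorm_add_le _ _).trans ?_
      rw [enorm_neg]
    refine h3.trans ((add_le_add_left (h1.trans h2) _).trans_eq ?_)
    simp only [e]
    ring
  have hzero : ∫⁻ γ, (ENNReal.ofReal |f (γ 1) - f (γ 0)| -
      curveIntegral (fun x => ENNReal.ofReal (G x)) γ) ∂π = 0 :=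
    le_antisymm (ge_of_tendsto' hlim fun n => lintegral_mono_ae (hle n)) zero_le
  have hmeas : Measurable fun γ : C(I, X) => ENNReal.ofReal |f (γ 1) - f (γ 0)| -
      curveIntegral (fun x => ENNReal.ofReal (G x)) γ := by
    have hft : ∀ t, Measurable fun γ : C(I, X) => f (γ t) := fun t =>
      hf.measurable.comp (measurable_eval_curve t)
    exact (((hft 1).sub (hft 0)).abs.ennreal_ofReal).sub (hcm hGm.ennreal_ofReal)
  rw [lintegral_eq_zero_iff hmeas] at hzero
  filter_upwards [hzero, hfin] with γ h1 h2
  exact ⟨tsub_eq_zero_iff_le.1 h1, h2⟩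

end RelaxedSlope


/-! ### The least slope is bounded by the contact distance. -/

section ContactBound

variable {X : Type*} [MetricSpace X] [MeasurableSpace X] [BorelSpace X]
  {m : Measure X}

/-- If `k < 0` on a set of positive measure, inner regularity gives a closed subset of positive
measure. Thickened indicators are Lipschitz, lie between 0 and 1 and converge to its indicator,
which contradicts the hypothesis in the limit. -/
lemma ae_nonneg_of_forall_lipschitz [IsFiniteMeasure m] {k : X → ℝ} (hkm : Measurable k)
    (hk : Integrable k m)
    (h : ∀ (χ : X → ℝ) (κ : ℝ≥0), LipschitzWith κ χ → (∀ x, 0 ≤ χ x) → (∀ x, χ x ≤ 1) →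
      0 ≤ ∫ x, χ x * k x ∂m) : ∀ᵐ x ∂m, 0 ≤ k x := by
  have hA : MeasurableSet {x | k x < 0} := measurableSet_lt hkm measurable_const
  by_contra hne
  have hpos : m {x | k x < 0} ≠ 0 := by
    simpa only [ae_iff, not_le] using hne
  obtain ⟨F, hFA, hF, hF0⟩ := MeasurableSet.exists_lt_isClosed_of_ne_top hA (measure_ne_top m _)
    (pos_iff_ne_zero.2 hpos)
  have hδ : ∀ n : ℕ, 0 < 1 / ((n : ℝ) + 1) := fun n => Nat.one_div_pos_of_nat
  have hlim : Tendsto (fun n : ℕ => ∫ x, (thickenedIndicator (hδ n) F x : ℝ) * k x ∂m) atTop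
      (𝓝 (∫ x, F.indicator k x ∂m)) := by
    refine tendsto_integral_of_dominated_convergence (fun x => ‖k x‖) (fun n => ?_) hk.norm
      (fun n => Eventually.of_forall fun x => ?_) (Eventually.of_forall fun x => ?_)
    · exact ((NNReal.continuous_coe.comp (thickenedIndicator (hδ n) F).continuous).measurable.mul
        hkm).aestronglyMeasurable
    · rw [norm_mul, Real.norm_of_nonneg (NNReal.coe_nonneg _)]
      exact mul_le_of_le_one_left (norm_nonneg _)
        (by exact_mod_cast thickenedIndicator_le_one (hδ n) F x)
    · have h1 := tendsto_pi_nhds.1 (thickenedIndicator_tendsto_indicator_closure hδ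
        tendsto_one_div_add_atTop_nhds_zero_nat F) x
      rw [hF.closure_eq] at h1
      have h2 := ((NNReal.continuous_coe.tendsto _).comp h1).mul_const (k x)
      have e : F.indicator k x = (F.indicator (fun _ => (1 : ℝ≥0)) x : ℝ≥0) * k x := by
        by_cases hx : x ∈ F
        · rw [indicator_of_mem hx, indicator_of_mem hx, NNReal.coe_one, one_mul]
        · rw [indicator_of_notMem hx, indicator_of_notMem hx, NNReal.coe_zero, zero_mul]
      rw [e]
      exact h2
  have h0 : 0 ≤ ∫ x, F.indicator k x ∂m := ge_of_tendsto' hlim fun n =>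
    h _ _ (LipschitzWith.of_dist_le_mul (K := (1 / ((n : ℝ) + 1)).toNNReal⁻¹) fun x y => by
      exact (lipschitzWith_thickenedIndicator (hδ n) F).dist_le_mul x y)
      (fun x => NNReal.coe_nonneg _)
      (fun x => by exact_mod_cast thickenedIndicator_le_one (hδ n) F x)
  have h1 : 0 < ∫ x, F.indicator (fun x => -k x) x ∂m := by
    rw [integral_indicator hF.measurableSet, setIntegral_pos_iff_support_of_nonneg_ae]
    · refine hF0.trans_le (measure_mono fun x hx => ⟨?_, hx⟩)
      have : k x < 0 := hFA hx
      simpa using this.ne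
    · refine (ae_restrict_iff' hF.measurableSet).2 (Eventually.of_forall fun x hx => ?_)
      have : k x < 0 := hFA hx
      simp only [Pi.zero_apply]
      linarith
    · exact hk.neg.integrableOn
  rw [integral_indicator hF.measurableSet] at h0 h1
  rw [integral_neg] at h1
  linarith

omit [MetricSpace X] [BorelSpace X] in
lemma eLpNorm_le_of_norm_le_const_add_add [IsProbabilityMeasure m] {w a b : X → ℝ} {c : ℝ}
    {κ : ℝ≥0} (ha : AEStronglyMeasurable a m) (hb : AEStronglyMeasurable b m)
    (h : ∀ x, ‖w x‖ ≤ c + ‖a x‖ + κ * ‖b x‖) :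
    eLpNorm w 2 m ≤ ‖c‖ₑ + eLpNorm a 2 m + κ * eLpNorm b 2 m := by
  have e1 : eLpNorm (fun _ : X => c) 2 m = ‖c‖ₑ := by
    rw [eLpNorm_const _ two_ne_zero (IsProbabilityMeasure.ne_zero m)]
    simp
  have e2 : eLpNorm (fun x => κ * ‖b x‖) 2 m = κ * eLpNorm b 2 m := by
    have := eLpNorm_const_smul (κ : ℝ) (fun x => ‖b x‖) 2 m
    rw [eLpNorm_norm] at this
    simpa [Pi.smul_def] using this
  rw [← e1, ← e2, ← eLpNorm_norm a]
  have hc : AEStronglyMeasurable (fun _ : X => c) m := aestronglyMeasurable_const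
  refine (eLpNorm_mono_real (g := ((fun _ => c) + fun x => ‖a x‖) + fun x => κ * ‖b x‖) h).trans
    ((eLpNorm_add_le (hc.add ha.norm) (hb.norm.const_mul _) (by norm_num)).trans ?_)
  gcongr
  exact eLpNorm_add_le hc ha.norm (by norm_num)

lemma tendsto_const_add_add {c : ℕ → ℝ} {a b : ℕ → ℝ≥0∞} {κ : ℝ≥0}
    (hc : Tendsto c atTop (𝓝 0)) (ha : Tendsto a atTop (𝓝 0)) (hb : Tendsto b atTop (𝓝 0)) :
    Tendsto (fun n => ‖c n‖ₑ + a n + κ * b n) atTop (𝓝 0) := by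
  simpa using (hc.enorm.add ha).add
    (ENNReal.Tendsto.const_mul (a := κ) hb (Or.inr ENNReal.coe_ne_top))

variable [CompactSpace X] [Nonempty X]

/-- The least slope of a `c`-concave function is bounded by the distance to the contact set. -/
lemma IsLeastSlope.ae_le_contactDist [IsProbabilityMeasure m] {φ : X → ℝ} {G : Lp ℝ 2 m}
    (hφ : IsCConcave φ) (hG : IsLeastSlope m φ G) : ∀ᵐ x ∂m, G x ≤ contactDist φ x := by
  have hφc := hφ.lipschitzWith.continuous
  have hGm : Measurable G := (Lp.stronglyMeasurable G).measurable
  have hDm : Measurable (contactDist φ) := measurable_contactDist hφ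
  have hD : MemLp (contactDist φ) 2 m := MemLp.of_bound hDm.aestronglyMeasurable (diamNN X)
    (Eventually.of_forall fun x => by
      rw [Real.norm_of_nonneg (contactDist_nonneg x)]
      exact contactDist_le_diamNN hφ x)
  -- First variation, with D the contact distance: gluing the Hopf–Lax functions (weight χ) to the
  -- optimal sequence (weight 1 - χ) gives ‖G‖² ≤ ⟨G, χD + (1 - χ)G⟩, that is, ∫ χ G (D - G) dm ≥ 0.
  have hkey : ∀ᵐ x ∂m, 0 ≤ G x * (contactDist φ x - G x) := by
    refine ae_nonneg_of_forall_lipschitz (hGm.mul (hDm.sub hGm))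
      ((Lp.memLp G).integrable_mul (hD.sub (Lp.memLp G))) fun χ κ hχ h0 h1 => ?_
    have hχm : ∀ {g : X → ℝ}, MemLp g 2 m → MemLp (fun x => χ x * g x) 2 m := fun {g} hg =>
      hg.mono (hχ.continuous.aestronglyMeasurable.mul hg.1) (Eventually.of_forall fun x => by
        rw [norm_mul, Real.norm_of_nonneg (h0 x)]
        exact mul_le_of_le_one_left (norm_nonneg _) (h1 x))
    have hχ'm : ∀ {g : X → ℝ}, MemLp g 2 m → MemLp (fun x => (1 - χ x) * g x) 2 m := fun {g} hg =>
      ((hg.sub (hχm hg)).ae_eq (Eventually.of_forall fun x => by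
        simp only [Pi.sub_apply]
        ring))
    obtain ⟨u, hu, hd, hs⟩ := hG.approx
    choose L hL using hu
    let δ : ℕ → ℝ := fun n => 1 / ((n : ℝ) + 1)
    have hδ0 : ∀ n, 0 < δ n := fun n => Nat.one_div_pos_of_nat
    have hδt : Tendsto δ atTop (𝓝 0) := tendsto_one_div_add_atTop_nhds_zero_nat
    let t : ℕ → ℝ := fun n => 1 / (1 + δ n)
    have ht0 : ∀ n, 0 < t n := fun n => by have := hδ0 n; positivity
    have ht1 : ∀ n, t n < 1 := fun n => by
      have := hδ0 n
      rw [div_lt_one (by linarith)]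
      linarith
    have htinv : ∀ n, 1 / t n = 1 + δ n := fun n => one_div_one_div _
    let v : ℕ → X → ℝ := fun n => hopfLax (cTransform φ) (t n)
    have hv : ∀ n, LipschitzWith (diamNN X / (t n).toNNReal) (v n) := fun n =>
      lipschitzWith_hopfLax (lipschitzWith_cTransform_of_continuous hφc).continuous (ht0 n)
    have hvd : ∀ n x, |v n x - φ x| ≤ diamNN X ^ 2 / 2 * δ n := fun n x => by
      have := abs_hopfLax_sub_le hφ (ht0 n) (ht1 n) x
      rwa [htinv, add_sub_cancel_left] at this
    have hvs : ∀ n x, (metricSlope (v n) x).toReal ≤ contactDist φ x * (1 + δ n) := fun n x => by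
      obtain ⟨y, hy, hxy⟩ := exists_contactDist_eq hφ x
      have h2 := ENNReal.toReal_mono ENNReal.ofReal_ne_top
        (metricSlope_hopfLax_le hφ (ht0 n) (ht1 n) hy)
      rwa [ENNReal.toReal_ofReal (div_nonneg dist_nonneg (ht0 n).le), ← hxy,
        div_eq_mul_one_div, htinv] at h2
    -- These functions dominate the slopes of the glued functions. The gluing error disappears in L²
    -- since `v n` and `u n` both converge to `φ`.
    have hW : ∀ n, MemLp (fun x => χ x * (contactDist φ x * (1 + δ n)) +
        (1 - χ x) * (metricSlope (u n) x).toReal + κ * |v n x - u n x|) 2 m := fun n =>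
      ((hχm (hD.mul_const _)).add (hχ'm (memLp_toReal_metricSlope (hL n) 2))).add
        (memLp_of_continuous (continuous_const.mul
          ((hv n).continuous.sub (hL n).continuous).abs) 2)
    have hW' : MemLp (fun x => χ x * contactDist φ x + (1 - χ x) * G x) 2 m :=
      (hχm hD).add (hχ'm (Lp.memLp G))
    have hcc : ∀ n, Continuous fun x => u n x - φ x := fun n => (hL n).continuous.sub hφc
    have hleast := hG.least (fun n => (hW n).toLp _) (hW'.toLp _) (fun ε hε => ?_) ?_
    · have e1 : inner ℝ G (hW'.toLp _) =
          ∫ x, G x * (χ x * contactDist φ x + (1 - χ x) * G x) ∂m := by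
        have := inner_toLp (Lp.memLp G) hW'
        rwa [Lp.toLp_coeFn] at this
      have e2 : ‖G‖ ^ 2 = ∫ x, G x * G x ∂m := by
        rw [← real_inner_self_eq_norm_sq, inner_eq_integral]
      have i1 := (Lp.memLp G).integrable_mul hW'
      have i2 := (Lp.memLp G).integrable_mul (Lp.memLp G)
      rw [e1, e2, ← sub_nonneg] at hleast
      refine (hleast.trans_eq (integral_sub i1 i2).symm).trans_eq ?_
      refine integral_congr_ae (Eventually.of_forall fun x => ?_)
      simp only [Pi.mul_apply]
      ring
    · have hb := tendsto_const_add_add (c := fun n => diamNN X ^ 2 / 2 * δ n) (κ := 1)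
        (by simpa using hδt.const_mul ((diamNN X : ℝ) ^ 2 / 2)) (tendsto_const_nhds (x := 0)) hd
      filter_upwards [hb.eventually (ge_mem_nhds (ENNReal.ofReal_pos.2 hε))] with n hn
      refine ⟨fun y => χ y * v n y + (1 - χ y) * u n y,
        exists_lipschitzWith_glue hχ (hv n) (hL n) h0 h1, le_trans ?_ hn, ?_⟩
      · rw [← eLpNorm_zero (μ := m) (p := 2) (α := X) (ε := ℝ)]
        refine eLpNorm_le_of_norm_le_const_add_add aestronglyMeasurable_const
          (hcc n).aestronglyMeasurable fun x => ?_
        have e : χ x * v n x + (1 - χ x) * u n x - φ x =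
            χ x * (v n x - φ x) + (1 - χ x) * (u n x - φ x) := by ring
        rw [e]
        refine (norm_add_le _ _).trans ?_
        rw [norm_mul, norm_mul, Real.norm_of_nonneg (h0 x),
          Real.norm_of_nonneg (sub_nonneg.2 (h1 x))]
        rw [Pi.zero_apply, norm_zero, add_zero, NNReal.coe_one, one_mul]
        exact add_le_add ((mul_le_of_le_one_left (norm_nonneg _) (h1 x)).trans (hvd n x))
          (mul_le_of_le_one_left (norm_nonneg _) (by linarith [h0 x]))
      · filter_upwards [(hW n).coeFn_toLp] with x hx
        rw [hx]
        refine (toReal_metricSlope_glue_le hχ (hv n) (hL n) (h0 x) (h1 x)).trans ?_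
        have h2 := mul_le_mul_of_nonneg_left (hvs n x) (h0 x)
        gcongr
    · have hstrong : Tendsto (fun n => (hW n).toLp _) atTop (𝓝 (hW'.toLp _)) := by
        rw [Lp.tendsto_Lp_iff_tendsto_eLpNorm'']
        have h2 : Tendsto (fun n => diamNN X * δ n + κ * (diamNN X ^ 2 / 2 * δ n)) atTop
            (𝓝 0) := by
          have := (hδt.const_mul (diamNN X : ℝ)).add
            ((hδt.const_mul ((diamNN X : ℝ) ^ 2 / 2)).const_mul (κ : ℝ))
          simpa using this
        refine tendsto_of_tendsto_of_tendsto_of_le_of_le tendsto_const_nhds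
          (tendsto_const_add_add (κ := κ) h2 hs hd) (fun _ => zero_le) fun n => ?_
        refine eLpNorm_le_of_norm_le_const_add_add
          ((measurable_metricSlope (hL n).continuous).ennreal_toReal.sub
            hGm).aestronglyMeasurable (hcc n).aestronglyMeasurable fun x => ?_
        have e : χ x * (contactDist φ x * (1 + δ n)) + (1 - χ x) * (metricSlope (u n) x).toReal +
            κ * |v n x - u n x| - (χ x * contactDist φ x + (1 - χ x) * G x) =
            χ x * (contactDist φ x * δ n) + (1 - χ x) * ((metricSlope (u n) x).toReal - G x) +
              κ * |v n x - u n x| := by ring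
        rw [Pi.sub_apply, e]
        refine (norm_add₃_le).trans ?_
        have hδn := (hδ0 n).le
        have a1 : ‖χ x * (contactDist φ x * δ n)‖ ≤ diamNN X * δ n := by
          rw [Real.norm_of_nonneg (mul_nonneg (h0 x) (mul_nonneg (contactDist_nonneg x) hδn))]
          refine (mul_le_of_le_one_left (mul_nonneg (contactDist_nonneg x) hδn) (h1 x)).trans ?_
          gcongr
          exact contactDist_le_diamNN hφ x
        have a2 : ‖(1 - χ x) * ((metricSlope (u n) x).toReal - G x)‖ ≤
            ‖(metricSlope (u n) x).toReal - G x‖ := by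
          rw [norm_mul, Real.norm_of_nonneg (sub_nonneg.2 (h1 x))]
          exact mul_le_of_le_one_left (norm_nonneg _) (by linarith [h0 x])
        have a3 : ‖κ * |v n x - u n x|‖ ≤
            κ * (diamNN X ^ 2 / 2 * δ n) + κ * ‖u n x - φ x‖ := by
          rw [Real.norm_of_nonneg (by positivity), ← mul_add]
          have h2 := abs_sub_le (v n x) (φ x) (u n x)
          rw [abs_sub_comm (φ x)] at h2
          have h3 := hvd n x
          rw [Real.norm_eq_abs]
          gcongr
          linarith
        linarith
      exact fun h => (tendsto_const_nhds (x := h)).inner hstrong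
  filter_upwards [hkey, hG.ae_nonneg] with x h1 h2
  by_contra! h3
  have h4 := contactDist_nonneg (φ := φ) x
  have h5 : 0 < G x := h4.trans_lt h3
  nlinarith

end ContactBound


/-! ### Convergence of the difference quotients -/

section Quotients

variable {X : Type*} [MetricSpace X] [CompactSpace X] [MeasurableSpace X] [BorelSpace X]
  {m μ₀ μ₁ : Measure X} {π : Measure C(I, X)} {φ : X → ℝ}

omit [CompactSpace X] [MeasurableSpace X] [BorelSpace X] in
lemma abs_quotient_le {L : ℝ≥0} (hφ : LipschitzWith L φ) (x y : X) :
    |(φ x - φ y) / dist x y| ≤ L := by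
  rw [abs_div, abs_of_nonneg dist_nonneg]
  exact div_le_of_le_mul₀ dist_nonneg L.2 (hφ.dist_le_mul x y)

lemma measurable_quotient (hφ : Continuous φ) (t : I) :
    Measurable fun γ : C(I, X) => (φ (γ 0) - φ (γ t)) / dist (γ 0) (γ t) := by
  have h : ∀ s : I, Measurable fun γ : C(I, X) => φ (γ s) := fun s =>
    hφ.measurable.comp (measurable_eval_curve s)
  exact ((h 0).sub (h t)).div ((measurable_eval_curve 0).dist (measurable_eval_curve t))

-- With quotient q and length l, `hlow` gives q ≥ (1 - t/2) l, hence |q - l| ≤ q - l + t l, and `hJ`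
-- gives t q ≤ J. Keeping l on the left avoids a subtraction in `ℝ≥0∞`.
omit [CompactSpace X] [MeasurableSpace X] [BorelSpace X] in
lemma IsGeodesic.ofReal_mul_quotient_le {γ : C(I, X)} (hγ : IsGeodesic γ) {t : I} (ht : 0 < t)
    (hlow : (t - (t : ℝ) ^ 2 / 2) * dist (γ 0) (γ 1) ^ 2 ≤ φ (γ 0) - φ (γ t)) {J : ℝ≥0∞}
    (hJ : ENNReal.ofReal |φ (γ t) - φ (γ 0)| ≤ edist (γ 0) (γ 1) * J) :
    ENNReal.ofReal t * (‖(φ (γ 0) - φ (γ t)) / dist (γ 0) (γ t) - dist (γ 0) (γ 1)‖ₑ +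
      edist (γ 0) (γ 1)) ≤ J + ENNReal.ofReal t * (ENNReal.ofReal t * edist (γ 0) (γ 1)) := by
  have ht' : (0 : ℝ) < t := ht
  have hd : dist (γ 0) (γ t) = t * dist (γ 0) (γ 1) := by
    rw [hγ 0 t, Icc.coe_zero, zero_sub, abs_neg, abs_of_pos ht']
  rcases (dist_nonneg (x := γ 0) (y := γ 1)).eq_or_lt with h0 | h0
  · rw [hd, edist_dist, ← h0]
    simp
  rcases eq_or_ne J ∞ with rfl | hJt
  · simp
  lift J to ℝ≥0 using hJt
  rw [hd]
  simp only [edist_dist] at hJ ⊢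
  set l := dist (γ 0) (γ 1)
  set Δ := φ (γ 0) - φ (γ t)
  rw [← ENNReal.ofReal_coe_nnreal, ← ENNReal.ofReal_mul h0.le,
    ENNReal.ofReal_le_ofReal_iff (by positivity), abs_sub_comm] at hJ
  have h1 : Δ ≤ l * J := (le_abs_self _).trans hJ
  rw [Real.enorm_eq_ofReal_abs, ← ENNReal.ofReal_add (abs_nonneg _) h0.le,
    ← ENNReal.ofReal_mul ht'.le, ← ENNReal.ofReal_mul ht'.le, ← ENNReal.ofReal_mul ht'.le,
    ← ENNReal.ofReal_coe_nnreal, ← ENNReal.ofReal_add J.coe_nonneg (by positivity)]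
  refine ENNReal.ofReal_le_ofReal ?_
  set q := Δ / (t * l) with hq
  have hΔ : Δ = q * (t * l) := by rw [hq]; field_simp
  have h2 : t * q ≤ J := by
    rw [hΔ] at h1
    nlinarith
  have h3 : (1 - t / 2) * l ≤ q := by
    rw [hΔ] at hlow
    have : t * l * ((1 - t / 2) * l) ≤ t * l * q := by nlinarith
    exact le_of_mul_le_mul_left this (by positivity)
  have h4 : |q - l| ≤ q - l + t * l := abs_le.2 ⟨by nlinarith, by nlinarith⟩
  nlinarith

/-- After integration, the short-time average of `G` is at most its initial value `E` plus a small
error. Since `E` is also the mean length, it cancels and only small terms bound the L¹ distance. -/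
lemma IsOptGeodPlan.tendsto_lintegral_quotient [IsProbabilityMeasure m] [Nonempty X]
    (hφ : IsCConcave φ) {G : X → ℝ≥0∞} (hG : IsMinimalWeakUpperGradient m φ G)
    (hπ : IsOptGeodPlan μ₀ μ₁ π) (hπt : IsTestPlan m π)
    (hc : ∀ᵐ γ ∂π, (γ 0, γ 1) ∈ contactSet φ) (hGd : ∀ᵐ γ ∂π, G (γ 0) = edist (γ 0) (γ 1)) :
    Tendsto (fun t : I => ∫⁻ γ, ‖(φ (γ 0) - φ (γ t)) / dist (γ 0) (γ t) -
      dist (γ 0) (γ 1)‖ₑ ∂π) (𝓝[>] 0) (𝓝 0) := by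
  have := hπ.prob
  have hL := hφ.lipschitzWith
  have hwG := hG.isWeakUpperGradient
  have hdm : Measurable fun γ : C(I, X) => dist (γ 0) (γ 1) :=
    (measurable_eval_curve 0).dist (measurable_eval_curve 1)
  have hem : Measurable fun γ : C(I, X) => edist (γ 0) (γ 1) :=
    (measurable_eval_curve 0).edist (measurable_eval_curve 1)
  set E := ∫⁻ γ : C(I, X), edist (γ 0) (γ 1) ∂π with hE
  have hEt : E ≠ ∞ := by
    refine ne_top_of_le_ne_top (ENNReal.coe_ne_top (r := diamNN X)) ?_
    refine (lintegral_mono fun γ : C(I, X) => edist_le_diamNN (γ 0) (γ 1)).trans_eq ?_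
    simp
  have hEG : ∫⁻ γ, G (γ 0) ∂π = E := lintegral_congr_ae hGd
  have hGL : ∀ᵐ x ∂m, G x ≤ diamNN X :=
    (hG.le_ascSlope hL).mono fun x hx => hx.trans (ascSlope_le_of_lipschitz hL x)
  have hsmall : Tendsto (fun t : I => ENNReal.ofReal t * E) (𝓝[>] 0) (𝓝 0) := by
    have h1 : Tendsto (fun t : I => ENNReal.ofReal t) (𝓝 0) (𝓝 0) := by
      have : Continuous fun t : I => ENNReal.ofReal t :=
        ENNReal.continuous_ofReal.comp continuous_subtype_val
      simpa using this.tendsto 0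
    simpa using ENNReal.Tendsto.mul_const (h1.mono_left nhdsWithin_le_nhds) (Or.inr hEt)
  rw [ENNReal.tendsto_nhds_zero]
  intro ε hε
  have hε2 : 0 < ε / 2 := ENNReal.half_pos hε.ne'
  filter_upwards [hπt.eventually_lintegral_Icc_le hwG.measurable hGL hε2,
    hsmall.eventually (ge_mem_nhds hε2), self_mem_nhdsWithin] with t h1 h2 (ht : 0 < t)
  have ht' : (0 : ℝ) < t := ht
  have hle : ∀ᵐ γ ∂π, ENNReal.ofReal t *
      (‖(φ (γ 0) - φ (γ t)) / dist (γ 0) (γ t) - dist (γ 0) (γ 1)‖ₑ + edist (γ 0) (γ 1)) ≤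
      (∫⁻ r in Icc 0 t, G (γ r)) + ENNReal.ofReal t * (ENNReal.ofReal t * edist (γ 0) (γ 1)) := by
    filter_upwards [hπ.geodesic, hc, hwG.ae_le_edist_mul hL.continuous hπt hπ.geodesic]
      with γ g1 g2 g3
    exact g1.ofReal_mul_quotient_le ht (g1.le_sub_of_mem_contactSet hL.continuous g2 t) (g3 t ht)
  have hint := lintegral_mono_ae hle
  have hqm : Measurable fun γ : C(I, X) =>
      ‖(φ (γ 0) - φ (γ t)) / dist (γ 0) (γ t) - dist (γ 0) (γ 1)‖ₑ :=
    ((measurable_quotient hL.continuous t).sub hdm).enorm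
  rw [lintegral_const_mul' _ _ ENNReal.ofReal_ne_top, lintegral_add_right _ hem,
    lintegral_add_right _ ((hem.const_mul _).const_mul _),
    lintegral_const_mul' _ _ ENNReal.ofReal_ne_top,
    lintegral_const_mul' _ _ ENNReal.ofReal_ne_top, ← hE] at hint
  have h3 := hint.trans (add_le_add_left h1 _)
  rw [← mul_add, hEG, ENNReal.mul_le_mul_iff_right (ENNReal.ofReal_pos.2 ht').ne'
    ENNReal.ofReal_ne_top, add_assoc, add_comm E, ENNReal.add_le_add_iff_right hEt] at h3
  exact h3.trans ((add_le_add_right h2 _).trans_eq (ENNReal.add_halves ε))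

lemma IsOptGeodPlan.tendsto_eLpNorm_quotient [IsProbabilityMeasure m] [Nonempty X]
    (hφ : IsCConcave φ) {G : X → ℝ≥0∞} (hG : IsMinimalWeakUpperGradient m φ G)
    (hπ : IsOptGeodPlan μ₀ μ₁ π) (hπt : IsTestPlan m π)
    (hc : ∀ᵐ γ ∂π, (γ 0, γ 1) ∈ contactSet φ) :
    MemLp (fun γ : C(I, X) => (ascSlope φ (γ 0)).toReal) 2 π ∧
    (∀ t : I, MemLp (fun γ : C(I, X) => (φ (γ 0) - φ (γ t)) / dist (γ 0) (γ t)) 2 π) ∧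
    Tendsto (fun t : I => eLpNorm (fun γ : C(I, X) =>
        (φ (γ 0) - φ (γ t)) / dist (γ 0) (γ t) - (ascSlope φ (γ 0)).toReal) 2 π)
      (𝓝[>] 0) (𝓝 0) := by
  have := hπ.prob
  have hL := hφ.lipschitzWith
  have hD := hπ.ae_eq_of_isTestPlan hφ hG hπt hc
  have hasc : ∀ γ : C(I, X), (ascSlope φ (γ 0)).toReal ≤ diamNN X := fun γ =>
    ENNReal.toReal_le_coe_of_le_coe (ascSlope_le_of_lipschitz hL _)
  have hascm : Measurable fun γ : C(I, X) => (ascSlope φ (γ 0)).toReal :=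
    ((measurable_ascSlope hL.continuous).comp (measurable_eval_curve 0)).ennreal_toReal
  have hqm := fun t : I => measurable_quotient (X := X) hL.continuous t
  refine ⟨MemLp.of_bound hascm.aestronglyMeasurable (diamNN X) (Eventually.of_forall fun γ => ?_),
    fun t => MemLp.of_bound (hqm t).aestronglyMeasurable (diamNN X)
      (Eventually.of_forall fun γ => abs_quotient_le hL _ _), ?_⟩
  · rw [Real.norm_of_nonneg ENNReal.toReal_nonneg]
    exact hasc γ
  have hlim := hπ.tendsto_lintegral_quotient hφ hG hπt hc (hD.mono fun γ h => h.1)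
  -- Quotients and lengths are bounded by the diameter, so the squared difference is at most twice
  -- the diameter times the difference: L¹ convergence implies L² convergence.
  have hlim2 : Tendsto (fun t : I => (((diamNN X + diamNN X : ℝ≥0) : ℝ≥0∞) *
      ∫⁻ γ, ‖(φ (γ 0) - φ (γ t)) / dist (γ 0) (γ t) - dist (γ 0) (γ 1)‖ₑ ∂π) ^ (1 / 2 : ℝ))
      (𝓝[>] 0) (𝓝 0) := by
    have := ((ENNReal.Tendsto.const_mul (a := ((diamNN X + diamNN X : ℝ≥0) : ℝ≥0∞)) hlim
      (Or.inr ENNReal.coe_ne_top))).ennrpow_const (1 / 2 : ℝ)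
    simpa using this
  refine tendsto_of_tendsto_of_tendsto_of_le_of_le tendsto_const_nhds hlim2
    (fun _ => zero_le) fun t => ?_
  simp only
  rw [eLpNorm_eq_lintegral_rpow_enorm_toReal two_ne_zero ENNReal.ofNat_ne_top,
    ENNReal.toReal_ofNat, ← lintegral_const_mul' _ _ ENNReal.coe_ne_top]
  refine ENNReal.rpow_le_rpow (lintegral_mono_ae ?_) (by norm_num)
  filter_upwards [hD] with γ hγ
  have e : (ascSlope φ (γ 0)).toReal = dist (γ 0) (γ 1) := by
    rw [hγ.2, edist_dist, ENNReal.toReal_ofReal dist_nonneg]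
  rw [e, ENNReal.rpow_two, sq]
  gcongr
  rw [enorm_le_coe, ← NNReal.coe_le_coe, coe_nnnorm, NNReal.coe_add]
  refine (norm_sub_le _ _).trans (add_le_add (abs_quotient_le hL _ _) ?_)
  rw [Real.norm_of_nonneg dist_nonneg]
  exact dist_le_diamNN _ _

end Quotients


/-! ### The Wasserstein distance -/

section Wasserstein

variable {X : Type*} [MetricSpace X] [CompactSpace X] [MeasurableSpace X] [BorelSpace X]
  {m : Measure X} {f₀ f₁ : X → ℝ≥0∞} {φ : X → ℝ}

omit [MetricSpace X] [CompactSpace X] [BorelSpace X] in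
lemma lintegral_fst_withDensity (hf₀ : AEMeasurable f₀ m) {μ₁ : Measure X} {ρ : Measure (X × X)}
    (hρ : IsCoupling (m.withDensity f₀) μ₁ ρ) {g : X → ℝ≥0∞} (hg : Measurable g) :
    ∫⁻ p, g p.1 ∂ρ = ∫⁻ x, g x * f₀ x ∂m := by
  rw [hρ.lintegral_fst hg, lintegral_withDensity_eq_lintegral_mul₀ hf₀ hg.aemeasurable]
  exact lintegral_congr fun x => mul_comm _ _

theorem StrongCD.ofReal_W2_sq_eq_lintegral [IsProbabilityMeasure m] {K : ℝ}
    (hCD : StrongCD m K) (hf₀ : AEMeasurable f₀ m) (hf₁ : AEMeasurable f₁ m)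
    [IsProbabilityMeasure (m.withDensity f₀)] [IsProbabilityMeasure (m.withDensity f₁)]
    (hφ : IsKantorovichPotential (m.withDensity f₀) (m.withDensity f₁) φ)
    {G : X → ℝ≥0∞} (hG : IsMinimalWeakUpperGradient m φ G) :
    ENNReal.ofReal (W2 (m.withDensity f₀) (m.withDensity f₁) ^ 2) =
      ∫⁻ x, G x ^ 2 * f₀ x ∂m := by
  have : Nonempty X := nonempty_of_isProbabilityMeasure m
  obtain ⟨ρ, hρ⟩ := exists_isOptimalCoupling (m.withDensity f₀) (m.withDensity f₁)
  rw [hρ.ofReal_W2_sq,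
    ← lintegral_fst_withDensity hf₀ hρ.1 (hG.isWeakUpperGradient.measurable.pow_const 2)]
  refine lintegral_congr_ae ?_
  filter_upwards [hCD.ae_eq_of_isOptimalCoupling hf₀ hf₁ hφ hG hρ] with p hp
  simp only [hp.1]

theorem StrongCD.ofReal_W2_sq_eq_lintegral_relaxed [IsProbabilityMeasure m] {K : ℝ}
    (hCD : StrongCD m K) (hf₀ : AEMeasurable f₀ m) (hf₁ : AEMeasurable f₁ m)
    [IsProbabilityMeasure (m.withDensity f₀)] [IsProbabilityMeasure (m.withDensity f₁)]
    (hφ : IsKantorovichPotential (m.withDensity f₀) (m.withDensity f₁) φ)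
    {R : X → ℝ} (hR : IsMinimalRelaxedSlope m φ R) :
    ENNReal.ofReal (W2 (m.withDensity f₀) (m.withDensity f₁) ^ 2) =
      ∫⁻ x, ENNReal.ofReal (R x ^ 2) * f₀ x ∂m := by
  have : Nonempty X := nonempty_of_isProbabilityMeasure m
  have hL := hφ.1.lipschitzWith
  obtain ⟨H, hH⟩ := exists_isLeastSlope (m := m) hL
  obtain ⟨G, hG⟩ := exists_isMinimalWeakUpperGradient (m := m) hL
  have hHm : Measurable H := (Lp.stronglyMeasurable H).measurable
  have hHG : ∀ᵐ x ∂m, G x ≤ ENNReal.ofReal (H x) ∧ H x ≤ contactDist φ x ∧ 0 ≤ H x := by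
    filter_upwards [hG.minimal _ (hH.isWeakUpperGradient hL.continuous),
      hH.ae_le_contactDist hφ.1, hH.ae_nonneg] with x h1 h2 h3 using ⟨h1, h2, h3⟩
  obtain ⟨ρ, hρ⟩ := exists_isOptimalCoupling (m.withDensity f₀) (m.withDensity f₁)
  have hHρ : ∀ᵐ p ∂ρ, G p.1 ≤ ENNReal.ofReal (H p.1) ∧ H p.1 ≤ contactDist φ p.1 ∧ 0 ≤ H p.1 := by
    refine ae_of_ae_map (p := fun x => G x ≤ ENNReal.ofReal (H x) ∧ H x ≤ contactDist φ x ∧ 0 ≤ H x)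
      measurable_fst.aemeasurable ?_
    rw [hρ.1.1]
    exact (withDensity_absolutelyContinuous m f₀).ae_le hHG
  have hRH : ∫⁻ x, ENNReal.ofReal (R x ^ 2) * f₀ x ∂m =
      ∫⁻ x, ENNReal.ofReal (H x ^ 2) * f₀ x ∂m := by
    refine lintegral_congr_ae ?_
    filter_upwards [hH.ae_eq hL.continuous hR] with x hx
    rw [hx]
  rw [hρ.ofReal_W2_sq, hRH,
    ← lintegral_fst_withDensity hf₀ hρ.1 (hHm.pow_const 2).ennreal_ofReal]
  refine lintegral_congr_ae ?_
  filter_upwards [hHρ, hCD.ae_eq_of_isOptimalCoupling hf₀ hf₁ hφ hG hρ,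
    hφ.ae_mem_contactSet hρ] with p h1 h2 h3
  rw [h2.1, edist_dist, ENNReal.ofReal_le_ofReal_iff h1.2.2] at h1
  -- Sandwich at a contact pair: the distance equals the weak gradient, which is at most `H`, which
  -- is at most the contact distance, which is at most the distance.
  have h4 : H p.1 = dist p.1 p.2 := le_antisymm (h1.2.1.trans (contactDist_le h3)) h1.1
  rw [h4, edist_dist, ENNReal.ofReal_pow dist_nonneg]

end Wasserstein

end MetricBrenier
-- The metric Brenier theorem.
theorem theorem7 {X : Type*} [MetricSpace X] [CompactSpace X] [MeasurableSpace X] [BorelSpace X]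
    (m : Measure X) [IsProbabilityMeasure m] (K : ℝ) (hCD : StrongCD m K)
    (f₀ f₁ : X → ℝ≥0∞) (hf₀ : AEMeasurable f₀ m) (hf₁ : AEMeasurable f₁ m)
    (hf₀_one : ∫⁻ x, f₀ x ∂m = 1) (hf₁_one : ∫⁻ x, f₁ x ∂m = 1)
    (φ : X → ℝ)
    (hφ : IsKantorovichPotential (m.withDensity f₀) (m.withDensity f₁) φ) :
    -- the two weak gradients of `φ` exist
    (∃ G : X → ℝ≥0∞, IsMinimalWeakUpperGradient m φ G) ∧
    (∃ R : X → ℝ, IsMinimalRelaxedSlope m φ R) ∧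
    -- the distance travelled is the weak gradient and the ascending slope at the initial point
    (∀ G : X → ℝ≥0∞, IsMinimalWeakUpperGradient m φ G →
      ∀ π : Measure C(I, X), IsOptGeodPlan (m.withDensity f₀) (m.withDensity f₁) π →
        ∀ᵐ γ ∂π, edist (γ 0) (γ 1) = G (γ 0) ∧ G (γ 0) = ascSlope φ (γ 0)) ∧
    -- the formula for the Wasserstein distance, with either weak gradient
    (∀ G : X → ℝ≥0∞, IsMinimalWeakUpperGradient m φ G →
      ENNReal.ofReal (W2 (m.withDensity f₀) (m.withDensity f₁) ^ 2) =
        ∫⁻ x, G x ^ 2 * f₀ x ∂m) ∧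
    (∀ R : X → ℝ, IsMinimalRelaxedSlope m φ R →
      ENNReal.ofReal (W2 (m.withDensity f₀) (m.withDensity f₁) ^ 2) =
        ∫⁻ x, ENNReal.ofReal (R x ^ 2) * f₀ x ∂m) ∧
    -- bounded densities: `L²` convergence of the difference quotients along test plans
    ((∃ C : ℝ≥0, ∀ᵐ x ∂m, f₀ x ≤ C ∧ f₁ x ≤ C) →
      (∃ π : Measure C(I, X),
        IsOptGeodPlan (m.withDensity f₀) (m.withDensity f₁) π ∧ IsTestPlan m π) ∧
      ∀ π : Measure C(I, X),
        IsOptGeodPlan (m.withDensity f₀) (m.withDensity f₁) π → IsTestPlan m π →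
          MemLp (fun γ : C(I, X) => (ascSlope φ (γ 0)).toReal) 2 π ∧
          (∀ t : I, MemLp (fun γ : C(I, X) => (φ (γ 0) - φ (γ t)) / dist (γ 0) (γ t)) 2 π) ∧
          Tendsto (fun t : I => eLpNorm (fun γ : C(I, X) =>
              (φ (γ 0) - φ (γ t)) / dist (γ 0) (γ t) - (ascSlope φ (γ 0)).toReal) 2 π)
            (𝓝[>] 0) (𝓝 0)) := by

  have : Nonempty X := nonempty_of_isProbabilityMeasure m
  have hp₀ : IsProbabilityMeasure (m.withDensity f₀) := ⟨by simpa using hf₀_one⟩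
  have hp₁ : IsProbabilityMeasure (m.withDensity f₁) := ⟨by simpa using hf₁_one⟩
  have hL := hφ.1.lipschitzWith
  have hex := exists_isMinimalWeakUpperGradient (m := m) hL
  refine ⟨hex, ?_, fun G hG π hπ => ?_, fun G hG => hCD.ofReal_W2_sq_eq_lintegral hf₀ hf₁ hφ hG,
    fun R hR => hCD.ofReal_W2_sq_eq_lintegral_relaxed hf₀ hf₁ hφ hR, ?_⟩
  · obtain ⟨H, hH⟩ := exists_isLeastSlope (m := m) hL
    exact ⟨H, hH.isMinimalRelaxedSlope hL.continuous⟩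
  · filter_upwards [ae_of_ae_map measurable_endpoints.aemeasurable
      (hCD.ae_eq_of_isOptimalCoupling hf₀ hf₁ hφ hG hπ.optimal)] with γ hγ
    exact ⟨hγ.1.symm, hγ.1.trans hγ.2.symm⟩
  · rintro ⟨C, hC⟩
    have hle : ∀ {f : X → ℝ≥0∞}, (∀ᵐ x ∂m, f x ≤ C) → m.withDensity f ≤ C • m := fun {f} hf => by
      have := withDensity_mono (μ := m) (g := fun _ => (C : ℝ≥0∞)) hf
      rwa [withDensity_const] at this
    obtain ⟨G, hG⟩ := hex
    refine ⟨hCD.exists_isOptGeodPlan_isTestPlan (hle (hC.mono fun x h => h.1))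
      (hle (hC.mono fun x h => h.2)), fun π hπ hπt => ?_⟩
    exact hπ.tendsto_eLpNorm_quotient hφ.1 hG hπt
      (ae_of_ae_map measurable_endpoints.aemeasurable (hφ.ae_mem_contactSet hπ.optimal))
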